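/- **Model.** Let $\pi\in(0,1/2)$, $\pi_1=\pi$, $\pi_2=1-\pi$, and let $\kappa=(\kappa_{a,b})_{a,b\in\{1,2\}}$ have strictly positive entries. Let $\{\mathcal G_n\}_{n\ge 0}$ be the linear preferential attachment model with attributes in $\{1,2\}$ and all out-degrees one: $\mathcal G_0$ is a finite connected graph whose vertices have attributes (if $\mathcal G_0=\{v_0\}$, then in the attachment rule below the degree of $v_0$ is initialized as $1$, i.e. is increased by one throughout); the vertex $v_{n+1}$ has attribute $a(v_{n+1})$ with law $(\pi_1,\pi_2)$, independent of the past, and, given the past and $a(v_{n+1})=b$, it attaches by one edge to $v\in\mathcal G_n$ with probability $$\frac{\kappa_{a(v),b}\,\deg(v,n)}{\sum_{v'\in\mathcal G_n}\kappa_{a(v'),b}\,\deg(v',n)} .$$ **Limiting degree laws.** Let $(\eta_1,\eta_2)$ be the minimizer of $1-\frac12\sum_{j}\pi_j\big(\log y_j+\log\sum_k y_k\kappa_{k,j}\big)$ over $y_1,y_2>0$, $y_1+y_2=1$, and put $\phi_a=\sum_b \kappa_{a,b}\,\pi_b/\sum_l\kappa_{l,b}\eta_l$. For $a\in\{1,2\}$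 let $\mathfrak D^a$ be a random variable with $$\mathbb P(\mathfrak D^a=k)=\frac{2}{\phi_a}\,\frac{\Gamma(1+2/\phi_a)\,\Gamma(k)}{\Gamma(k+1+2/\phi_a)},\qquad k\ge 1,$$ and let $\mathsf{Bin}(\mathfrak D^a,p)$ be the variable that, given $\mathfrak D^a$, is binomial with $\mathfrak D^a$ trials and success probability $p$. **Bias.** For a finite graph $G$ with attributes and $\alpha\in(0,1)$, let $\mathrm{pmn}(G;\alpha)$ be the proportion of attribute-$1$ vertices among the top $\alpha$ proportion of the vertices ranked by degree, ties included, i.e. among the vertices $v$ such that fewer than $\alpha|V(G)|$ vertices have degree strictly larger than $\deg v$. Consider two sampling schemes of density $p\in[0,1]$, each applied, for every $n$, to $\mathcal G_n$ with vertex set $V_n$ and edge set $E_n$: * *induced (node) sampling*, with $p>0$: given $\mathcal G_n$, choose a uniformly random set of $\lfloor p|V_n|\rfloor$ vertices and let $\mathcal G_n^{\rm sample}$ be the subgraph of $\mathcal G_n$ induced by it; * *incident (edge) sampling*: given $\mathcal G_n$, choose a uniformly random set of $\lfloor p|E_n|\rfloor$ edges and let $\mathcal G_n^{\rm sample}$ be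 the graph with these edges, in which all vertices of $\mathcal G_n$ are kept (those without sampled edges having degree $0$). Put $\mathrm{bias}_n=\mathrm{pmn}(\mathcal G_n^{\rm sample};\alpha)-\mathrm{pmn}(\mathcal G_n;\alpha)$. **Theorem.** Let $\mu(\cdot)=\pi\,\mathbb P(\mathfrak D^1\in\cdot)+(1-\pi)\,\mathbb P(\mathfrak D^2\in\cdot)$ and $\mu_p(\cdot)=\pi\,\mathbb P(\mathsf{Bin}(\mathfrak D^1,p)\in\cdot)+(1-\pi)\,\mathbb P(\mathsf{Bin}(\mathfrak D^2,p)\in\cdot)$. The $(1-\alpha)$ percentile of the law of an integer-valued $Z\ge 0$ is the unique integer $z\ge 0$ with $\mathbb P(Z<z)\le 1-\alpha\le \mathbb P(Z\le z)$. Suppose that $\mu$ and $\mu_p$ have such unique percentiles, $k_\alpha$ and $k_{\alpha,p}$ respectively, and that $\tilde\alpha:=\mu([k_\alpha,\infty))>\alpha$ and $\tilde\alpha_p:=\mu_p([k_{\alpha,p},\infty))>\alpha$. Then under both sampling schemes, as $n\to\infty$, $$\mathrm{bias}_n\ \stackrel{\mathrm P}{\longrightarrow}\ \pi\left(\frac{\mathbb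 P\big(\mathsf{Bin}(\mathfrak D^1,p)\ge k_{\alpha,p}\big)}{\tilde\alpha_p}-\frac{\mathbb P\big(\mathfrak D^1\ge k_\alpha\big)}{\tilde\alpha}\right).$$ -/

import Mathlib

open MeasureTheory Filter
open scoped Topology

noncomputable section

/-! ### Finite attributed networks, degree ranking -/

open Classical in
/-- The top `α` proportion of the vertices of a finite graph, ranked by degree, ties included:
`v` belongs to it iff fewer than `α |V|` vertices have degree strictly larger than `deg v`.
Equivalently, it is `{v | k ≤ deg v}` for the largest `k` such that at least `α |V|` vertices
have degree at least `k` (a `(1 - α)` percentile of the empirical degree distribution). -/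
def topDegreeSet {V : Type*} [Fintype V] (G : SimpleGraph V) (α : ℝ) : Finset V :=
  Finset.univ.filter fun v =>
    ((Finset.univ.filter fun w => G.degree v < G.degree w).card : ℝ) < α * Fintype.card V

open Classical in
/-- The proportion of vertices of attribute `b` among the top `α` proportion by degree
(`0` for the graph without vertices). -/
def topProportion {V K : Type*} [Fintype V] (G : SimpleGraph V) (attr : V → K) (b : K)
    (α : ℝ) : ℝ :=
  (((topDegreeSet G α).filter fun v => attr v = b).card : ℝ) / (topDegreeSet G α).card

/-! ### The preferential attachment tree with attributes -/

/-- The attributes of `v_1, …, v_n` and the vertices they attached to. The vertex set at time `n`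
is `V₀ ⊕ Fin n`, where `Sum.inr i` stands for the vertex `v_{i+1}`, which enters at time `i + 1`
and attaches to a vertex present at time `i`. -/
abbrev History (V₀ K : Type*) (n : ℕ) : Type _ :=
  (Fin n → K) × ((i : Fin n) → V₀ ⊕ Fin (i : ℕ))

namespace History

variable {V₀ K : Type*} {n : ℕ}

/-- The attributes of all vertices at time `n`. -/
def attr (a₀ : V₀ → K) (h : History V₀ K n) : V₀ ⊕ Fin n → K :=
  Sum.elim a₀ h.1

/-- The (undirected) network at time `n`: the base graph, together with one edge from every later
vertex to the vertex it attached to. -/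
def graph (B : SimpleGraph V₀) (h : History V₀ K n) : SimpleGraph (V₀ ⊕ Fin n) :=
  B.map (Function.Embedding.inl : V₀ ↪ V₀ ⊕ Fin n) ⊔
    SimpleGraph.fromEdgeSet (Set.range fun i : Fin n =>
      s((Sum.inr i : V₀ ⊕ Fin n), Sum.map id (Fin.castLE i.isLt.le) (h.2 i)))

variable [Fintype V₀] [Fintype K]

open Classical in
/-- The degree that drives the attachment. It is the degree in the network, except that the base
vertex carries one additional half-edge if it is the only one (so its degree is initialized
as `1`). -/
def attachDegree (B : SimpleGraph V₀) (h : History V₀ K n) (v : V₀ ⊕ Fin n) : ℝ :=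
  (h.graph B).degree v + (if v.isLeft ∧ Fintype.card V₀ = 1 then 1 else 0)

/-- The conditional probability that the next vertex attaches to `v`, given the present network
and the attribute `b` of the next vertex. -/
def attachProb (κ : K → K → ℝ) (B : SimpleGraph V₀) (a₀ : V₀ → K) (h : History V₀ K n) (b : K)
    (v : V₀ ⊕ Fin n) : ℝ :=
  κ (h.attr a₀ v) b * h.attachDegree B v / ∑ w, κ (h.attr a₀ w) b * h.attachDegree B w

open Classical in
/-- The edges of the network at time `n`, as a finite set. -/
def edges (B : SimpleGraph V₀) (h : History V₀ K n) : Finset (Sym2 (V₀ ⊕ Fin n)) :=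
  (h.graph B).edgeFinset

end History

section Dynamics

variable {V₀ K Ω : Type*} [Fintype V₀] [Fintype K] [MeasurableSpace Ω]

/-- The random history up to time `n`, when `attr i` is the attribute of `v_{i+1}` and `par i` the
vertex to which `v_{i+1}` attaches. -/
def historyAt (attr : ℕ → Ω → K) (par : (n : ℕ) → Ω → V₀ ⊕ Fin n) (n : ℕ) (ω : Ω) :
    History V₀ K n :=
  (fun i => attr i ω, fun i => par i ω)

/-- The sequence of networks encoded by `attr` and `par` follows the linear preferential
attachment model with attribute law `π`, propensity kernel `κ`, all out-degrees one, and base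
graph `B` with attributes `a₀`: the attribute of `v_{n+1}` has law `π` and is independent of the
past, and, given the past and the attribute, the vertex to which `v_{n+1}` attaches is chosen
according to `History.attachProb`. -/
structure IsAttachmentModel (ℙ : Measure Ω) (π : K → ℝ) (κ : K → K → ℝ) (B : SimpleGraph V₀)
    (a₀ : V₀ → K) (attr : ℕ → Ω → K) (par : (n : ℕ) → Ω → V₀ ⊕ Fin n) : Prop where
  measurableSet_attr : ∀ n b, MeasurableSet {ω | attr n ω = b}
  measurableSet_par : ∀ n v, MeasurableSet {ω | par n ω = v}
  attr_law : ∀ (n : ℕ) (h : History V₀ K n) (b : K),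
    ℙ.real {ω | historyAt attr par n ω = h ∧ attr n ω = b} =
      ℙ.real {ω | historyAt attr par n ω = h} * π b
  par_law : ∀ (n : ℕ) (h : History V₀ K n) (b : K) (v : V₀ ⊕ Fin n),
    ℙ.real {ω | historyAt attr par n ω = h ∧ attr n ω = b ∧ par n ω = v} =
      ℙ.real {ω | historyAt attr par n ω = h ∧ attr n ω = b} * h.attachProb κ B a₀ b v

/-- Node sampling at density `p`: for every `n`, given the network at time `n`, the set `S n` is
uniformly distributed over the sets of `⌊p |V|⌋` vertices of that network. -/
structure IsNodeSample (ℙ : Measure Ω) (attr : ℕ → Ω → K) (par : (n : ℕ) → Ω → V₀ ⊕ Fin n)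
    (p : ℝ) (S : (n : ℕ) → Ω → Finset (V₀ ⊕ Fin n)) : Prop where
  measurableSet : ∀ n T, MeasurableSet {ω | S n ω = T}
  law : ∀ (n : ℕ) (h : History V₀ K n) (T : Finset (V₀ ⊕ Fin n)),
    T.card = ⌊p * Fintype.card (V₀ ⊕ Fin n)⌋₊ →
      ℙ.real {ω | historyAt attr par n ω = h ∧ S n ω = T} =
        ℙ.real {ω | historyAt attr par n ω = h} /
          (Fintype.card (V₀ ⊕ Fin n)).choose ⌊p * Fintype.card (V₀ ⊕ Fin n)⌋₊

/-- Edge sampling at density `p`: for every `n`, given the network at time `n` with edge set `E`,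
the set `F n` is uniformly distributed over the sets of `⌊p |E|⌋` edges of that network. -/
structure IsEdgeSample (ℙ : Measure Ω) (B : SimpleGraph V₀) (attr : ℕ → Ω → K)
    (par : (n : ℕ) → Ω → V₀ ⊕ Fin n) (p : ℝ)
    (F : (n : ℕ) → Ω → Finset (Sym2 (V₀ ⊕ Fin n))) : Prop where
  measurableSet : ∀ n T, MeasurableSet {ω | F n ω = T}
  law : ∀ (n : ℕ) (h : History V₀ K n) (T : Finset (Sym2 (V₀ ⊕ Fin n))),
    T ⊆ h.edges B → T.card = ⌊p * (h.edges B).card⌋₊ →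
      ℙ.real {ω | historyAt attr par n ω = h ∧ F n ω = T} =
        ℙ.real {ω | historyAt attr par n ω = h} /
          ((h.edges B).card).choose ⌊p * (h.edges B).card⌋₊

/-- The bias of the subgraph of the network induced by the set `S` of sampled vertices. -/
def nodeBias {n : ℕ} (B : SimpleGraph V₀) (a₀ : V₀ → K) (b : K) (α : ℝ) (h : History V₀ K n)
    (S : Finset (V₀ ⊕ Fin n)) : ℝ :=
  topProportion ((h.graph B).induce {v | v ∈ S}) (fun v => h.attr a₀ v.1) b α -
    topProportion (h.graph B) (h.attr a₀) b α

/-- The bias of the subgraph of the network formed by the set `F` of sampled edges; all vertices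
are kept, a vertex without sampled edges having degree `0`. -/
def edgeBias {n : ℕ} (B : SimpleGraph V₀) (a₀ : V₀ → K) (b : K) (α : ℝ) (h : History V₀ K n)
    (F : Finset (Sym2 (V₀ ⊕ Fin n))) : ℝ :=
  topProportion (SimpleGraph.fromEdgeSet {e | e ∈ F}) (h.attr a₀) b α -
    topProportion (h.graph B) (h.attr a₀) b α

end Dynamics

/-! ### The limiting degree distributions -/

section Limit

variable {K : Type*} [Fintype K]

/-- The function `V_π` whose minimizer is the limiting vector of normalized total degrees. -/
def potential (π : K → ℝ) (κ : K → K → ℝ) (y : K → ℝ) : ℝ :=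
  1 - 1 / 2 * ∑ j, π j * (Real.log (y j) + Real.log (∑ k, y k * κ k j))

/-- The interior of the probability simplex. -/
def openSimplex (K : Type*) [Fintype K] : Set (K → ℝ) :=
  {y | (∀ j, 0 < y j) ∧ ∑ j, y j = 1}

/-- The minimizer of `potential π κ` over the interior of the simplex. -/
def etaLimit (π : K → ℝ) (κ : K → K → ℝ) : K → ℝ :=
  Classical.epsilon fun y => y ∈ openSimplex K ∧ IsMinOn (potential π κ) (openSimplex K) y

/-- The rate `φ_a = ∑_b κ_{a,b} π_b / ∑_l κ_{l,b} η_l`. -/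
def phiLimit (π : K → ℝ) (κ : K → K → ℝ) (a : K) : ℝ :=
  ∑ b, κ a b * (π b / ∑ l, κ l b * etaLimit π κ l)

/-- The limiting probability that a vertex of attribute `a` has degree `k` (for `k ≥ 1`). -/
def degreePMF (π : K → ℝ) (κ : K → K → ℝ) (a : K) (k : ℕ) : ℝ :=
  2 / phiLimit π κ a * (Real.Gamma (1 + 2 / phiLimit π κ a) * Real.Gamma k) /
    Real.Gamma (k + 1 + 2 / phiLimit π κ a)

/-- The limiting degree distribution of the vertices of attribute `a`. -/
def degreeLaw (π : K → ℝ) (κ : K → K → ℝ) (a : K) : Measure ℕ :=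
  Measure.sum fun k : ℕ => ENNReal.ofReal (degreePMF π κ a (k + 1)) • Measure.dirac (k + 1)

/-- The law of `Bin(D, p)` when `D` has law `μ`. -/
def thinning (p : unitInterval) (μ : Measure ℕ) : Measure ℕ :=
  μ.bind fun k => ProbabilityTheory.binomial k p

/-- The mixture `q μ + (1 - q) ν`. -/
def mixture (q : ℝ) (μ ν : Measure ℕ) : Measure ℕ :=
  ENNReal.ofReal q • μ + ENNReal.ofReal (1 - q) • ν

/-- `k` is the `(1 - α)` percentile of `μ`: the unique `z` with `μ (Z < z) ≤ 1 - α` and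
`1 - α ≤ μ (Z ≤ z)`. -/
def IsPercentile (μ : Measure ℕ) (α : ℝ) (k : ℕ) : Prop :=
  ∀ z : ℕ, (μ.real (Set.Iio z) ≤ 1 - α ∧ 1 - α ≤ μ.real (Set.Iic z)) ↔ z = k

end Limit

end

/-! Write T = t + 2n for the total attachment degree at time n; it is deterministic (`sum_adeg`).
Given the history, a half-edge at a vertex of attribute a attracts the next edge with probability
r_a(y)/T, where r = `rateAt` and y is the vector of shares of the two attributes in T. All drifts
are therefore explicit, and the limits of the network follow from one Lyapunov principle: a
nonnegative functional whose conditional mean grows by a factor of at most 1 + (4 - c)/T with c > 0,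
up to errors of order o(T) in mean, is o(T²) in mean (`tendsto_meanAt_div_sq_of_step`, resting on
`tendsto_zero_of_damped_recursion`).

The principle is used three times. For the squared deviation of the share from its limit η, the
criticality condition π_a/η_a + φ_a = 2 says that η is a zero of the drift, and a two-type
computation shows that the drift is contracting on the whole simplex (`exists_drift_contraction`);
convexity, in the form log x ≤ x - 1, identifies η with the minimizer of the potential
(`etaLimit_eq_of_critical`). For the number of vertices of attribute a and degree k, induction on k
leads to the balance equation of the law of D^a (`degreePMF_succ`, `tendsto_meanAt_degFreq`). For
the sum of squared degrees, the growth factor is 1 + 2φ/T with φ = max φ_a < 2, so that this sum is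
o(T²) (`tendsto_meanAt_sum_sq`).

Sampling is treated conditionally on the network. Whether v survives with sampled degree at least k
depends only on the trace of the sample on a set of about deg(v) elements. On sets of bounded size a
uniform subset of density near p has nearly the trace law of independent sampling
(`tendsto_patternCount`), and traces on disjoint sets are nearly uncorrelated; hence the number of
such v has small variance if few pairs of vertices have overlapping sets (`uniformMean_sq_sum_le`).
For edges the overlaps are O(T); for nodes they are controlled by the sum of squared degrees. The
means are binomial tails, to which the degree limits apply.

Finally, the two percentile conditions give strict inequalities: fewer than α of the mass lies above
the threshold, more than α at or above it. With probability tending to one the empirical top set is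
then exactly the set of vertices at or above the threshold (`topProportion_eq_div`), and the
proportion is a continuous function of convergent counts (`tendstoInMeasure_ratio`). Under node
sampling the probability p that a vertex is kept is a common factor and cancels. -/

noncomputable section

set_option linter.unusedSectionVars false

/-! ### Effect of one attachment step on the network and its degrees -/

namespace History

variable {V₀ K : Type*} {n : ℕ}

/-- The history extended by one vertex of attribute `b` that attaches to `v`. -/
def snoc (h : History V₀ K n) (b : K) (v : V₀ ⊕ Fin n) : History V₀ K (n + 1) :=
  (Fin.snoc h.1 b, Fin.snoc (α := fun i : Fin (n + 1) => V₀ ⊕ Fin (i : ℕ)) h.2 v)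

/-- The embedding of the vertices at time `n` into those at time `n + 1`. -/
def emb : V₀ ⊕ Fin n → V₀ ⊕ Fin (n + 1) := Sum.map id Fin.castSucc

lemma emb_injective : Function.Injective (emb : V₀ ⊕ Fin n → V₀ ⊕ Fin (n + 1)) :=
  Sum.map_injective.2 ⟨Function.injective_id, Fin.castSucc_injective n⟩

lemma emb_ne_last (x : V₀ ⊕ Fin n) : emb x ≠ Sum.inr (Fin.last n) := by
  rcases x with x | x
  · simp [emb]
  · simp [emb]

@[simp] lemma attr_snoc_emb (a₀ : V₀ → K) (h : History V₀ K n) (b : K) (v x : V₀ ⊕ Fin n) :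
    (h.snoc b v).attr a₀ (emb x) = h.attr a₀ x := by
  rcases x with x | x <;> simp [attr, emb, snoc]

@[simp] lemma attr_snoc_last (a₀ : V₀ → K) (h : History V₀ K n) (b : K) (v : V₀ ⊕ Fin n) :
    (h.snoc b v).attr a₀ (Sum.inr (Fin.last n)) = b := by
  simp [attr, snoc]

/-- `fromEdgeSet` discards loops, but none arise here: the parent of a vertex has a strictly smaller
index. The condition x ≠ y can therefore be dropped. -/
lemma graph_adj (B : SimpleGraph V₀) (h : History V₀ K n) (x y : V₀ ⊕ Fin n) :
    (h.graph B).Adj x y ↔ (∃ a b, B.Adj a b ∧ Sum.inl a = x ∧ Sum.inl b = y) ∨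
      ∃ i : Fin n, s((Sum.inr i : V₀ ⊕ Fin n), Sum.map id (Fin.castLE i.isLt.le) (h.2 i)) =
        s(x, y) := by
  rw [graph, SimpleGraph.sup_adj, SimpleGraph.map_adj, SimpleGraph.fromEdgeSet_adj]
  refine or_congr Iff.rfl ⟨fun hh => hh.1, fun hh => ⟨hh, ?_⟩⟩
  obtain ⟨i, hi⟩ := hh
  rintro rfl
  have h1 : Sum.map id (Fin.castLE i.isLt.le) (h.2 i) = (Sum.inr i : V₀ ⊕ Fin n) := by
    have h2 := (Sym2.eq_iff.1 hi)
    rcases h2 with h2 | h2 <;> rw [h2.1, h2.2]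
  rcases hv : h.2 i with x | x
  · simp [hv] at h1
  · rw [hv] at h1
    simp only [Sum.map_inr, Sum.inr.injEq] at h1
    have := congrArg Fin.val h1
    have h3 := x.isLt
    simp at this
    omega

lemma graph_snoc_adj_emb_emb (B : SimpleGraph V₀) (h : History V₀ K n) (b : K)
    (v x y : V₀ ⊕ Fin n) :
    ((h.snoc b v).graph B).Adj (emb x) (emb y) ↔ (h.graph B).Adj x y := by
  rw [graph_adj, graph_adj]
  refine or_congr ?_ ?_
  · refine exists_congr fun a => exists_congr fun c => and_congr_right fun _ => ?_
    have (z : V₀) (w : V₀ ⊕ Fin n) : Sum.inl z = emb w ↔ Sum.inl z = w := by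
      rcases w with w | w <;> simp [emb]
    rw [this, this]
  · constructor
    · rintro ⟨i, hi⟩
      induction i using Fin.lastCases with
      | last =>
        exfalso
        rcases Sym2.eq_iff.1 hi with h2 | h2
        · exact emb_ne_last _ h2.1.symm
        · exact emb_ne_last _ h2.1.symm
      | cast i =>
        refine ⟨i, Sym2.map.injective emb_injective ?_⟩
        simp only [Sym2.map_mk]
        rw [← hi]
        simp only [snoc, Fin.snoc_castSucc]
        rcases h.2 i with z | z <;> simp [emb]
    · rintro ⟨i, hi⟩
      refine ⟨i.castSucc, ?_⟩
      have := congrArg (Sym2.map emb) hi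
      simp only [Sym2.map_mk] at this
      rw [← this]
      simp only [snoc, Fin.snoc_castSucc]
      rcases h.2 i with z | z <;> simp [emb]

lemma graph_snoc_adj_emb_last (B : SimpleGraph V₀) (h : History V₀ K n) (b : K)
    (v x : V₀ ⊕ Fin n) :
    ((h.snoc b v).graph B).Adj (emb x) (Sum.inr (Fin.last n)) ↔ x = v := by
  have hv : Sum.map id (Fin.castLE (Fin.last n).isLt.le) ((h.snoc b v).2 (Fin.last n)) = emb v := by
    simp only [snoc, Fin.snoc_last]
    rcases v with z | z <;> simp [emb]
    rfl
  rw [graph_adj]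
  constructor
  · rintro (⟨a, c, -, -, hc⟩ | ⟨i, hi⟩)
    · simp at hc
    · induction i using Fin.lastCases with
      | last =>
        rw [hv] at hi
        rcases Sym2.eq_iff.1 hi with h2 | h2
        · exact absurd h2.1.symm (emb_ne_last _)
        · exact (emb_injective h2.2).symm
      | cast i =>
        exfalso
        rcases Sym2.eq_iff.1 hi with h2 | h2
        · have h3 := h2.2
          simp only [snoc, Fin.snoc_castSucc] at h3
          rcases hz : h.2 i with z | z
          · simp [hz] at h3
          · rw [hz] at h3
            simp only [Sum.map_inr, Sum.inr.injEq] at h3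
            have h4 := congrArg Fin.val h3
            have h5 := z.isLt
            have h6 := i.isLt
            simp at h4
            omega
        · exact absurd (Sum.inr_injective h2.1) (Fin.castSucc_lt_last i).ne
  · rintro rfl
    exact Or.inr ⟨Fin.last n, by rw [hv, Sym2.eq_swap]⟩

section Degrees

variable [Fintype V₀]

lemma sum_emb_add {M : Type*} [AddCommMonoid M] (f : V₀ ⊕ Fin (n + 1) → M) :
    ∑ w, f w = ∑ x : V₀ ⊕ Fin n, f (emb x) + f (Sum.inr (Fin.last n)) := by
  rw [Fintype.sum_sum_type, Fintype.sum_sum_type, Fin.sum_univ_castSucc, ← add_assoc]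
  rfl

open Classical in
/-- The degree that drives the attachment, as a natural number. -/
def adeg (B : SimpleGraph V₀) (h : History V₀ K n) (v : V₀ ⊕ Fin n) : ℕ :=
  (h.graph B).degree v + (if v.isLeft ∧ Fintype.card V₀ = 1 then 1 else 0)

lemma attachDegree_eq (B : SimpleGraph V₀) (h : History V₀ K n) (v : V₀ ⊕ Fin n) :
    h.attachDegree B v = h.adeg B v := by
  simp [attachDegree, adeg]

open Classical in
lemma degree_eq_sum {V : Type*} [Fintype V] (G : SimpleGraph V) (v : V)
    [Fintype (G.neighborSet v)] : G.degree v = ∑ w, if G.Adj v w then 1 else 0 := by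
  rw [← SimpleGraph.card_neighborFinset_eq_degree, ← Finset.card_filter]
  congr 1
  ext w
  simp

open Classical in
lemma degree_snoc_emb (B : SimpleGraph V₀) (h : History V₀ K n) (b : K) (v x : V₀ ⊕ Fin n) :
    ((h.snoc b v).graph B).degree (emb x) = (h.graph B).degree x + if x = v then 1 else 0 := by
  rw [degree_eq_sum, degree_eq_sum, sum_emb_add]
  simp only [graph_snoc_adj_emb_emb, graph_snoc_adj_emb_last]

open Classical in
lemma degree_snoc_last (B : SimpleGraph V₀) (h : History V₀ K n) (b : K) (v : V₀ ⊕ Fin n) :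
    ((h.snoc b v).graph B).degree (Sum.inr (Fin.last n)) = 1 := by
  rw [degree_eq_sum, sum_emb_add]
  simp [SimpleGraph.adj_comm _ (Sum.inr (Fin.last n)), graph_snoc_adj_emb_last]

open Classical in
lemma adeg_snoc_emb (B : SimpleGraph V₀) (h : History V₀ K n) (b : K) (v x : V₀ ⊕ Fin n) :
    (h.snoc b v).adeg B (emb x) = h.adeg B x + if x = v then 1 else 0 := by
  rw [adeg, adeg, degree_snoc_emb]
  have : (emb x : V₀ ⊕ Fin (n + 1)).isLeft = x.isLeft := by rcases x with x | x <;> simp [emb]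
  rw [this]
  ring

lemma adeg_snoc_last (B : SimpleGraph V₀) (h : History V₀ K n) (b : K) (v : V₀ ⊕ Fin n) :
    (h.snoc b v).adeg B (Sum.inr (Fin.last n)) = 1 := by
  rw [adeg, degree_snoc_last]
  simp

/-- The sum of a function of attribute and degree over the vertices. -/
def degSum (B : SimpleGraph V₀) (a₀ : V₀ → K) (f : K → ℕ → ℝ) (h : History V₀ K n) : ℝ :=
  ∑ w, f (h.attr a₀ w) (h.adeg B w)

/-- One step changes only two summands: the new vertex contributes a leaf, and the parent moves from
degree d to d + 1. Every drift computed below starts from this. -/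
lemma degSum_snoc (B : SimpleGraph V₀) (a₀ : V₀ → K) (f : K → ℕ → ℝ) (h : History V₀ K n)
    (b : K) (v : V₀ ⊕ Fin n) :
    degSum B a₀ f (h.snoc b v) = degSum B a₀ f h +
      (f b 1 + (f (h.attr a₀ v) (h.adeg B v + 1) - f (h.attr a₀ v) (h.adeg B v))) := by
  classical
  have key : ∑ x, f (h.attr a₀ x) (h.adeg B x + if x = v then 1 else 0) =
      ∑ x, f (h.attr a₀ x) (h.adeg B x) +
        (f (h.attr a₀ v) (h.adeg B v + 1) - f (h.attr a₀ v) (h.adeg B v)) := by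
    rw [← sub_eq_iff_eq_add', ← Finset.sum_sub_distrib, Finset.sum_eq_single v]
    · simp
    · intro x _ hx
      simp [hx]
    · simp
  rw [degSum, sum_emb_add]
  simp only [attr_snoc_emb, attr_snoc_last, adeg_snoc_emb, adeg_snoc_last]
  rw [key, degSum]
  ring

end Degrees

end History

/-! ### A deterministic recursion with divergent total damping -/

/-- With T = t + 2n one has (T + 2)² = T² + 4T + 4, so the recursion multiplies e by about 1 - c/T.
Since ∑ 1/T diverges, any initial value is forgotten and only the vanishing forcing r remains. -/
lemma tendsto_zero_of_damped_recursion {e r : ℕ → ℝ} {t c : ℝ} (ht : 1 ≤ t) (hc : 0 < c) (hc4 : c ≤ 4)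
    (he : ∀ n, 0 ≤ e n) (hr : Tendsto r atTop (𝓝 0))
    (hrec : ∀ n : ℕ, e (n + 1) * (t + 2 * n + 2) ^ 2 ≤
      e n * ((t + 2 * n) ^ 2 + (4 - c) * (t + 2 * n)) + (t + 2 * n) * r n) :
    Tendsto e atTop (𝓝 0) := by
  rw [Metric.tendsto_atTop]
  intro ε hε
  obtain ⟨n₀, hn₀⟩ := (Metric.tendsto_atTop.1 hr) (c * (ε / 2)) (by positivity)
  -- Once r n ≤ c ε/2, the level ε/2 is not left upwards, because ε/2 (T² + (4 - c)T) + T c ε/2 ≤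
  -- ε/2 (T + 2)². The excess over this level satisfies a homogeneous recursion.
  set f : ℕ → ℝ := fun n => max (e n - ε / 2) 0 with hf
  -- A lower bound for the damping cT/(T + 2)²: as T, t ≥ 1, (T + 2)² ≤ T(T + 8t) ≤ 9t(n + 1)T. The
  -- shape c'/(n + 1) reduces divergence to the harmonic series.
  set a : ℕ → ℝ := fun n => c / (9 * t) * (1 / ((n : ℝ) + 1)) with ha
  have hstep : ∀ n, n₀ ≤ n → f (n + 1) ≤ f n * Real.exp (-a n) := by
    intro n hn
    have hT : (1 : ℝ) ≤ t + 2 * n := by have := Nat.cast_nonneg (α := ℝ) n; linarith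
    set T := t + 2 * (n : ℝ) with hTdef
    have h1 : r n ≤ c * (ε / 2) := by
      have := hn₀ n hn
      rw [Real.dist_eq, sub_zero] at this
      exact (abs_lt.1 this).2.le
    have hexp : 1 - a n ≤ Real.exp (-a n) := by
      have := Real.add_one_le_exp (-a n); linarith
    have hfn : 0 ≤ f n := le_max_right _ _
    refine max_le ?_ (by positivity)
    have h2 : e n - ε / 2 ≤ f n := le_max_left _ _
    have han : a n * (T + 2) ^ 2 ≤ c * T := by
      have h4 : T + 2 ≤ 3 * T := by linarith
      have h5 : T ≤ t * (2 * (n + 1)) := by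
        have := Nat.cast_nonneg (α := ℝ) n
        nlinarith
      have h3 : a n = c / (9 * t * (n + 1)) := by
        simp only [ha]; field_simp
      rw [h3, div_mul_eq_mul_div, div_le_iff₀ (by positivity)]
      have h6 : (T + 2) ^ 2 ≤ 9 * T * T := by nlinarith
      have h7 : T * T ≤ T * (t * (2 * (n + 1))) := by gcongr
      have h8 : (T + 2) ^ 2 ≤ T * (9 * t * (n + 1)) := by
        have h9 : T ≤ t * (n + 1) * 2 := by linarith
        have h10 : (T + 2) ^ 2 = T ^ 2 + 4 * T + 4 := by ring
        have h11 : T ≤ t * (1 + 2 * n) := by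
          have := Nat.cast_nonneg (α := ℝ) n
          nlinarith
        have h12 : 0 ≤ (n : ℝ) := Nat.cast_nonneg n
        have h13 : T + 8 * t ≤ 9 * t * (n + 1) := by nlinarith
        have h14 : (T + 2) ^ 2 ≤ T * (T + 8 * t) := by nlinarith
        exact h14.trans (by gcongr)
      calc c * (T + 2) ^ 2 ≤ c * (T * (9 * t * (n + 1))) := by gcongr
        _ = _ := by ring
    have h3 := hrec n
    have hA : (0 : ℝ) < (T + 2) ^ 2 := by positivity
    have h5 : (e (n + 1) - ε / 2) * (T + 2) ^ 2 ≤ f n * (1 - a n) * (T + 2) ^ 2 := by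
      rcases le_total (e n) (ε / 2) with hle | hle
      · have hmul : 0 ≤ e n := he n
        have hpos : 0 ≤ T ^ 2 + (4 - c) * T :=
          add_nonneg (sq_nonneg T) (mul_nonneg (by linarith) (by linarith))
        have : e n * (T ^ 2 + (4 - c) * T) ≤ ε / 2 * (T ^ 2 + (4 - c) * T) := by gcongr
        have h6 : T * r n ≤ T * (c * (ε / 2)) := by gcongr
        have h7 : f n = 0 := max_eq_right (by linarith)
        rw [h7]
        nlinarith
      · have h6 : T * r n ≤ T * (c * (ε / 2)) := by gcongr
        have h7 : f n = e n - ε / 2 := max_eq_left (by linarith)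
        rw [h7]
        have h8 : (e n - ε / 2) * (a n * (T + 2) ^ 2) ≤ (e n - ε / 2) * (c * T) := by
          gcongr
        nlinarith
    have h6 := le_of_mul_le_mul_right h5 hA
    calc _ ≤ f n * (1 - a n) := h6
      _ ≤ _ := by gcongr
  have hbound : ∀ m, f (n₀ + m) ≤ f n₀ * Real.exp (-∑ i ∈ Finset.range m, a (n₀ + i)) := by
    intro m
    induction m with
    | zero => simp
    | succ m ih =>
      refine (hstep (n₀ + m) (by omega)).trans ?_
      rw [Finset.sum_range_succ, neg_add, Real.exp_add, ← mul_assoc]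
      gcongr
  have hdiv : Tendsto (fun m => ∑ i ∈ Finset.range m, a (n₀ + i)) atTop atTop := by
    have h1 : Tendsto (fun m => ∑ i ∈ Finset.range m, a i) atTop atTop := by
      simp only [ha, ← Finset.mul_sum]
      exact (Real.tendsto_sum_range_one_div_nat_succ_atTop).const_mul_atTop (by positivity)
    have h2 : (fun m => ∑ i ∈ Finset.range m, a (n₀ + i)) = fun m =>
        (∑ i ∈ Finset.range (m + n₀), a i) + (-∑ i ∈ Finset.range n₀, a i) := by
      funext m
      rw [add_comm m n₀, Finset.sum_range_add]
      ring
    rw [h2]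
    exact tendsto_atTop_add_const_right _ _ (h1.comp (tendsto_add_atTop_nat n₀))
  have hlim : Tendsto (fun m => f n₀ * Real.exp (-∑ i ∈ Finset.range m, a (n₀ + i))) atTop
      (𝓝 (f n₀ * 0)) :=
    (Real.tendsto_exp_neg_atTop_nhds_zero.comp hdiv).const_mul _
  rw [mul_zero] at hlim
  obtain ⟨m₀, hm₀⟩ := (Metric.tendsto_atTop.1 hlim) (ε / 2) (by positivity)
  refine ⟨n₀ + m₀, fun n hn => ?_⟩
  obtain ⟨m, rfl⟩ := Nat.exists_eq_add_of_le (show n₀ ≤ n by omega)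
  have h1 := hm₀ m (by omega)
  rw [Real.dist_eq, sub_zero] at h1
  have h2 := (le_abs_self _).trans_lt h1
  have h3 := (le_max_left (e (n₀ + m) - ε / 2) 0).trans (hbound m)
  rw [Real.dist_eq, sub_zero, abs_of_nonneg (he _)]
  linarith

/-! ### Expectations of functions of finitely-valued variables -/

section FiniteLaw

variable {Ω : Type*} [MeasurableSpace Ω] (ℙ : Measure Ω) [IsProbabilityMeasure ℙ]

omit [MeasurableSpace Ω] in
lemma comp_eq_sum_indicator {α : Type*} [Fintype α] (X : Ω → α) (f : α → ℝ) :
    (fun ω => f (X ω)) = fun ω => ∑ a, Set.indicator {ω | X ω = a} (fun _ => f a) ω := by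
  funext ω
  rw [Finset.sum_eq_single (X ω)]
  · simp
  · intro b _ hb
    simp [Ne.symm hb]
  · simp

lemma integrable_comp_of_fintype {α : Type*} [Fintype α] (X : Ω → α)
    (hX : ∀ a, MeasurableSet {ω | X ω = a}) (f : α → ℝ) : Integrable (fun ω => f (X ω)) ℙ := by
  rw [comp_eq_sum_indicator]
  exact integrable_finsetSum _ fun a _ => (integrable_const _).indicator (hX a)

lemma integral_comp_of_fintype {α : Type*} [Fintype α] (X : Ω → α)
    (hX : ∀ a, MeasurableSet {ω | X ω = a}) (f : α → ℝ) :
    ∫ ω, f (X ω) ∂ℙ = ∑ a, ℙ.real {ω | X ω = a} * f a := by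
  rw [comp_eq_sum_indicator, integral_finsetSum]
  · refine Finset.sum_congr rfl fun a _ => ?_
    rw [integral_indicator_const _ (hX a), smul_eq_mul]
  · intro a _
    exact (integrable_const _).indicator (hX a)

end FiniteLaw

open History

/-! ### Means over histories and conditional means of one step -/

section Mean


variable {V₀ K Ω : Type*} [Fintype V₀] [Fintype K] [MeasurableSpace Ω]

lemma historyAt_succ (attr : ℕ → Ω → K) (par : (n : ℕ) → Ω → V₀ ⊕ Fin n) (n : ℕ) (ω : Ω) :
    historyAt attr par (n + 1) ω = (historyAt attr par n ω).snoc (attr n ω) (par n ω) := by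
  refine Prod.ext ?_ ?_
  · funext i
    induction i using Fin.lastCases <;> simp [historyAt, snoc]
  · funext i
    induction i using Fin.lastCases with
    | last => simp [historyAt, snoc]
    | cast i =>
      simp only [historyAt, snoc, Fin.snoc_castSucc]
      rfl

/-- The mean of a function of the history at time `n`. -/
def meanAt (ℙ : Measure Ω) (attr : ℕ → Ω → K) (par : (n : ℕ) → Ω → V₀ ⊕ Fin n) (n : ℕ)
    (F : History V₀ K n → ℝ) : ℝ :=
  ∑ h, ℙ.real {ω | historyAt attr par n ω = h} * F h

/-- The conditional mean, given the history, of a function of the attribute of the next vertex and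
the vertex it attaches to. -/
def stepMean (π : K → ℝ) (κ : K → K → ℝ) (B : SimpleGraph V₀) (a₀ : V₀ → K) {n : ℕ}
    (h : History V₀ K n) (G : K → V₀ ⊕ Fin n → ℝ) : ℝ :=
  ∑ b, π b * ∑ v, h.attachProb κ B a₀ b v * G b v

section Algebra

variable (ℙ : Measure Ω) (attr : ℕ → Ω → K) (par : (n : ℕ) → Ω → V₀ ⊕ Fin n) (n : ℕ)
  (F G : History V₀ K n → ℝ)

lemma meanAt_add : meanAt ℙ attr par n (fun h => F h + G h) =
    meanAt ℙ attr par n F + meanAt ℙ attr par n G := by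
  simp [meanAt, mul_add, Finset.sum_add_distrib]

lemma meanAt_const_mul (c : ℝ) : meanAt ℙ attr par n (fun h => c * F h) =
    c * meanAt ℙ attr par n F := by
  simp only [meanAt, Finset.mul_sum]
  exact Finset.sum_congr rfl fun _ _ => by ring

lemma meanAt_div (c : ℝ) : meanAt ℙ attr par n (fun h => F h / c) =
    meanAt ℙ attr par n F / c := by
  simp only [div_eq_inv_mul, meanAt_const_mul]

lemma meanAt_finsetSum {ι : Type*} (s : Finset ι) (F : ι → History V₀ K n → ℝ) :
    meanAt ℙ attr par n (fun h => ∑ i ∈ s, F i h) = ∑ i ∈ s, meanAt ℙ attr par n (F i) := by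
  simp only [meanAt, Finset.mul_sum]
  exact Finset.sum_comm

variable {F G}

lemma meanAt_mono (hFG : ∀ h, F h ≤ G h) : meanAt ℙ attr par n F ≤ meanAt ℙ attr par n G :=
  Finset.sum_le_sum fun h _ => mul_le_mul_of_nonneg_left (hFG h) measureReal_nonneg

lemma meanAt_nonneg (hF : ∀ h, 0 ≤ F h) : 0 ≤ meanAt ℙ attr par n F :=
  Finset.sum_nonneg fun h _ => mul_nonneg measureReal_nonneg (hF h)

end Algebra

lemma stepMean_mono {π : K → ℝ} {κ : K → K → ℝ} {B : SimpleGraph V₀} {a₀ : V₀ → K} {n : ℕ}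
    {h : History V₀ K n} (hπ : ∀ b, 0 ≤ π b) (hκ : ∀ a b, 0 < κ a b)
    {G G' : K → V₀ ⊕ Fin n → ℝ} (hG : ∀ b v, G b v ≤ G' b v) :
    stepMean π κ B a₀ h G ≤ stepMean π κ B a₀ h G' := by
  have hd : ∀ w, 0 ≤ h.attachDegree B w := fun w => by rw [attachDegree_eq]; positivity
  refine Finset.sum_le_sum fun b _ => mul_le_mul_of_nonneg_left ?_ (hπ b)
  refine Finset.sum_le_sum fun v _ => mul_le_mul_of_nonneg_left (hG b v) ?_
  exact div_nonneg (mul_nonneg (hκ _ _).le (hd v))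
    (Finset.sum_nonneg fun w _ => mul_nonneg (hκ _ _).le (hd w))

lemma stepMean_add (π : K → ℝ) (κ : K → K → ℝ) (B : SimpleGraph V₀) (a₀ : V₀ → K) {n : ℕ}
    (h : History V₀ K n) (G G' : K → V₀ ⊕ Fin n → ℝ) :
    stepMean π κ B a₀ h (fun b v => G b v + G' b v) =
      stepMean π κ B a₀ h G + stepMean π κ B a₀ h G' := by
  simp [stepMean, mul_add, Finset.sum_add_distrib]

lemma stepMean_const_mul (π : K → ℝ) (κ : K → K → ℝ) (B : SimpleGraph V₀) (a₀ : V₀ → K) {n : ℕ}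
    (h : History V₀ K n) (c : ℝ) (G : K → V₀ ⊕ Fin n → ℝ) :
    stepMean π κ B a₀ h (fun b v => c * G b v) = c * stepMean π κ B a₀ h G := by
  simp only [stepMean, Finset.mul_sum]
  exact Finset.sum_congr rfl fun _ _ => Finset.sum_congr rfl fun _ _ => by ring

section Model

variable {ℙ : Measure Ω} [IsProbabilityMeasure ℙ] {π : K → ℝ} {κ : K → K → ℝ}
  {B : SimpleGraph V₀} {a₀ : V₀ → K} {attr : ℕ → Ω → K} {par : (n : ℕ) → Ω → V₀ ⊕ Fin n}

lemma measurableSet_historyAt (hm : IsAttachmentModel ℙ π κ B a₀ attr par) (n : ℕ)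
    (h : History V₀ K n) : MeasurableSet {ω | historyAt attr par n ω = h} := by
  have : {ω | historyAt attr par n ω = h} =
      (⋂ i : Fin n, {ω | attr i ω = h.1 i}) ∩ ⋂ i : Fin n, {ω | par i ω = h.2 i} := by
    ext ω
    simp [historyAt, Prod.ext_iff, funext_iff]
  rw [this]
  exact (MeasurableSet.iInter fun i => hm.measurableSet_attr _ _).inter
    (MeasurableSet.iInter fun i => hm.measurableSet_par _ _)

lemma integrable_historyAt (hm : IsAttachmentModel ℙ π κ B a₀ attr par) (n : ℕ)
    (F : History V₀ K n → ℝ) : Integrable (fun ω => F (historyAt attr par n ω)) ℙ :=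
  integrable_comp_of_fintype ℙ _ (measurableSet_historyAt hm n) F

lemma integral_historyAt (hm : IsAttachmentModel ℙ π κ B a₀ attr par) (n : ℕ)
    (F : History V₀ K n → ℝ) :
    ∫ ω, F (historyAt attr par n ω) ∂ℙ = meanAt ℙ attr par n F :=
  integral_comp_of_fintype ℙ _ (measurableSet_historyAt hm n) F

lemma meanAt_const (hm : IsAttachmentModel ℙ π κ B a₀ attr par) (n : ℕ) (c : ℝ) :
    meanAt ℙ attr par n (fun _ => c) = c := by
  rw [← integral_historyAt hm n]
  simp

/-- The tower property: multiplying `attr_law` by `par_law` gives the joint law of the history, the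
next attribute and the next parent. Afterwards all arguments about the network are finite sums. -/
lemma meanAt_succ (hm : IsAttachmentModel ℙ π κ B a₀ attr par) (n : ℕ)
    (F : History V₀ K (n + 1) → ℝ) :
    meanAt ℙ attr par (n + 1) F =
      meanAt ℙ attr par n fun h => stepMean π κ B a₀ h fun b v => F (h.snoc b v) := by
  rw [← integral_historyAt hm]
  simp only [historyAt_succ]
  rw [integral_comp_of_fintype ℙ (fun ω => (historyAt attr par n ω, attr n ω, par n ω))
    ?_ (fun x => F (x.1.snoc x.2.1 x.2.2)), Fintype.sum_prod_type]
  · refine Finset.sum_congr rfl fun h _ => ?_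
    rw [Fintype.sum_prod_type]
    simp only [stepMean]
    rw [Finset.mul_sum]
    refine Finset.sum_congr rfl fun b _ => ?_
    rw [← mul_assoc, ← hm.attr_law, Finset.mul_sum]
    refine Finset.sum_congr rfl fun v _ => ?_
    rw [← mul_assoc, ← hm.par_law]
    simp only [Prod.mk.injEq]
  · rintro ⟨h, b, v⟩
    simp only [Prod.mk.injEq]
    exact (measurableSet_historyAt hm n h).inter
      ((hm.measurableSet_attr n b).inter (hm.measurableSet_par n v))

/-- Jensen's inequality, from expanding (|F| - c)² ≥ 0 with c the mean of |F|. -/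
lemma meanAt_abs_sq_le (hm : IsAttachmentModel ℙ π κ B a₀ attr par) (n : ℕ)
    (F : History V₀ K n → ℝ) :
    meanAt ℙ attr par n (fun h => |F h|) ^ 2 ≤ meanAt ℙ attr par n fun h => F h ^ 2 := by
  set c := meanAt ℙ attr par n (fun h => |F h|)
  have h1 : meanAt ℙ attr par n (fun h => 2 * c * |F h|) ≤
      meanAt ℙ attr par n (fun h => F h ^ 2 + c ^ 2) := by
    refine meanAt_mono _ _ _ _ fun h => ?_
    nlinarith [sq_nonneg (|F h| - c), sq_abs (F h)]
  rw [meanAt_const_mul, meanAt_add, meanAt_const hm] at h1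
  change 2 * c * c ≤ _ at h1
  linarith

lemma tendsto_meanAt_abs (hm : IsAttachmentModel ℙ π κ B a₀ attr par)
    {F : ∀ n, History V₀ K n → ℝ}
    (hF : Tendsto (fun n => meanAt ℙ attr par n fun h => F n h ^ 2) atTop (𝓝 0)) :
    Tendsto (fun n => meanAt ℙ attr par n fun h => |F n h|) atTop (𝓝 0) := by
  have h1 : Tendsto (fun n => Real.sqrt (meanAt ℙ attr par n fun h => F n h ^ 2)) atTop (𝓝 0) := by
    simpa using hF.sqrt
  refine squeeze_zero (fun n => meanAt_nonneg _ _ _ _ fun h => abs_nonneg _) (fun n => ?_) h1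
  exact Real.le_sqrt_of_sq_le (meanAt_abs_sq_le hm n (F n))

/-- A nonnegative functional whose conditional growth factor is at most `1 + (4 - c) / T` up to
small errors is negligible with respect to the square of the total degree `T`. -/
lemma tendsto_meanAt_div_sq_of_step (hm : IsAttachmentModel ℙ π κ B a₀ attr par)
    {t c : ℝ} (ht : 1 ≤ t) (hc : 0 < c) (hc4 : c ≤ 4) {F R : ∀ n, History V₀ K n → ℝ}
    (hF : ∀ n h, 0 ≤ F n h)
    (hR : Tendsto (fun n => meanAt ℙ attr par n (R n)) atTop (𝓝 0))
    (hstep : ∀ n h, stepMean π κ B a₀ h (fun b v => F (n + 1) (h.snoc b v)) ≤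
      F n h + (4 - c) * F n h / (t + 2 * n) + (t + 2 * n) * R n h) :
    Tendsto (fun n : ℕ => meanAt ℙ attr par n (F n) / (t + 2 * n) ^ 2) atTop (𝓝 0) := by
  refine tendsto_zero_of_damped_recursion ht hc hc4 (fun n => ?_) hR fun n => ?_
  · exact div_nonneg (meanAt_nonneg _ _ _ _ (hF n)) (sq_nonneg _)
  · have hT : 0 < t + 2 * (n : ℝ) := by positivity
    have h1 : t + 2 * ((n + 1 : ℕ) : ℝ) = t + 2 * n + 2 := by push_cast; ring
    rw [h1, div_mul_cancel₀ _ (by positivity), meanAt_succ hm]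
    refine (meanAt_mono _ _ _ _ (hstep n)).trans (le_of_eq ?_)
    rw [meanAt_add, meanAt_add, meanAt_const_mul, meanAt_div, meanAt_const_mul]
    field_simp

end Model

end Mean

/-! ### The total degree and the shares of the attributes -/

namespace History

variable {V₀ K : Type*} [Fintype V₀] [Fintype K]

lemma exists_eq_snoc {n : ℕ} (h : History V₀ K (n + 1)) :
    ∃ (h' : History V₀ K n) (b : K) (v : V₀ ⊕ Fin n), h = h'.snoc b v := by
  refine ⟨(fun i => h.1 i.castSucc, fun i => h.2 i.castSucc), h.1 (Fin.last n),
    h.2 (Fin.last n), Prod.ext ?_ ?_⟩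
  · funext i
    induction i using Fin.lastCases <;> simp [snoc]
  · funext i
    induction i using Fin.lastCases with
    | last => simp [snoc]
    | cast i =>
      simp only [snoc, Fin.snoc_castSucc]

/-- The history at time `0`. -/
def empty : History V₀ K 0 := (Fin.elim0, fun i => i.elim0)

/-- The total attachment degree of the base graph. -/
def baseDegree (B : SimpleGraph V₀) : ℝ :=
  ∑ v, ((empty : History V₀ Unit 0).adeg B v : ℝ)

open Classical in
-- A history at time 0 carries no information, so the base degrees can be defined with the attribute
-- type `Unit`; this makes `baseDegree` independent of `K`.
lemma adeg_zero (B : SimpleGraph V₀) (h : History V₀ K 0) (v : V₀ ⊕ Fin 0) :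
    h.adeg B v = (empty : History V₀ Unit 0).adeg B v := by
  have (x y : V₀ ⊕ Fin 0) : (h.graph B).Adj x y ↔ ((empty : History V₀ Unit 0).graph B).Adj x y := by
    simp [graph_adj]
  rw [adeg, adeg, degree_eq_sum, degree_eq_sum]
  simp only [this]

/-- Each step adds one edge, hence two half-edges. The denominator of all normalized quantities is
thus not random. -/
lemma sum_adeg (B : SimpleGraph V₀) {n : ℕ} (h : History V₀ K n) :
    ∑ v, (h.adeg B v : ℝ) = baseDegree B + 2 * n := by
  induction n with
  | zero => simp [baseDegree, adeg_zero B h]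
  | succ n ih =>
    obtain ⟨h', b, v, rfl⟩ := exists_eq_snoc h
    have := degSum_snoc (K := K) B (fun _ => b) (fun _ d => (d : ℝ)) h' b v
    simp only [degSum] at this
    rw [this, ih]
    push_cast
    ring

/-- A connected base graph with more than one vertex has an edge, and a single vertex carries the
extra half-edge; this is where the initialization convention matters. -/
lemma one_le_baseDegree {B : SimpleGraph V₀} (hB : B.Connected) : 1 ≤ baseDegree B := by
  classical
  obtain ⟨v⟩ := hB.nonempty
  set h : History V₀ Unit 0 := empty with hh
  have h1 : 1 ≤ h.adeg B (Sum.inl v) := by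
    by_cases hc : Fintype.card V₀ = 1
    · simp [adeg, hc]
    · have : Nontrivial V₀ := by
        have := Fintype.card_pos_iff.2 ⟨v⟩
        exact Fintype.one_lt_card_iff_nontrivial.1 (by omega)
      obtain ⟨w, hw⟩ := hB.preconnected.exists_adj_of_nontrivial v
      have h2 : (h.graph B).Adj (Sum.inl v) (Sum.inl w) := by
        rw [graph_adj]
        exact Or.inl ⟨v, w, hw, rfl, rfl⟩
      have h3 : 0 < (h.graph B).degree (Sum.inl v) :=
        (SimpleGraph.degree_pos_iff_exists_adj _ _).2 ⟨_, h2⟩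
      rw [adeg]
      omega
  calc (1 : ℝ) ≤ h.adeg B (Sum.inl v) := by exact_mod_cast h1
    _ ≤ _ := Finset.single_le_sum (f := fun v => (h.adeg B v : ℝ)) (fun _ _ => by positivity)
      (Finset.mem_univ _)

open Classical in
/-- The share of attribute `a` in the total attachment degree. -/
def share (B : SimpleGraph V₀) (a₀ : V₀ → K) {n : ℕ} (h : History V₀ K n) (a : K) : ℝ :=
  degSum B a₀ (fun a' d => if a' = a then (d : ℝ) else 0) h / (baseDegree B + 2 * n)

lemma share_nonneg {B : SimpleGraph V₀} (hB : B.Connected) (a₀ : V₀ → K) {n : ℕ}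
    (h : History V₀ K n) (a : K) : 0 ≤ share B a₀ h a := by
  have := one_le_baseDegree hB
  refine div_nonneg (Finset.sum_nonneg fun w _ => ?_) (by positivity)
  dsimp only
  split_ifs <;> positivity

lemma sum_mul_degSum (B : SimpleGraph V₀) (a₀ : V₀ → K) {n : ℕ} (h : History V₀ K n)
    (f : K → ℝ) : ∑ w, f (h.attr a₀ w) * h.adeg B w =
      (baseDegree B + 2 * n) * ∑ a, f a * share B a₀ h a := by
  classical
  -- Connectedness is not assumed here; if the total is zero then every degree vanishes and so do
  -- both sides.
  by_cases hT : baseDegree B + 2 * (n : ℝ) = 0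
  · have h1 := sum_adeg B h
    rw [hT] at h1
    rw [hT, zero_mul]
    refine Finset.sum_eq_zero fun w _ => ?_
    rw [(Finset.sum_eq_zero_iff_of_nonneg (fun _ _ => by positivity)).1 h1 w (Finset.mem_univ w),
      mul_zero]
  · simp only [share, degSum]
    rw [Finset.mul_sum]
    have (a : K) : (baseDegree B + 2 * (n : ℝ)) * (f a *
        ((∑ w, if h.attr a₀ w = a then (h.adeg B w : ℝ) else 0) / (baseDegree B + 2 * n))) =
        ∑ w, if h.attr a₀ w = a then f a * (h.adeg B w : ℝ) else 0 := by
      rw [mul_left_comm, mul_div_cancel₀ _ hT, Finset.mul_sum]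
      exact Finset.sum_congr rfl fun w _ => by split_ifs <;> simp
    simp only [this]
    rw [Finset.sum_comm]
    exact Finset.sum_congr rfl fun w _ => by simp

lemma sum_share {B : SimpleGraph V₀} (hB : B.Connected) (a₀ : V₀ → K) {n : ℕ}
    (h : History V₀ K n) : ∑ a, share B a₀ h a = 1 := by
  have h1 := sum_mul_degSum B a₀ h (fun _ => 1)
  have h2 := one_le_baseDegree hB
  simp only [one_mul, sum_adeg] at h1
  have h3 : baseDegree B + 2 * (n : ℝ) ≠ 0 := by positivity
  exact (mul_left_cancel₀ h3 (by rw [mul_one]; exact h1)).symm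

end History

open History

/-- The rate at which a half-edge at a vertex of attribute `a` attracts edges, for the
normalized total degrees `y`. -/
def rateAt {K : Type*} [Fintype K] (π : K → ℝ) (κ : K → K → ℝ) (y : K → ℝ) (a : K) : ℝ :=
  ∑ b, κ a b * (π b / ∑ l, κ l b * y l)

lemma phiLimit_eq {K : Type*} [Fintype K] (π : K → ℝ) (κ : K → K → ℝ) (a : K) :
    phiLimit π κ a = rateAt π κ (etaLimit π κ) a := rfl

/-! ### Attachment probabilities and drifts in terms of the shares -/

section Drift

variable {V₀ K : Type*} [Fintype V₀] [Fintype K] {π : K → ℝ} {κ : K → K → ℝ}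
  {B : SimpleGraph V₀}

lemma kernel_mean_pos (hκ : ∀ a b, 0 < κ a b) {y : K → ℝ} (hy : ∀ a, 0 ≤ y a)
    (hy1 : ∑ a, y a = 1) (b : K) : 0 < ∑ l, κ l b * y l := by
  refine lt_of_le_of_ne (Finset.sum_nonneg fun l _ => mul_nonneg (hκ _ _).le (hy l)) fun h0 => ?_
  have h1 := (Finset.sum_eq_zero_iff_of_nonneg
    (fun l _ => mul_nonneg (hκ l b).le (hy l))).1 h0.symm
  have h2 : ∀ l, y l = 0 := fun l =>
    (mul_eq_zero.1 (h1 l (Finset.mem_univ l))).resolve_left (hκ l b).ne'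
  simp [h2] at hy1

/-- Separates the size bias d/T of the vertex from a factor that depends only on attributes and
shares. Averaging that factor over the next attribute produces `rateAt`. -/
lemma attachProb_eq (a₀ : V₀ → K) {n : ℕ} (h : History V₀ K n) (b : K)
    (v : V₀ ⊕ Fin n) : h.attachProb κ B a₀ b v =
      h.adeg B v / (baseDegree B + 2 * n) *
        (κ (h.attr a₀ v) b / ∑ l, κ l b * share B a₀ h l) := by
  rw [attachProb]
  simp only [attachDegree_eq]
  rw [sum_mul_degSum B a₀ h (fun a => κ a b), div_mul_div_comm, mul_comm (κ _ _)]

lemma sum_attachProb (hB : B.Connected) (hκ : ∀ a b, 0 < κ a b) (a₀ : V₀ → K) {n : ℕ}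
    (h : History V₀ K n) (b : K) : ∑ v, h.attachProb κ B a₀ b v = 1 := by
  simp only [attachProb]
  rw [← Finset.sum_div]
  simp only [attachDegree_eq]
  rw [sum_mul_degSum B a₀ h (fun a => κ a b), div_self]
  have h2 := one_le_baseDegree hB
  exact mul_ne_zero (by positivity)
    (kernel_mean_pos hκ (share_nonneg hB a₀ h) (sum_share hB a₀ h) b).ne'

lemma stepMean_const (hB : B.Connected) (hκ : ∀ a b, 0 < κ a b) (hπ : ∑ b, π b = 1)
    (a₀ : V₀ → K) {n : ℕ} (h : History V₀ K n) (c : ℝ) :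
    stepMean π κ B a₀ h (fun _ _ => c) = c := by
  simp only [stepMean]
  simp only [← Finset.sum_mul, sum_attachProb hB hκ, one_mul, hπ]

/-- The conditional mean of a sum of a function of the new attribute and a function of the
parent. -/
lemma stepMean_eq (hB : B.Connected) (hκ : ∀ a b, 0 < κ a b) (a₀ : V₀ → K) {n : ℕ}
    (h : History V₀ K n) (f : K → ℝ) (g : V₀ ⊕ Fin n → ℝ) :
    stepMean π κ B a₀ h (fun b v => f b + g v) = ∑ b, π b * f b +
      (∑ v, rateAt π κ (share B a₀ h) (h.attr a₀ v) * (h.adeg B v * g v)) /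
        (baseDegree B + 2 * n) := by
  have h0 : ∀ b, ∑ v, h.attachProb κ B a₀ b v * (f b + g v) =
      f b + ∑ v, h.attachProb κ B a₀ b v * g v := by
    intro b
    simp only [mul_add, Finset.sum_add_distrib]
    rw [← Finset.sum_mul, sum_attachProb hB hκ, one_mul]
  simp only [stepMean, h0]
  simp only [mul_add, Finset.sum_add_distrib, Finset.mul_sum, rateAt, Finset.sum_mul,
    Finset.sum_div]
  congr 1
  rw [Finset.sum_comm]
  refine Finset.sum_congr rfl fun v _ => Finset.sum_congr rfl fun b _ => ?_
  rw [attachProb_eq]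
  ring

/-- The drift splits into the contribution of the new leaf and that of the parent, a vertex of
attribute a and degree d being the parent with probability r_a d/T. -/
lemma stepMean_degSum (hB : B.Connected) (hκ : ∀ a b, 0 < κ a b) (a₀ : V₀ → K) {n : ℕ}
    (h : History V₀ K n) (f : K → ℕ → ℝ) :
    stepMean π κ B a₀ h (fun b v => degSum B a₀ f (h.snoc b v) - degSum B a₀ f h) =
      ∑ b, π b * f b 1 +
      degSum B a₀ (fun a d => rateAt π κ (share B a₀ h) a * (d * (f a (d + 1) - f a d))) h /
        (baseDegree B + 2 * n) := by
  simp only [degSum_snoc, add_sub_cancel_left]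
  rw [stepMean_eq hB hκ a₀ h (fun b => f b 1)]
  rfl

end Drift

/-! ### Mean square bounds from drift conditions -/

section SquareMean

variable {V₀ K Ω : Type*} [Fintype V₀] [Fintype K] [MeasurableSpace Ω]
  {ℙ : Measure Ω} [IsProbabilityMeasure ℙ] {π : K → ℝ} {κ : K → K → ℝ}
  {B : SimpleGraph V₀} {a₀ : V₀ → K} {attr : ℕ → Ω → K} {par : (n : ℕ) → Ω → V₀ ⊕ Fin n}

/-- A process with bounded increments whose drift is not too repelling is negligible, in mean
square, with respect to the total degree. -/
lemma tendsto_meanAt_sq (hm : IsAttachmentModel ℙ π κ B a₀ attr par) (hB : B.Connected)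
    (hκ : ∀ a b, 0 < κ a b) (hπ : ∀ b, 0 ≤ π b) (hπ1 : ∑ b, π b = 1)
    {c C : ℝ} (hc : 0 < c) (hc4 : c ≤ 4) {M R : ∀ n, History V₀ K n → ℝ}
    (hM : ∀ n (h : History V₀ K n) b v, |M (n + 1) (h.snoc b v) - M n h| ≤ C)
    (hR : Tendsto (fun n => meanAt ℙ attr par n (R n)) atTop (𝓝 0))
    (hdrift : ∀ n (h : History V₀ K n),
      2 * M n h * stepMean π κ B a₀ h (fun b v => M (n + 1) (h.snoc b v) - M n h) ≤
        (4 - c) * M n h ^ 2 / (baseDegree B + 2 * n) + (baseDegree B + 2 * n) * R n h) :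
    Tendsto (fun n => meanAt ℙ attr par n fun h => (M n h / (baseDegree B + 2 * n)) ^ 2)
      atTop (𝓝 0) := by
  have ht := one_le_baseDegree hB
  have hTlim : Tendsto (fun n : ℕ => C ^ 2 / (baseDegree B + 2 * (n : ℝ))) atTop (𝓝 0) := by
    refine tendsto_const_nhds.div_atTop (tendsto_atTop_add_const_left _ _ ?_)
    exact tendsto_natCast_atTop_atTop.const_mul_atTop (by norm_num)
  have hR' : Tendsto (fun n => meanAt ℙ attr par n
      fun h => R n h + C ^ 2 / (baseDegree B + 2 * (n : ℝ))) atTop (𝓝 0) := by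
    simp only [meanAt_add, meanAt_const hm]
    simpa using hR.add hTlim
  have := tendsto_meanAt_div_sq_of_step hm ht hc hc4 (F := fun n h => M n h ^ 2)
    (fun n h => sq_nonneg _) hR' fun n h => ?_
  · simpa only [div_pow, meanAt_div] using this
  · have hT : 0 < baseDegree B + 2 * (n : ℝ) := by positivity
    -- Expand (M + Δ)² = M² + 2MΔ + Δ² with Δ² ≤ C². The constant C² is T · (C²/T), an admissible
    -- error since C²/T tends to zero.
    have h1 : stepMean π κ B a₀ h (fun b v => M (n + 1) (h.snoc b v) ^ 2) ≤
        stepMean π κ B a₀ h (fun b v =>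
          2 * M n h * (M (n + 1) (h.snoc b v) - M n h) + (M n h ^ 2 + C ^ 2)) := by
      refine stepMean_mono hπ hκ fun b v => ?_
      have h2 := sq_le_sq' (neg_le_of_abs_le (hM n h b v)) (le_of_abs_le (hM n h b v))
      nlinarith
    rw [stepMean_add, stepMean_const_mul, stepMean_const hB hκ hπ1] at h1
    have h3 := hdrift n h
    rw [mul_add, mul_div_cancel₀ _ hT.ne']
    linarith

end SquareMean

open History

/-! ### Critical points of the potential -/

section Minimizer

variable {K : Type*} [Fintype K] {π : K → ℝ} {κ : K → K → ℝ}

/-- Every new vertex chooses exactly one parent, so the attraction rates weighted by the shares have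
total one. -/
lemma sum_mul_rateAt (hκ : ∀ a b, 0 < κ a b) (hπ1 : ∑ b, π b = 1) {y : K → ℝ}
    (hy : ∀ a, 0 ≤ y a) (hy1 : ∑ a, y a = 1) : ∑ a, y a * rateAt π κ y a = 1 := by
  simp only [rateAt, Finset.mul_sum]
  rw [Finset.sum_comm, ← hπ1]
  refine Finset.sum_congr rfl fun b _ => ?_
  have := (kernel_mean_pos hκ hy hy1 b).ne'
  calc ∑ a, y a * (κ a b * (π b / ∑ l, κ l b * y l)) =
      (∑ a, κ a b * y a) * (π b / ∑ l, κ l b * y l) := by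
        rw [Finset.sum_mul]; exact Finset.sum_congr rfl fun _ _ => by ring
    _ = π b := mul_div_cancel₀ _ this

/-- A critical point of the potential in the open simplex is its unique minimizer. -/
lemma etaLimit_eq_of_critical (hκ : ∀ a b, 0 < κ a b) (hπ : ∀ b, 0 < π b) (hπ1 : ∑ b, π b = 1)
    {ρ : K → ℝ} (hρ : ρ ∈ openSimplex K) (hcrit : ∀ a, π a / ρ a + rateAt π κ ρ a = 2) :
    etaLimit π κ = ρ := by
  -- The linear part of the potential at ρ vanishes on the simplex: by criticality the terms with y
  -- add up to 2 ∑ y_a = 2.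
  have hsum : ∀ y ∈ openSimplex K, ∑ j, (π j * (y j / ρ j - 1) +
      π j * ((∑ k, y k * κ k j) / (∑ k, ρ k * κ k j) - 1)) = 0 := by
    intro y hy
    have h1 : ∑ j, π j * ((∑ k, y k * κ k j) / (∑ k, ρ k * κ k j)) =
        ∑ a, y a * rateAt π κ ρ a := by
      simp only [rateAt, Finset.mul_sum, Finset.sum_div]
      rw [Finset.sum_comm]
      refine Finset.sum_congr rfl fun a _ => Finset.sum_congr rfl fun b _ => ?_
      have : ∑ k, ρ k * κ k b = ∑ l, κ l b * ρ l := Finset.sum_congr rfl fun _ _ => mul_comm _ _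
      rw [this]
      ring
    have h2 : ∑ j, π j * (y j / ρ j) + ∑ a, y a * rateAt π κ ρ a = 2 := by
      rw [← Finset.sum_add_distrib]
      calc _ = ∑ a, y a * 2 := Finset.sum_congr rfl fun a _ => by rw [← hcrit a]; ring
        _ = 2 := by rw [← Finset.sum_mul, hy.2, one_mul]
    simp only [mul_sub, Finset.sum_add_distrib, Finset.sum_sub_distrib, mul_one, hπ1, h1]
    linarith
  have hspos : ∀ y ∈ openSimplex K, ∀ j, 0 < ∑ k, y k * κ k j := fun y hy j => by
    have := kernel_mean_pos hκ (fun a => (hy.1 a).le) hy.2 j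
    simpa only [mul_comm] using this
  have hlog : ∀ x : ℝ, 0 < x → Real.log x ≤ x - 1 := fun x hx => Real.log_le_sub_one_of_pos hx
  -- After subtraction of the vanishing linear part, the difference is a sum of terms π_j (x - 1 -
  -- log x) ≥ 0. Equality forces y_j/ρ_j = 1 for every j, which gives uniqueness and hence the value
  -- chosen by `Classical.epsilon`.
  have hdiff : ∀ y ∈ openSimplex K, 2 * (potential π κ y - potential π κ ρ) =
      ∑ j, (π j * ((y j / ρ j - 1) - Real.log (y j / ρ j)) +
        π j * (((∑ k, y k * κ k j) / (∑ k, ρ k * κ k j) - 1) -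
          Real.log ((∑ k, y k * κ k j) / (∑ k, ρ k * κ k j)))) := by
    intro y hy
    have h1 : ∀ j, (π j * ((y j / ρ j - 1) - Real.log (y j / ρ j)) +
        π j * (((∑ k, y k * κ k j) / (∑ k, ρ k * κ k j) - 1) -
          Real.log ((∑ k, y k * κ k j) / (∑ k, ρ k * κ k j)))) =
        (π j * (y j / ρ j - 1) + π j * ((∑ k, y k * κ k j) / (∑ k, ρ k * κ k j) - 1)) -
        (π j * (Real.log (y j) + Real.log (∑ k, y k * κ k j)) -
          π j * (Real.log (ρ j) + Real.log (∑ k, ρ k * κ k j))) := by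
      intro j
      rw [Real.log_div (hy.1 j).ne' (hρ.1 j).ne', Real.log_div (hspos y hy j).ne'
        (hspos ρ hρ j).ne']
      ring
    simp only [h1]
    rw [Finset.sum_sub_distrib, hsum y hy, Finset.sum_sub_distrib, potential, potential]
    ring
  have hnn : ∀ y ∈ openSimplex K, ∀ j, 0 ≤ π j * ((y j / ρ j - 1) - Real.log (y j / ρ j)) ∧
      0 ≤ π j * (((∑ k, y k * κ k j) / (∑ k, ρ k * κ k j) - 1) -
          Real.log ((∑ k, y k * κ k j) / (∑ k, ρ k * κ k j))) := fun y hy j =>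
    ⟨mul_nonneg (hπ j).le (sub_nonneg.2 (hlog _ (div_pos (hy.1 j) (hρ.1 j)))),
      mul_nonneg (hπ j).le (sub_nonneg.2 (hlog _ (div_pos (hspos y hy j) (hspos ρ hρ j))))⟩
  have hmin : IsMinOn (potential π κ) (openSimplex K) ρ := by
    intro y hy
    have h1 := hdiff y hy
    have h2 := Finset.sum_nonneg fun j (_ : j ∈ Finset.univ) =>
      add_nonneg (hnn y hy j).1 (hnn y hy j).2
    rw [← h1] at h2
    change potential π κ ρ ≤ potential π κ y
    linarith
  have hspec := Classical.epsilon_spec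
    (p := fun y => y ∈ openSimplex K ∧ IsMinOn (potential π κ) (openSimplex K) y) ⟨ρ, hρ, hmin⟩
  change etaLimit π κ ∈ openSimplex K ∧ IsMinOn (potential π κ) (openSimplex K) (etaLimit π κ)
    at hspec
  set y := etaLimit π κ
  have hy := hspec.1
  have hle : potential π κ y ≤ potential π κ ρ := hspec.2 hρ
  have h0 := Finset.sum_nonneg fun j (_ : j ∈ Finset.univ) =>
      add_nonneg (hnn y hy j).1 (hnn y hy j).2
  have hzero := le_antisymm (by rw [← hdiff y hy]; linarith) h0
  funext j
  have h3 := (Finset.sum_eq_zero_iff_of_nonneg fun j (_ : j ∈ Finset.univ) =>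
      add_nonneg (hnn y hy j).1 (hnn y hy j).2).1 hzero j (Finset.mem_univ j)
  have h4 : π j * ((y j / ρ j - 1) - Real.log (y j / ρ j)) = 0 := by
    linarith [(hnn y hy j).1, (hnn y hy j).2]
  have h5 := (mul_eq_zero.1 h4).resolve_left (hπ j).ne'
  by_contra hne
  have h6 := Real.log_lt_sub_one_of_pos (div_pos (hy.1 j) (hρ.1 j))
    (fun h => hne ((div_eq_one_iff_eq (hρ.1 j).ne').1 h))
  linarith

end Minimizer

/-! ### The limiting shares for two attributes -/

section TwoTypes

variable {π : Fin 2 → ℝ} {κ : Fin 2 → Fin 2 → ℝ}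

/-- Intermediate value theorem for the drift of the first share: it is π_0 > 0 at t = 0 and π_0 - 1
< 0 at t = 1. The equation for the other attribute follows from `sum_mul_rateAt`. -/
lemma exists_critical (hκ : ∀ a b, 0 < κ a b) (hπ : ∀ b, 0 < π b) (hπ1 : ∑ b, π b = 1) :
    ∃ ρ ∈ openSimplex (Fin 2), ∀ a, π a / ρ a + rateAt π κ ρ a = 2 := by
  set F : ℝ → ℝ := fun t => π 0 + t * rateAt π κ ![t, 1 - t] 0 - 2 * t with hF
  have hp0 := hπ 0
  have hp1 := hπ 1
  have hs : π 0 + π 1 = 1 := by rw [← hπ1, Fin.sum_univ_two]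
  have hmem : ∀ t ∈ Set.Icc (0 : ℝ) 1, (∀ a, 0 ≤ (![t, 1 - t] : Fin 2 → ℝ) a) ∧
      ∑ a, (![t, 1 - t] : Fin 2 → ℝ) a = 1 := by
    intro t ht
    refine ⟨fun a => ?_, by simp⟩
    fin_cases a
    · exact ht.1
    · exact sub_nonneg.2 ht.2
  have hcont : ContinuousOn F (Set.Icc 0 1) := by
    have hd : ∀ b, ∀ t ∈ Set.Icc (0 : ℝ) 1, κ 0 b * t + κ 1 b * (1 - t) ≠ 0 := by
      intro b t ht
      have := kernel_mean_pos hκ (hmem t ht).1 (hmem t ht).2 b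
      simp only [Fin.sum_univ_two, Matrix.cons_val_zero, Matrix.cons_val_one] at this
      exact this.ne'
    simp only [hF, rateAt, Fin.sum_univ_two, Matrix.cons_val_zero, Matrix.cons_val_one]
    have h0 := hd 0
    have h1 := hd 1
    fun_prop (disch := assumption)
  have h0 : F 0 = π 0 := by simp [hF]
  have h1 : F 1 < 0 := by
    have k0 := (hκ 0 0).ne'
    have k1 := (hκ 0 1).ne'
    have : F 1 = π 0 - 1 := by
      simp only [hF, rateAt, Fin.sum_univ_two, Matrix.cons_val_zero, Matrix.cons_val_one,
        sub_self, mul_zero, add_zero, mul_one, one_mul, mul_div_cancel₀ _ k0, mul_div_cancel₀ _ k1]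
      linarith
    linarith
  obtain ⟨t, ht, hFt⟩ := intermediate_value_Icc' zero_le_one hcont
    (show (0 : ℝ) ∈ Set.Icc (F 1) (F 0) from ⟨h1.le, by rw [h0]; exact hp0.le⟩)
  have ht0 : 0 < t := lt_of_le_of_ne ht.1 (by rintro rfl; linarith)
  have ht1 : t < 1 := lt_of_le_of_ne ht.2 (by rintro rfl; linarith)
  have hsum := sum_mul_rateAt hκ hπ1 (hmem t ht).1 (hmem t ht).2
  rw [Fin.sum_univ_two] at hsum
  simp only [Matrix.cons_val_zero, Matrix.cons_val_one] at hsum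
  simp only [hF] at hFt
  have ht2 : 1 - t ≠ 0 := by linarith
  refine ⟨![t, 1 - t], ⟨fun j => ?_, (hmem t ht).2⟩, fun a => ?_⟩
  · fin_cases j
    · exact ht0
    · exact sub_pos.2 ht1
  · fin_cases a
    · change π 0 / t + rateAt π κ ![t, 1 - t] 0 = 2
      field_simp
      linarith
    · change π 1 / (1 - t) + rateAt π κ ![t, 1 - t] 1 = 2
      field_simp
      linarith

lemma etaLimit_spec (hκ : ∀ a b, 0 < κ a b) (hπ : ∀ b, 0 < π b) (hπ1 : ∑ b, π b = 1) :
    etaLimit π κ ∈ openSimplex (Fin 2) ∧ ∀ a, π a / etaLimit π κ a + phiLimit π κ a = 2 := by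
  obtain ⟨ρ, hρ, hc⟩ := exists_critical hκ hπ hπ1
  have h := etaLimit_eq_of_critical hκ hπ hπ1 hρ hc
  refine ⟨h ▸ hρ, fun a => ?_⟩
  rw [phiLimit_eq, h]
  exact hc a

lemma phiLimit_pos (hκ : ∀ a b, 0 < κ a b) (hπ : ∀ b, 0 < π b) (hπ1 : ∑ b, π b = 1)
    (a : Fin 2) : 0 < phiLimit π κ a := by
  have h := (etaLimit_spec hκ hπ hπ1).1
  refine Finset.sum_pos (fun b _ => mul_pos (hκ _ _) (div_pos (hπ b) ?_)) ⟨0, Finset.mem_univ _⟩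
  exact kernel_mean_pos hκ (fun a => (h.1 a).le) h.2 b

/-- The gap is 2 - φ_a = π_a/η_a > 0. It keeps the growth factor 1 + 2φ/T of the sum of squared
degrees below the critical 1 + 4/T. -/
lemma phiLimit_lt_two (hκ : ∀ a b, 0 < κ a b) (hπ : ∀ b, 0 < π b) (hπ1 : ∑ b, π b = 1)
    (a : Fin 2) : phiLimit π κ a < 2 := by
  have h := etaLimit_spec hκ hπ hπ1
  have h1 := h.2 a
  have h2 := div_pos (hπ a) (h.1.1 a)
  linarith

/-- The drift of the normalized total degrees points towards the minimizer. -/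
lemma exists_drift_contraction (hκ : ∀ a b, 0 < κ a b) (hπ : ∀ b, 0 < π b)
    (hπ1 : ∑ b, π b = 1) : ∃ c, 0 < c ∧ c ≤ 2 ∧ ∀ y : Fin 2 → ℝ, (∀ a, 0 ≤ y a) →
      ∑ a, y a = 1 →
      (y 0 - etaLimit π κ 0) * (π 0 + y 0 * rateAt π κ y 0 - 2 * etaLimit π κ 0) ≤
        (2 - c) * (y 0 - etaLimit π κ 0) ^ 2 := by
  obtain ⟨hη, hcrit⟩ := etaLimit_spec hκ hπ hπ1
  have hc0 := hcrit 0
  have hc1 := hcrit 1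
  have hφ := phiLimit_pos hκ hπ hπ1
  have hη0 := hη.1 0
  have hη1 := hη.1 1
  simp only [phiLimit_eq] at hc0 hc1 hφ
  set η := etaLimit π κ
  -- By criticality this constant is 2 - max φ_a.
  refine ⟨min (π 0 / η 0) (π 1 / η 1), lt_min (div_pos (hπ 0) hη0) (div_pos (hπ 1) hη1),
    (min_le_left _ _).trans (by linarith [hφ 0]), fun y hy hy1 => ?_⟩
  set c := min (π 0 / η 0) (π 1 / η 1)
  have hsη : ∀ b, 0 < κ 0 b * η 0 + κ 1 b * η 1 := fun b => by
    have := hκ 0 b; have := hκ 1 b; positivity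
  have hsy : ∀ b, 0 < κ 0 b * y 0 + κ 1 b * y 1 := fun b => by
    have := kernel_mean_pos hκ hy hy1 b
    rwa [Fin.sum_univ_two] at this
  have hy1' : y 1 = 1 - y 0 := by rw [Fin.sum_univ_two] at hy1; linarith
  have hη1' : η 1 = 1 - η 0 := by have := hη.2; rw [Fin.sum_univ_two] at this; linarith
  -- Subtracting the critical equation at η leaves differences of y_0 κ_0/(κ_0 y_0 + κ_1 y_1); in
  -- these the factor y_0 - η_0 splits off exactly, so the estimate is global and not a
  -- linearization.
  have hdiff : π 0 + y 0 * rateAt π κ y 0 - 2 * η 0 = (y 0 - η 0) *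
      ∑ b, κ 0 b * κ 1 b * π b / ((κ 0 b * y 0 + κ 1 b * y 1) * (κ 0 b * η 0 + κ 1 b * η 1)) := by
    have h1 : 2 * η 0 - π 0 = η 0 * rateAt π κ η 0 := by
      have : π 0 = (2 - rateAt π κ η 0) * η 0 := by
        rw [← div_eq_iff hη0.ne']; linarith
      linarith
    have h2 : y 0 * rateAt π κ y 0 - η 0 * rateAt π κ η 0 = (y 0 - η 0) *
      ∑ b, κ 0 b * κ 1 b * π b /
        ((κ 0 b * y 0 + κ 1 b * y 1) * (κ 0 b * η 0 + κ 1 b * η 1)) := by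
      simp only [rateAt, Finset.mul_sum]
      rw [← Finset.sum_sub_distrib]
      refine Finset.sum_congr rfl fun b _ => ?_
      rw [Fin.sum_univ_two, Fin.sum_univ_two]
      have e1 := (hsη b).ne'
      have e2 := (hsy b).ne'
      rw [← mul_div_assoc (y 0 - η 0), show ∀ S S' : ℝ, y 0 * (κ 0 b * (π b / S)) -
        η 0 * (κ 0 b * (π b / S')) = y 0 * κ 0 b * π b / S - η 0 * κ 0 b * π b / S' from
          fun S S' => by ring, div_sub_div _ _ e2 e1]
      congr 1
      rw [hy1', hη1']
      ring
    linarith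
  have hbound : ∑ b, κ 0 b * κ 1 b * π b /
      ((κ 0 b * y 0 + κ 1 b * y 1) * (κ 0 b * η 0 + κ 1 b * η 1)) ≤ 2 - c := by
    have h1 : ∀ b, κ 0 b * κ 1 b * π b /
      ((κ 0 b * y 0 + κ 1 b * y 1) * (κ 0 b * η 0 + κ 1 b * η 1)) ≤
        y 1 * (κ 0 b * (π b / ∑ l, κ l b * η l)) + y 0 * (κ 1 b * (π b / ∑ l, κ l b * η l)) := by
      intro b
      rw [Fin.sum_univ_two]
      -- As y_0 + y_1 = 1, the difference after clearing the denominator is y_0 y_1 (κ_0 - κ_1)².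
      -- Summed over b, the slope is at most the convex combination y_1 φ_0 + y_0 φ_1 ≤ max φ_a.
      have h2 : κ 0 b * κ 1 b / (κ 0 b * y 0 + κ 1 b * y 1) ≤ y 1 * κ 0 b + y 0 * κ 1 b := by
        rw [div_le_iff₀ (hsy b)]
        have h3 : 0 ≤ y 0 * y 1 * (κ 0 b - κ 1 b) ^ 2 :=
          mul_nonneg (mul_nonneg (hy 0) (hy 1)) (sq_nonneg _)
        rw [hy1'] at h3 ⊢
        nlinarith
      calc _ = κ 0 b * κ 1 b / (κ 0 b * y 0 + κ 1 b * y 1) *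
            (π b / (κ 0 b * η 0 + κ 1 b * η 1)) := by
              rw [div_mul_div_comm]
        _ ≤ (y 1 * κ 0 b + y 0 * κ 1 b) * (π b / (κ 0 b * η 0 + κ 1 b * η 1)) :=
            mul_le_mul_of_nonneg_right h2 (div_pos (hπ b) (hsη b)).le
        _ = _ := by ring
    refine (Finset.sum_le_sum fun b _ => h1 b).trans ?_
    rw [Finset.sum_add_distrib, ← Finset.mul_sum, ← Finset.mul_sum]
    change y 1 * rateAt π κ η 0 + y 0 * rateAt π κ η 1 ≤ 2 - c
    have h2 : c ≤ π 0 / η 0 := min_le_left _ _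
    have h3 : c ≤ π 1 / η 1 := min_le_right _ _
    have h4 : y 1 * rateAt π κ η 0 ≤ y 1 * (2 - c) := mul_le_mul_of_nonneg_left (by linarith) (hy 1)
    have h5 : y 0 * rateAt π κ η 1 ≤ y 0 * (2 - c) := mul_le_mul_of_nonneg_left (by linarith) (hy 0)
    rw [hy1'] at h4 ⊢
    linarith
  rw [hdiff]
  nlinarith [mul_le_mul_of_nonneg_left hbound (sq_nonneg (y 0 - η 0))]

/-- On the simplex the denominators are at least min(κ_0b, κ_1b) > 0, and differ at y and η by (κ_0b
- κ_1b)(η_0 - y_0). This transfers convergence of the shares to the rates. -/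
lemma exists_rateAt_lipschitz (hκ : ∀ a b, 0 < κ a b) (hπ : ∀ b, 0 < π b)
    (hπ1 : ∑ b, π b = 1) (a : Fin 2) : ∃ C, 0 ≤ C ∧ ∀ y : Fin 2 → ℝ, (∀ a, 0 ≤ y a) →
      ∑ a, y a = 1 → |rateAt π κ y a - phiLimit π κ a| ≤ C * |y 0 - etaLimit π κ 0| := by
  obtain ⟨hη, -⟩ := etaLimit_spec hκ hπ hπ1
  simp only [phiLimit_eq]
  set η := etaLimit π κ
  refine ⟨∑ b, κ a b * π b * |κ 0 b - κ 1 b| / (min (κ 0 b) (κ 1 b) * min (κ 0 b) (κ 1 b)),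
    Finset.sum_nonneg fun b _ => ?_, fun y hy hy1 => ?_⟩
  · have := hκ a b; have := hπ b; have := hκ 0 b; have := hκ 1 b
    positivity
  · rw [rateAt, rateAt, ← Finset.sum_sub_distrib, Finset.sum_mul]
    refine (Finset.abs_sum_le_sum_abs _ _).trans (Finset.sum_le_sum fun b _ => ?_)
    have hm : 0 < min (κ 0 b) (κ 1 b) := lt_min (hκ 0 b) (hκ 1 b)
    have hlow : ∀ z : Fin 2 → ℝ, (∀ a, 0 ≤ z a) → ∑ a, z a = 1 →
        min (κ 0 b) (κ 1 b) ≤ ∑ l, κ l b * z l := by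
      intro z hz hz1
      rw [Fin.sum_univ_two] at hz1 ⊢
      have h1 : min (κ 0 b) (κ 1 b) * z 0 ≤ κ 0 b * z 0 :=
        mul_le_mul_of_nonneg_right (min_le_left _ _) (hz 0)
      have h2 : min (κ 0 b) (κ 1 b) * z 1 ≤ κ 1 b * z 1 :=
        mul_le_mul_of_nonneg_right (min_le_right _ _) (hz 1)
      calc _ = min (κ 0 b) (κ 1 b) * z 0 + min (κ 0 b) (κ 1 b) * z 1 := by
            rw [← mul_add, hz1, mul_one]
        _ ≤ _ := add_le_add h1 h2
    have ly := hlow y hy hy1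
    have lη := hlow η (fun a => (hη.1 a).le) hη.2
    have py := hm.trans_le ly
    have pη := hm.trans_le lη
    have hd : ∑ l, κ l b * η l - ∑ l, κ l b * y l = (κ 0 b - κ 1 b) * (η 0 - y 0) := by
      have e1 := hη.2
      rw [Fin.sum_univ_two] at hy1 e1 ⊢
      rw [Fin.sum_univ_two, show y 1 = 1 - y 0 by linarith, show η 1 = 1 - η 0 by linarith]
      ring
    have heq : κ a b * (π b / ∑ l, κ l b * y l) - κ a b * (π b / ∑ l, κ l b * η l) =
        κ a b * π b * ((κ 0 b - κ 1 b) * (η 0 - y 0)) /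
          ((∑ l, κ l b * y l) * ∑ l, κ l b * η l) := by
      rw [← hd]
      field_simp
    have hka := hκ a b
    have hpb := hπ b
    rw [heq, abs_div, abs_mul, abs_mul (κ 0 b - κ 1 b), abs_of_pos (mul_pos hka hpb),
      abs_of_pos (mul_pos py pη), abs_sub_comm (η 0), ← mul_assoc, div_mul_eq_mul_div]
    gcongr

end TwoTypes

open History

/-! ### The balance equation of the limiting degree law -/

section Recurrence

variable {K : Type*} [Fintype K] {π : K → ℝ} {κ : K → K → ℝ}

/-- Relies on the value `Real.Gamma 0 = 0`. Sums over the degree can therefore start at 0, and the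
induction on k has a trivial base. -/
lemma degreePMF_zero (a : K) : degreePMF π κ a 0 = 0 := by
  simp [degreePMF, Real.Gamma_zero]

/-- Stationarity of the degree counts: growth of the count at k + 1 balances new leaves, arrivals
from degree k and departures to k + 2. The factor 2 is the growth of T per step. -/
lemma degreePMF_succ {a : K} (hφ : 0 < phiLimit π κ a) (k : ℕ) :
    2 * degreePMF π κ a (k + 1) = (if k = 0 then 2 else 0) +
      phiLimit π κ a * (k * degreePMF π κ a k - (k + 1) * degreePMF π κ a (k + 1)) := by
  have hc : 0 < 2 / phiLimit π κ a := by positivity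
  have hcφ : 2 / phiLimit π κ a * phiLimit π κ a = 2 := div_mul_cancel₀ _ hφ.ne'
  set c := 2 / phiLimit π κ a with hcdef
  rw [show (2 : ℝ) * degreePMF π κ a (k + 1) =
    phiLimit π κ a * (c * degreePMF π κ a (k + 1)) by rw [← mul_assoc, mul_comm _ c, hcφ]]
  rw [show (if k = 0 then (2 : ℝ) else 0) = phiLimit π κ a * (if k = 0 then c else 0) by
    split_ifs <;> [rw [mul_comm, hcφ]; simp], ← mul_add]
  congr 1
  have hΓ := Real.Gamma_add_one (s := k + 1 + c) (by positivity)
  have hG : 0 < Real.Gamma (k + 1 + c) := Real.Gamma_pos_of_pos (by positivity)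
  have hk : (0 : ℝ) < k + 1 + c := by positivity
  rw [degreePMF, degreePMF, ← hcdef]
  push_cast
  rw [show (k : ℝ) + 1 + 1 + c = k + 1 + c + 1 by ring, hΓ]
  rcases Nat.eq_zero_or_pos k with rfl | hk0
  · have h1 : Real.Gamma (1 + c) ≠ 0 := (Real.Gamma_pos_of_pos (by positivity)).ne'
    simp only [Nat.cast_zero, zero_add, Real.Gamma_one, zero_mul, if_true]
    field_simp
    ring
  · rw [if_neg hk0.ne', Real.Gamma_add_one (s := k) (by positivity)]
    field_simp
    ring

end Recurrence

/-! ### Convergence of shares and degree frequencies, and the second moment of the degrees -/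

section Counts

variable {V₀ K : Type*} [Fintype V₀] [Fintype K]

open Classical in
/-- The number of vertices of attribute `a` and degree `k`, divided by the total degree. -/
def degFreq (B : SimpleGraph V₀) (a₀ : V₀ → K) (a : K) (k : ℕ) {n : ℕ} (h : History V₀ K n) : ℝ :=
  degSum B a₀ (fun a' d => if a' = a ∧ d = k then 1 else 0) h / (baseDegree B + 2 * n)

lemma degFreq_nonneg {B : SimpleGraph V₀} (hB : B.Connected) (a₀ : V₀ → K) (a : K) (k : ℕ) {n : ℕ}
    (h : History V₀ K n) : 0 ≤ degFreq B a₀ a k h := by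
  have := one_le_baseDegree hB
  refine div_nonneg (Finset.sum_nonneg fun w _ => ?_) (by positivity)
  dsimp only
  split_ifs <;> simp

lemma mul_degFreq_le_one {B : SimpleGraph V₀} (hB : B.Connected) (a₀ : V₀ → K) (a : K) (k : ℕ)
    {n : ℕ} (h : History V₀ K n) : k * degFreq B a₀ a k h ≤ 1 := by
  have := one_le_baseDegree hB
  have hT : 0 < baseDegree B + 2 * (n : ℝ) := by positivity
  rw [degFreq, mul_div_assoc', div_le_one hT, ← sum_adeg B h, degSum, Finset.mul_sum]
  refine Finset.sum_le_sum fun w _ => ?_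
  split_ifs with hw
  · rw [hw.2, mul_one]
  · rw [mul_zero]
    positivity

end Counts

section Limits

variable {V₀ Ω : Type*} [Fintype V₀] [MeasurableSpace Ω]
  {ℙ : Measure Ω} [IsProbabilityMeasure ℙ] {π : Fin 2 → ℝ} {κ : Fin 2 → Fin 2 → ℝ}
  {B : SimpleGraph V₀} {a₀ : V₀ → Fin 2} {attr : ℕ → Ω → Fin 2}
  {par : (n : ℕ) → Ω → V₀ ⊕ Fin n}

/-- The process M = T (share - η_0) has bounded increments and, by `exists_drift_contraction`, a
drift with M · drift ≤ (2 - c) M²/T. -/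
lemma tendsto_meanAt_share (hm : IsAttachmentModel ℙ π κ B a₀ attr par) (hB : B.Connected)
    (hκ : ∀ a b, 0 < κ a b) (hπ : ∀ b, 0 < π b) (hπ1 : ∑ b, π b = 1) :
    Tendsto (fun n => meanAt ℙ attr par n fun h => (share B a₀ h 0 - etaLimit π κ 0) ^ 2)
      atTop (𝓝 0) := by
  classical
  obtain ⟨c, hc, hc2, hcon⟩ := exists_drift_contraction hκ hπ hπ1
  have ht := one_le_baseDegree hB
  have hη := (etaLimit_spec hκ hπ hπ1).1
  have hη0 := hη.1 0
  have hη1 : etaLimit π κ 0 ≤ 1 := by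
    have := hη.2
    rw [Fin.sum_univ_two] at this
    linarith [hη.1 1]
  set η := etaLimit π κ 0
  set f : Fin 2 → ℕ → ℝ := fun a' d => if a' = 0 then (d : ℝ) else 0 with hf
  have hMT : ∀ n (h : History V₀ (Fin 2) n),
      degSum B a₀ f h - η * (baseDegree B + 2 * n) =
        (share B a₀ h 0 - η) * (baseDegree B + 2 * n) := by
    intro n h
    have hT : 0 < baseDegree B + 2 * (n : ℝ) := by positivity
    rw [sub_mul, share, div_mul_cancel₀ _ hT.ne']
    congr 1
    simp only [hf, degSum]
    exact Finset.sum_congr rfl fun w _ => by congr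
  have hinc : ∀ n (h : History V₀ (Fin 2) n) b v,
      (degSum B a₀ f (h.snoc b v) - η * (baseDegree B + 2 * (n + 1 : ℕ))) -
        (degSum B a₀ f h - η * (baseDegree B + 2 * n)) =
      (degSum B a₀ f (h.snoc b v) - degSum B a₀ f h) + (-2 * η) := by
    intro n h b v
    push_cast
    ring
  -- Doubling 2 - c gives 4 - 2c, hence the damping 2c. The increments are differences of numbers in
  -- [0, 2], so 4 is a safe bound.
  have := tendsto_meanAt_sq hm hB hκ (fun b => (hπ b).le) hπ1 (c := 2 * c) (C := 4)
    (by positivity) (by linarith)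
    (M := fun n h => degSum B a₀ f h - η * (baseDegree B + 2 * n)) (R := fun _ _ => 0)
    (fun n h b v => ?_) ?_ fun n h => ?_
  · refine this.congr fun n => ?_
    congr 1
    funext h
    have hT : 0 < baseDegree B + 2 * (n : ℝ) := by positivity
    rw [hMT, mul_div_cancel_right₀ _ hT.ne']
  · rw [hinc, degSum_snoc, abs_le]
    simp only [hf]
    push_cast
    constructor <;> split_ifs <;> linarith
  · simp only [meanAt_const hm, tendsto_const_nhds]
  · have hT : 0 < baseDegree B + 2 * (n : ℝ) := by positivity
    simp only [hinc]
    rw [stepMean_add, stepMean_const hB hκ hπ1, stepMean_degSum hB hκ, hMT]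
    have h1 : ∑ b, π b * f b 1 = π 0 := by
      simp [hf]
    have h2 : degSum B a₀ (fun a d => rateAt π κ (share B a₀ h) a * (d * (f a (d + 1) - f a d))) h /
        (baseDegree B + 2 * n) = share B a₀ h 0 * rateAt π κ (share B a₀ h) 0 := by
      rw [share, div_mul_eq_mul_div, degSum, degSum, Finset.sum_mul]
      congr 1
      refine Finset.sum_congr rfl fun w _ => ?_
      simp only [hf]
      split_ifs with hw
      · rw [hw]; push_cast; ring
      · simp
    rw [h1, h2]
    have h3 := hcon (share B a₀ h) (share_nonneg hB a₀ h) (sum_share hB a₀ h)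
    rw [mul_pow, mul_zero, add_zero, div_eq_mul_inv]
    calc _ = 2 * (baseDegree B + 2 * n) * ((share B a₀ h 0 - η) *
          (π 0 + share B a₀ h 0 * rateAt π κ (share B a₀ h) 0 - 2 * η)) := by ring
      _ ≤ 2 * (baseDegree B + 2 * n) * ((2 - c) * (share B a₀ h 0 - η) ^ 2) := by gcongr
      _ = _ := by
        field_simp
        ring

/-- Induction on k: the drift of the deviation at k + 1 is driven by the deviation at k and by the
error of the shares, both already negligible, while its dependence on itself is restoring. The
factor π_a/2 arises since the counts are divided by T, about 2n. -/
lemma tendsto_meanAt_degFreq (hm : IsAttachmentModel ℙ π κ B a₀ attr par) (hB : B.Connected)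
    (hκ : ∀ a b, 0 < κ a b) (hπ : ∀ b, 0 < π b) (hπ1 : ∑ b, π b = 1) (a : Fin 2) (k : ℕ) :
    Tendsto (fun n => meanAt ℙ attr par n
      fun h => (degFreq B a₀ a k h - π a / 2 * degreePMF π κ a k) ^ 2) atTop (𝓝 0) := by
  classical
  have ht := one_le_baseDegree hB
  have hφ := phiLimit_pos hκ hπ hπ1 a
  have hshare := tendsto_meanAt_share hm hB hκ hπ hπ1
  obtain ⟨C, hC, hlip⟩ := exists_rateAt_lipschitz hκ hπ hπ1 a
  set x : ℕ → ℝ := fun k => π a / 2 * degreePMF π κ a k with hx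
  set f : ℕ → Fin 2 → ℕ → ℝ := fun k a' d => if a' = a ∧ d = k then 1 else 0 with hf
  have hMT : ∀ k n (h : History V₀ (Fin 2) n),
      degSum B a₀ (f k) h - x k * (baseDegree B + 2 * n) =
        (degFreq B a₀ a k h - x k) * (baseDegree B + 2 * n) := by
    intro k n h
    have hT : 0 < baseDegree B + 2 * (n : ℝ) := by positivity
    rw [sub_mul, degFreq, div_mul_cancel₀ _ hT.ne']
    congr 1
    simp only [hf, degSum]
    exact Finset.sum_congr rfl fun w _ => by congr
  have hinc : ∀ k n (h : History V₀ (Fin 2) n) b v,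
      (degSum B a₀ (f k) (h.snoc b v) - x k * (baseDegree B + 2 * (n + 1 : ℕ))) -
        (degSum B a₀ (f k) h - x k * (baseDegree B + 2 * n)) =
      (degSum B a₀ (f k) (h.snoc b v) - degSum B a₀ (f k) h) + (-2 * x k) := by
    intro k n h b v
    push_cast
    ring
  have hbdd : ∀ k n (h : History V₀ (Fin 2) n) b v,
      |(degSum B a₀ (f k) (h.snoc b v) - x k * (baseDegree B + 2 * (n + 1 : ℕ))) -
        (degSum B a₀ (f k) h - x k * (baseDegree B + 2 * n))| ≤ 2 + 2 * |x k| := by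
    intro k n h b v
    rw [hinc, degSum_snoc]
    have h1 : ∀ a' d, 0 ≤ f k a' d ∧ f k a' d ≤ 1 := fun a' d => by
      simp only [hf]
      split_ifs <;> simp
    have h2 := h1 b 1
    have h3 := h1 (h.attr a₀ v) (h.adeg B v)
    have h4 := h1 (h.attr a₀ v) (h.adeg B v + 1)
    have h5 := le_abs_self (x k)
    have h6 := neg_abs_le (x k)
    rw [abs_le]
    constructor <;> linarith
  have main : ∀ k (R : ∀ n, History V₀ (Fin 2) n → ℝ),
      Tendsto (fun n => meanAt ℙ attr par n (R n)) atTop (𝓝 0) →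
      (∀ n (h : History V₀ (Fin 2) n),
        2 * (degFreq B a₀ a k h - x k) *
          (∑ b, π b * f k b 1 + rateAt π κ (share B a₀ h) a *
            (degSum B a₀ (fun a' d => d * (f k a' (d + 1) - f k a' d)) h /
              (baseDegree B + 2 * n)) - 2 * x k) ≤
        (degFreq B a₀ a k h - x k) ^ 2 + R n h) →
      Tendsto (fun n => meanAt ℙ attr par n fun h => (degFreq B a₀ a k h - x k) ^ 2)
        atTop (𝓝 0) := by
    intro k R hR hdr
    -- Young's inequality 2uw ≤ u² + w² costs a growth factor 1 + 1/T, and 1 = 4 - 3.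
    have := tendsto_meanAt_sq hm hB hκ (fun b => (hπ b).le) hπ1 (c := 3)
      (by norm_num) (by norm_num)
      (M := fun n h => degSum B a₀ (f k) h - x k * (baseDegree B + 2 * n)) (R := R)
      (hbdd k) hR fun n h => ?_
    · refine this.congr fun n => ?_
      congr 1
      funext h
      have hT : 0 < baseDegree B + 2 * (n : ℝ) := by positivity
      rw [hMT, mul_div_cancel_right₀ _ hT.ne']
    · have hT : 0 < baseDegree B + 2 * (n : ℝ) := by positivity
      simp only [hinc]
      rw [stepMean_add, stepMean_const hB hκ hπ1, stepMean_degSum hB hκ, hMT]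
      have h2 : degSum B a₀ (fun a' d => rateAt π κ (share B a₀ h) a' *
          (d * (f k a' (d + 1) - f k a' d))) h = rateAt π κ (share B a₀ h) a *
            degSum B a₀ (fun a' d => d * (f k a' (d + 1) - f k a' d)) h := by
        rw [degSum, degSum, Finset.mul_sum]
        refine Finset.sum_congr rfl fun w _ => ?_
        by_cases hw : h.attr a₀ w = a
        · rw [hw]
        · simp [hf, hw]
      rw [h2]
      have h3 := mul_le_mul_of_nonneg_left (hdr n h) hT.le
      calc _ = (baseDegree B + 2 * n) * (2 * (degFreq B a₀ a k h - x k) *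
          (∑ b, π b * f k b 1 + rateAt π κ (share B a₀ h) a *
            (degSum B a₀ (fun a' d => d * (f k a' (d + 1) - f k a' d)) h /
              (baseDegree B + 2 * n)) - 2 * x k)) := by ring
        _ ≤ _ := h3
        _ = _ := by
          rw [mul_pow]
          field_simp
          ring
  induction k with
  | zero =>
    refine main 0 (fun _ _ => 0) (by simp only [meanAt_const hm, tendsto_const_nhds]) fun n h => ?_
    have h1 : x 0 = 0 := by simp [hx, degreePMF_zero]
    have h2 : degSum B a₀ (fun a' d => d * (f 0 a' (d + 1) - f 0 a' d)) h = 0 := by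
      refine Finset.sum_eq_zero fun w _ => ?_
      by_cases hd : h.adeg B w = 0 <;> simp [hf, hd]
    have h3 : ∑ b, π b * f 0 b 1 = 0 := by simp [hf]
    rw [h2, h3, h1]
    simp [sq_nonneg]
  | succ k ih =>
    refine main (k + 1) (fun n h => 2 * (k * phiLimit π κ a) ^ 2 * (degFreq B a₀ a k h - x k) ^ 2 +
      2 * C ^ 2 * (share B a₀ h 0 - etaLimit π κ 0) ^ 2) ?_ fun n h => ?_
    · simp only [meanAt_add, meanAt_const_mul]
      simpa using (ih.const_mul (2 * (k * phiLimit π κ a) ^ 2)).add (hshare.const_mul (2 * C ^ 2))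
    · have hT : 0 < baseDegree B + 2 * (n : ℝ) := by positivity
      have h1 : ∑ b, π b * f (k + 1) b 1 = if k = 0 then π a else 0 := by
        by_cases hk : k = 0
        · simp [hf, hk]
        · simp [hf, hk]
      have h2 : degSum B a₀ (fun a' d => d * (f (k + 1) a' (d + 1) - f (k + 1) a' d)) h /
          (baseDegree B + 2 * n) =
          k * degFreq B a₀ a k h - (k + 1) * degFreq B a₀ a (k + 1) h := by
        rw [degFreq, degFreq, mul_div_assoc', mul_div_assoc', ← sub_div, degSum, degSum, degSum,
          Finset.mul_sum, Finset.mul_sum, ← Finset.sum_sub_distrib]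
        congr 1
        refine Finset.sum_congr rfl fun w _ => ?_
        simp only [hf, Nat.add_right_cancel_iff]
        by_cases hw : h.attr a₀ w = a
        · by_cases hd : h.adeg B w = k
          · simp [hw, hd]
          · by_cases hd' : h.adeg B w = k + 1
            · simp [hw, hd']
            · simp [hw, hd, hd']
        · simp [hw]
      have hxrec : 2 * x (k + 1) = (if k = 0 then π a else 0) +
          phiLimit π κ a * (k * x k - (k + 1) * x (k + 1)) := by
        have := degreePMF_succ hφ k
        simp only [hx]
        have h3 : (if k = 0 then π a else 0) = π a / 2 * (if k = 0 then 2 else 0) := by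
          split_ifs <;> ring
        rw [h3]
        linear_combination π a / 2 * this
      have z0 := degFreq_nonneg hB a₀ a k h
      have z1 := degFreq_nonneg hB a₀ a (k + 1) h
      have z2 := mul_degFreq_le_one hB a₀ a k h
      have z3 := mul_degFreq_le_one hB a₀ a (k + 1) h
      have hl := hlip (share B a₀ h) (share_nonneg hB a₀ h) (sum_share hB a₀ h)
      rw [h1, h2]
      set z := degFreq B a₀ a k h
      set z' := degFreq B a₀ a (k + 1) h
      set r := rateAt π κ (share B a₀ h) a
      set φ := phiLimit π κ a
      set y := share B a₀ h 0 - etaLimit π κ 0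
      push_cast at z3
      have hkz : 0 ≤ (k : ℝ) * z := by positivity
      have hkz' : 0 ≤ ((k : ℝ) + 1) * z' := by positivity
      have hw : |k * z - (k + 1) * z'| ≤ 1 := by rw [abs_le]; constructor <;> linarith
      have hδ : ((r - φ) * (k * z - (k + 1) * z')) ^ 2 ≤ C ^ 2 * y ^ 2 := by
        rw [mul_pow]
        have e1 : (r - φ) ^ 2 ≤ C ^ 2 * y ^ 2 := by
          rw [← mul_pow]
          refine sq_le_sq.2 (hl.trans (le_of_eq ?_))
          rw [abs_mul, abs_of_nonneg hC]
        have e2 : (k * z - (k + 1) * z') ^ 2 ≤ 1 := (sq_le_one_iff_abs_le_one _).2 hw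
        calc _ ≤ (r - φ) ^ 2 * 1 := by gcongr
          _ ≤ _ := by rw [mul_one]; exact e1
      -- The error of replacing the current rate by its limit. Both k z and (k + 1) z' lie in [0,
      -- 1], so it is bounded by the error of the rate uniformly in the degree.
      set δ := (r - φ) * (k * z - (k + 1) * z') with hδdef
      have heq : (if k = 0 then π a else 0) + r * (k * z - (k + 1) * z') - 2 * x (k + 1) =
          k * φ * (z - x k) + δ - (k + 1) * φ * (z' - x (k + 1)) := by
        rw [hxrec, hδdef]
        ring
      rw [heq]
      have hu : 0 ≤ (k + 1) * φ * (z' - x (k + 1)) ^ 2 := by positivity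
      -- The first square is Young's inequality, the second bounds the square of kφ(z - x_k) + δ by
      -- twice the sum of squares; the restoring term `hu` is dropped.
      nlinarith [sq_nonneg (z' - x (k + 1) - (k * φ * (z - x k) + δ)),
        sq_nonneg (k * φ * (z - x k) - δ)]

/-- The sum of the squared degrees is negligible with respect to the square of the total
degree. -/
lemma tendsto_meanAt_sum_sq (hm : IsAttachmentModel ℙ π κ B a₀ attr par) (hB : B.Connected)
    (hκ : ∀ a b, 0 < κ a b) (hπ : ∀ b, 0 < π b) (hπ1 : ∑ b, π b = 1) :
    Tendsto (fun n : ℕ => meanAt ℙ attr par n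
      (fun h => ∑ v, (h.adeg B v : ℝ) ^ 2) / (baseDegree B + 2 * n) ^ 2) atTop (𝓝 0) := by
  have ht := one_le_baseDegree hB
  have hshare := tendsto_meanAt_abs hm (tendsto_meanAt_share hm hB hκ hπ hπ1)
  choose C hC hlip using exists_rateAt_lipschitz hκ hπ hπ1
  set φ := max (phiLimit π κ 0) (phiLimit π κ 1)
  have hφ0 : 0 < φ := lt_max_of_lt_left (phiLimit_pos hκ hπ hπ1 0)
  have hφ2 : φ < 2 := max_lt (phiLimit_lt_two hκ hπ hπ1 0) (phiLimit_lt_two hκ hπ hπ1 1)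
  have hφa : ∀ a, phiLimit π κ a ≤ φ := fun a => by
    fin_cases a
    · exact le_max_left _ _
    · exact le_max_right _ _
  have hCa : ∀ a, C a ≤ C 0 + C 1 := fun a => by
    fin_cases a
    · exact le_add_of_nonneg_right (hC 1)
    · exact le_add_of_nonneg_left (hC 0)
  have hTlim : Tendsto (fun n : ℕ => (1 + φ) / (baseDegree B + 2 * (n : ℝ))) atTop (𝓝 0) := by
    refine tendsto_const_nhds.div_atTop (tendsto_atTop_add_const_left _ _ ?_)
    exact tendsto_natCast_atTop_atTop.const_mul_atTop (by norm_num)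
  -- A parent of degree d adds 2d + 1 to the sum of squares and is chosen at rate r_a d/T, so the
  -- growth factor is 1 + 2φ/T once the rates are near their limits.
  refine tendsto_meanAt_div_sq_of_step hm ht (c := 4 - 2 * φ) (by linarith) (by linarith)
    (F := fun n h => ∑ v, (h.adeg B v : ℝ) ^ 2)
    (R := fun n h => 3 * (C 0 + C 1) * |share B a₀ h 0 - etaLimit π κ 0| +
      (1 + φ) / (baseDegree B + 2 * n))
    (fun n h => Finset.sum_nonneg fun _ _ => sq_nonneg _) ?_ fun n h => ?_
  · simp only [meanAt_add, meanAt_const_mul, meanAt_const hm]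
    simpa using (hshare.const_mul (3 * (C 0 + C 1))).add hTlim
  · have hT : 1 ≤ baseDegree B + 2 * (n : ℝ) := by
      have := Nat.cast_nonneg (α := ℝ) n
      linarith
    set f : Fin 2 → ℕ → ℝ := fun _ d => (d : ℝ) ^ 2 with hf
    have h0 : ∀ m (h : History V₀ (Fin 2) m), ∑ v, (h.adeg B v : ℝ) ^ 2 = degSum B a₀ f h :=
      fun m h => rfl
    simp only [h0]
    have h1 := stepMean_degSum (π := π) hB hκ a₀ h f
    have h2 : stepMean π κ B a₀ h (fun b v => degSum B a₀ f (h.snoc b v)) =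
        degSum B a₀ f h +
        stepMean π κ B a₀ h (fun b v => degSum B a₀ f (h.snoc b v) - degSum B a₀ f h) := by
      conv_rhs => rw [← stepMean_const hB hκ hπ1 a₀ h (degSum B a₀ f h), ← stepMean_add]
      congr 1
      funext b v
      rw [stepMean_const hB hκ hπ1]
      ring
    rw [h2, h1]
    have h3 : ∑ b, π b * f b 1 = 1 := by simpa [hf] using hπ1
    set D := |share B a₀ h 0 - etaLimit π κ 0|
    have hD : 0 ≤ D := abs_nonneg _
    have hr : ∀ a, rateAt π κ (share B a₀ h) a ≤ φ + (C 0 + C 1) * D := fun a => by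
      have e1 := le_of_abs_le (hlip a (share B a₀ h) (share_nonneg hB a₀ h) (sum_share hB a₀ h))
      have e2 : C a * D ≤ (C 0 + C 1) * D := mul_le_mul_of_nonneg_right (hCa a) hD
      linarith [hφa a]
    set T := baseDegree B + 2 * (n : ℝ) with hTdef
    -- This crude bound is spent only on the product with the share error D, which tends to zero in
    -- mean.
    have hQ : degSum B a₀ f h ≤ T ^ 2 := by
      have e1 : ∀ w, (h.adeg B w : ℝ) ≤ T := fun w => by
        rw [hTdef, ← sum_adeg B h]
        exact Finset.single_le_sum (f := fun w => (h.adeg B w : ℝ)) (fun _ _ => by positivity)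
          (Finset.mem_univ w)
      calc degSum B a₀ f h = ∑ w, (h.adeg B w : ℝ) * h.adeg B w :=
            Finset.sum_congr rfl fun w _ => by simp only [hf]; ring
        _ ≤ ∑ w, T * (h.adeg B w : ℝ) := Finset.sum_le_sum fun w _ => by
            have := e1 w
            gcongr
        _ = T ^ 2 := by rw [← Finset.mul_sum, sum_adeg B h]; ring
    have h4 : degSum B a₀ (fun a d => rateAt π κ (share B a₀ h) a *
        (d * (f a (d + 1) - f a d))) h ≤
          (φ + (C 0 + C 1) * D) * (2 * degSum B a₀ f h + T) := by
      rw [hTdef, ← sum_adeg B h, degSum, degSum, Finset.mul_sum, ← Finset.sum_add_distrib,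
        Finset.mul_sum]
      refine Finset.sum_le_sum fun w _ => ?_
      have e1 : ((h.adeg B w : ℝ) * (f (h.attr a₀ w) (h.adeg B w + 1) -
          f (h.attr a₀ w) (h.adeg B w))) = 2 * f (h.attr a₀ w) (h.adeg B w) + h.adeg B w := by
        simp only [hf]; push_cast; ring
      rw [e1]
      refine mul_le_mul_of_nonneg_right (hr _) ?_
      simp only [hf]
      positivity
    have hT0 : 0 < T := by linarith
    rw [h3]
    set Q := degSum B a₀ f h
    have h5 : degSum B a₀ (fun a d => rateAt π κ (share B a₀ h) a *
        (d * (f a (d + 1) - f a d))) h / T ≤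
        φ * (2 * Q + T) / T + (C 0 + C 1) * D * (3 * T) := by
      rw [div_le_iff₀ hT0, add_mul, div_mul_cancel₀ _ hT0.ne']
      refine h4.trans ?_
      rw [add_mul]
      have e0 : 0 ≤ (C 0 + C 1) * D := mul_nonneg (add_nonneg (hC 0) (hC 1)) hD
      have e1 : 2 * Q + T ≤ 3 * T * T := by nlinarith
      have := mul_le_mul_of_nonneg_left e1 e0
      linarith
    have h6 : φ * (2 * Q + T) / T = 2 * φ * Q / T + φ := by field_simp
    have h7 : T * (3 * (C 0 + C 1) * D + (1 + φ) / T) = (C 0 + C 1) * D * (3 * T) + (1 + φ) := by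
      field_simp
    rw [h7]
    have h8 : (4 - (4 - 2 * φ)) * Q / T = 2 * φ * Q / T := by ring
    rw [h8]
    linarith

end Limits

open History

/-! ### The limiting degree law, its tails, its thinning and mixtures -/

section DegreeLaw

variable {K : Type*} [Fintype K] {π : K → ℝ} {κ : K → K → ℝ} {a : K}

lemma degreePMF_nonneg (hφ : 0 < phiLimit π κ a) (k : ℕ) : 0 ≤ degreePMF π κ a k := by
  rcases Nat.eq_zero_or_pos k with rfl | hk
  · rw [degreePMF_zero]
  · have hc : 0 < 2 / phiLimit π κ a := by positivity
    have h1 := Real.Gamma_pos_of_pos (s := 1 + 2 / phiLimit π κ a) (by positivity)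
    have h2 := Real.Gamma_pos_of_pos (s := (k : ℝ)) (by positivity)
    have h3 := Real.Gamma_pos_of_pos (s := k + 1 + 2 / phiLimit π κ a) (by positivity)
    rw [degreePMF]
    positivity

/-- The partial sums of the limiting degree distribution tend to `1` at rate `1 / m`. -/
lemma sum_range_degreePMF (hφ : 0 < phiLimit π κ a) (hφ2 : phiLimit π κ a < 2) (m : ℕ) :
    1 - 1 / ((m : ℝ) + 1) ≤ ∑ k ∈ Finset.range (m + 1), degreePMF π κ a k ∧
      ∑ k ∈ Finset.range (m + 1), degreePMF π κ a k ≤ 1 := by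
  set c := 2 / phiLimit π κ a with hc
  have hc1 : 1 < c := by rw [hc, one_lt_div hφ]; exact hφ2
  -- The exact tail P(D > m). Its ratios (m + 1)/(m + 1 + c) are at most (m + 1)/(m + 2) because c =
  -- 2/φ > 1, so it is bounded by the telescoping product 1/(m + 1).
  set t : ℕ → ℝ := fun m => Real.Gamma (1 + c) * Real.Gamma (m + 1) / Real.Gamma (m + 1 + c) with ht
  have hΓ0 : 0 < Real.Gamma (1 + c) := Real.Gamma_pos_of_pos (by positivity)
  have hΓ : ∀ m : ℕ, 0 < Real.Gamma (m + 1 + c) := fun m => Real.Gamma_pos_of_pos (by positivity)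
  have hΓ1 : ∀ m : ℕ, 0 < Real.Gamma ((m : ℝ) + 1) := fun m =>
    Real.Gamma_pos_of_pos (by positivity)
  have ht0 : t 0 = 1 := by
    simp only [ht, Nat.cast_zero, zero_add, Real.Gamma_one, mul_one]
    exact div_self hΓ0.ne'
  have hrec : ∀ m : ℕ, Real.Gamma (m + 1 + 1 + c) = (m + 1 + c) * Real.Gamma (m + 1 + c) := by
    intro m
    rw [← Real.Gamma_add_one (by positivity)]
    ring_nf
  have htsucc : ∀ m : ℕ, t (m + 1) = t m * ((m + 1) / (m + 1 + c)) := by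
    intro m
    simp only [ht]
    push_cast
    rw [hrec, Real.Gamma_add_one (s := (m : ℝ) + 1) (by positivity)]
    field_simp
  have htpos : ∀ m, 0 ≤ t m := fun m => by
    simp only [ht]
    have := hΓ m; have := hΓ1 m
    positivity
  have htle : ∀ m : ℕ, t m ≤ 1 / ((m : ℝ) + 1) := by
    intro m
    induction m with
    | zero => simp [ht0]
    | succ m ih =>
      rw [htsucc]
      calc t m * ((m + 1) / (m + 1 + c)) ≤ 1 / ((m : ℝ) + 1) * ((m + 1) / (m + 1 + 1)) := by
            gcongr
        _ = _ := by
            push_cast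
            field_simp
  have hsum : ∀ m : ℕ, ∑ k ∈ Finset.range (m + 1), degreePMF π κ a k = 1 - t m := by
    intro m
    induction m with
    | zero => simp [degreePMF_zero, ht0]
    | succ m ih =>
      rw [Finset.sum_range_succ, ih, htsucc]
      have : degreePMF π κ a (m + 1) = t m * (c / (m + 1 + c)) := by
        rw [degreePMF, ← hc]
        simp only [ht]
        push_cast
        rw [hrec]
        have := hΓ m
        field_simp
      rw [this]
      have hp : (0 : ℝ) < m + 1 + c := by positivity
      field_simp
      ring
  rw [hsum]
  constructor
  · linarith [htle m]
  · linarith [htpos m]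

lemma hasSum_degreePMF (hφ : 0 < phiLimit π κ a) (hφ2 : phiLimit π κ a < 2) :
    HasSum (degreePMF π κ a) 1 := by
  rw [hasSum_iff_tendsto_nat_of_nonneg (degreePMF_nonneg hφ), ← tendsto_add_atTop_iff_nat 1]
  refine tendsto_of_tendsto_of_tendsto_of_le_of_le ?_ tendsto_const_nhds
    (fun m => (sum_range_degreePMF hφ hφ2 m).1) (fun m => (sum_range_degreePMF hφ hφ2 m).2)
  simpa using tendsto_const_nhds.sub (tendsto_one_div_add_atTop_nhds_zero_nat (𝕜 := ℝ))

lemma summable_degreePMF_mul (hφ : 0 < phiLimit π κ a) (hφ2 : phiLimit π κ a < 2) {β : ℕ → ℝ}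
    (hβ : ∀ k, 0 ≤ β k ∧ β k ≤ 1) : Summable fun k => degreePMF π κ a k * β k :=
  Summable.of_nonneg_of_le (fun k => mul_nonneg (degreePMF_nonneg hφ k) (hβ k).1)
    (fun k => mul_le_of_le_one_right (degreePMF_nonneg hφ k) (hβ k).2)
    (hasSum_degreePMF hφ hφ2).summable

lemma abs_tsum_sub_sum_degreePMF (hφ : 0 < phiLimit π κ a) (hφ2 : phiLimit π κ a < 2) {β : ℕ → ℝ}
    (hβ : ∀ k, 0 ≤ β k ∧ β k ≤ 1) (m : ℕ) :
    |∑' k, degreePMF π κ a k * β k - ∑ k ∈ Finset.range (m + 1), degreePMF π κ a k * β k| ≤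
      1 / ((m : ℝ) + 1) := by
  have h1 := (summable_degreePMF_mul hφ hφ2 hβ).sum_add_tsum_nat_add (m + 1)
  have h2 := (hasSum_degreePMF hφ hφ2).summable.sum_add_tsum_nat_add (m + 1)
  rw [(hasSum_degreePMF hφ hφ2).tsum_eq] at h2
  rw [← h1, add_sub_cancel_left, abs_of_nonneg (tsum_nonneg fun k =>
    mul_nonneg (degreePMF_nonneg hφ _) (hβ _).1)]
  have h3 : ∑' k, degreePMF π κ a (k + (m + 1)) * β (k + (m + 1)) ≤
      ∑' k, degreePMF π κ a (k + (m + 1)) :=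
    Summable.tsum_le_tsum (fun k => mul_le_of_le_one_right (degreePMF_nonneg hφ _) (hβ _).2)
      ((summable_nat_add_iff (m + 1)).2 (summable_degreePMF_mul hφ hφ2 hβ))
      ((summable_nat_add_iff (m + 1)).2 (hasSum_degreePMF hφ hφ2).summable)
  linarith [(sum_range_degreePMF hφ hφ2 m).1]

open ProbabilityTheory in
-- One computation for both uses: Dirac kernels give the degree law itself, binomial kernels its
-- thinning.
lemma degreeLaw_bind_real (hφ : 0 < phiLimit π κ a) (hφ2 : phiLimit π κ a < 2) (ν : ℕ → Measure ℕ)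
    [∀ k, IsProbabilityMeasure (ν k)] (s : Set ℕ) :
    ((degreeLaw π κ a).bind ν).real s = ∑' k, degreePMF π κ a k * (ν k).real s := by
  have hs : MeasurableSet s := MeasurableSet.of_discrete
  rw [Measure.real, Measure.bind_apply hs (measurable_from_top).aemeasurable, degreeLaw,
    lintegral_sum_measure]
  simp only [lintegral_smul_measure, lintegral_dirac, smul_eq_mul]
  rw [ENNReal.tsum_toReal_eq fun k => ENNReal.mul_ne_top ENNReal.ofReal_ne_top (measure_ne_top _ _)]
  simp only [ENNReal.toReal_mul, ENNReal.toReal_ofReal (degreePMF_nonneg hφ _)]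
  rw [eq_comm, tsum_eq_zero_add']
  · simp [degreePMF_zero, Measure.real]
  · exact (summable_nat_add_iff 1).2 (summable_degreePMF_mul hφ hφ2
      (β := fun k => (ν k).real s) fun k => ⟨measureReal_nonneg, measureReal_le_one⟩)

lemma degreeLaw_real (hφ : 0 < phiLimit π κ a) (hφ2 : phiLimit π κ a < 2) (s : Set ℕ) :
    (degreeLaw π κ a).real s = ∑' k, degreePMF π κ a k * s.indicator 1 k := by
  have := degreeLaw_bind_real hφ hφ2 (fun k => Measure.dirac k) s
  rw [Measure.bind_dirac] at this
  rw [this]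
  refine tsum_congr fun k => ?_
  by_cases hk : k ∈ s <;> simp [Measure.real, hk]

lemma thinning_real (hφ : 0 < phiLimit π κ a) (hφ2 : phiLimit π κ a < 2) (p : unitInterval) (s : Set ℕ) :
    (thinning p (degreeLaw π κ a)).real s =
      ∑' k, degreePMF π κ a k * (ProbabilityTheory.binomial k p).real s :=
  degreeLaw_bind_real hφ hφ2 _ s

lemma isProbabilityMeasure_degreeLaw (hφ : 0 < phiLimit π κ a) (hφ2 : phiLimit π κ a < 2) :
    IsProbabilityMeasure (degreeLaw π κ a) := by
  have h1 := hasSum_degreePMF hφ hφ2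
  constructor
  rw [degreeLaw, Measure.sum_apply _ MeasurableSet.univ]
  simp only [Measure.smul_apply, measure_univ, smul_eq_mul, mul_one]
  rw [← ENNReal.ofReal_tsum_of_nonneg (fun k => degreePMF_nonneg hφ _)
    ((summable_nat_add_iff 1).2 h1.summable)]
  have h2 := h1.summable.tsum_eq_zero_add
  rw [degreePMF_zero, zero_add, h1.tsum_eq] at h2
  rw [← h2, ENNReal.ofReal_one]

lemma isProbabilityMeasure_thinning (p : unitInterval) (μ : Measure ℕ) [IsProbabilityMeasure μ] :
    IsProbabilityMeasure (thinning p μ) := by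
  constructor
  rw [thinning, Measure.bind_apply MeasurableSet.univ (measurable_from_top).aemeasurable]
  simp

lemma mixture_real {q : ℝ} (hq₀ : 0 ≤ q) (hq₁ : q ≤ 1) (μ ν : Measure ℕ) [IsFiniteMeasure μ]
    [IsFiniteMeasure ν] (s : Set ℕ) :
    (mixture q μ ν).real s = q * μ.real s + (1 - q) * ν.real s := by
  rw [mixture, Measure.real, Measure.add_apply, Measure.smul_apply, Measure.smul_apply,
    smul_eq_mul, smul_eq_mul, ENNReal.toReal_add, ENNReal.toReal_mul, ENNReal.toReal_mul,
    ENNReal.toReal_ofReal hq₀, ENNReal.toReal_ofReal (by linarith)]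
  · rfl
  · exact ENNReal.mul_ne_top ENNReal.ofReal_ne_top (measure_ne_top _ _)
  · exact ENNReal.mul_ne_top ENNReal.ofReal_ne_top (measure_ne_top _ _)

lemma isProbabilityMeasure_mixture {q : ℝ} (hq₀ : 0 ≤ q) (hq₁ : q ≤ 1) (μ ν : Measure ℕ)
    [IsProbabilityMeasure μ] [IsProbabilityMeasure ν] : IsProbabilityMeasure (mixture q μ ν) := by
  constructor
  rw [mixture, Measure.add_apply, Measure.smul_apply, Measure.smul_apply, measure_univ,
    measure_univ, smul_eq_mul, smul_eq_mul, mul_one, mul_one,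
    ← ENNReal.ofReal_add hq₀ (by linarith)]
  simp

lemma binomial_real_Ici (d : ℕ) (p : unitInterval) (k : ℕ) :
    (ProbabilityTheory.binomial d p).real (Set.Ici k) =
      ∑ i ∈ Finset.range (d + 1),
        (d.choose i : ℝ) * ((p : ℝ) ^ i * (1 - p) ^ (d - i) * if k ≤ i then 1 else 0) := by
  rw [← integral_indicator_one MeasurableSet.of_discrete, ProbabilityTheory.integral_binomial,
    ← Nat.range_succ_eq_Iic]
  refine Finset.sum_congr rfl fun i _ => ?_
  by_cases hk : k ≤ i <;> simp [hk, mul_assoc]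

end DegreeLaw

/-! ### Averages of bounded functions of the degree -/

section Limits

variable {V₀ Ω : Type*} [Fintype V₀] [MeasurableSpace Ω]
  {ℙ : Measure Ω} [IsProbabilityMeasure ℙ] {π : Fin 2 → ℝ} {κ : Fin 2 → Fin 2 → ℝ}
  {B : SimpleGraph V₀} {a₀ : V₀ → Fin 2} {attr : ℕ → Ω → Fin 2}
  {par : (n : ℕ) → Ω → V₀ ⊕ Fin n}

/-- Vertices of degree above m carry more than m half-edges each, so there are at most T/(m + 1) of
them. The cutoff error is uniform in n, matching the tail bound of the limit law. -/
lemma abs_degSum_sub_sum_degFreq {B : SimpleGraph V₀} (hB : B.Connected) (a₀ : V₀ → Fin 2)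
    (a : Fin 2) {β : ℕ → ℝ} (hβ : ∀ k, 0 ≤ β k ∧ β k ≤ 1) (m : ℕ) {n : ℕ}
    (h : History V₀ (Fin 2) n) :
    |degSum B a₀ (fun a' d => if a' = a then β d else 0) h / (baseDegree B + 2 * n) -
      ∑ k ∈ Finset.range (m + 1), β k * degFreq B a₀ a k h| ≤ 1 / ((m : ℝ) + 1) := by
  classical
  have ht := one_le_baseDegree hB
  have hT : 0 < baseDegree B + 2 * (n : ℝ) := by positivity
  simp only [degFreq, mul_div_assoc']
  rw [← Finset.sum_div, ← sub_div, abs_div, abs_of_pos hT, div_le_div_iff₀ hT (by positivity),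
    one_mul]
  have h1 : degSum B a₀ (fun a' d => if a' = a then β d else 0) h -
      ∑ k ∈ Finset.range (m + 1), β k * degSum B a₀
        (fun a' d => if a' = a ∧ d = k then 1 else 0) h =
      ∑ w, if h.attr a₀ w = a ∧ m < h.adeg B w then β (h.adeg B w) else 0 := by
    simp only [degSum, Finset.mul_sum]
    rw [Finset.sum_comm, ← Finset.sum_sub_distrib]
    refine Finset.sum_congr rfl fun w _ => ?_
    by_cases hw : h.attr a₀ w = a
    · by_cases hd : m < h.adeg B w
      · rw [Finset.sum_eq_zero]
        · simp [hw, hd]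
        · intro k hk
          have : h.adeg B w ≠ k := by
            have := Finset.mem_range.1 hk
            omega
          simp [this]
      · rw [Finset.sum_eq_single (h.adeg B w)]
        · simp [hw, hd]
        · intro k _ hk
          simp [Ne.symm hk]
        · intro hk
          exact absurd (Finset.mem_range.2 (by omega)) hk
    · simp [hw]
  have hterm : ∀ w, 0 ≤ (if h.attr a₀ w = a ∧ m < h.adeg B w then β (h.adeg B w) else 0) ∧
      (if h.attr a₀ w = a ∧ m < h.adeg B w then β (h.adeg B w) else 0) * ((m : ℝ) + 1) ≤
        h.adeg B w := by
    intro w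
    split_ifs with hw
    · have h2 : ((m : ℝ) + 1) ≤ h.adeg B w := by exact_mod_cast hw.2
      have h3 := hβ (h.adeg B w)
      refine ⟨h3.1, ?_⟩
      calc _ ≤ 1 * ((m : ℝ) + 1) := by gcongr; exact h3.2
        _ ≤ _ := by rw [one_mul]; exact h2
    · simp
  have h1' : degSum B a₀ (fun a' d => if a' = a then β d else 0) h -
      ∑ k ∈ Finset.range (m + 1), β k * degSum B a₀
        (fun a' d => if a' = a ∧ d = k then 1 else 0) h =
      ∑ w, if h.attr a₀ w = a ∧ m < h.adeg B w then β (h.adeg B w) else 0 := by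
    rw [← h1]
  have h4 : 0 ≤ ∑ w, if h.attr a₀ w = a ∧ m < h.adeg B w then β (h.adeg B w) else 0 :=
    Finset.sum_nonneg fun w _ => (hterm w).1
  have h5 : (∑ w, if h.attr a₀ w = a ∧ m < h.adeg B w then β (h.adeg B w) else 0) *
      ((m : ℝ) + 1) ≤ baseDegree B + 2 * n := by
    rw [← sum_adeg B h, Finset.sum_mul]
    exact Finset.sum_le_sum fun w _ => (hterm w).2
  rw [show (|_| : ℝ) = _ from (congrArg abs (by convert h1')).trans (abs_of_nonneg h4)]
  exact h5

/-- Averages of bounded functions of the degree over the vertices of one attribute converge. -/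
lemma tendsto_meanAt_degSum (hm : IsAttachmentModel ℙ π κ B a₀ attr par) (hB : B.Connected)
    (hκ : ∀ a b, 0 < κ a b) (hπ : ∀ b, 0 < π b) (hπ1 : ∑ b, π b = 1) (a : Fin 2) {β : ℕ → ℝ}
    (hβ : ∀ k, 0 ≤ β k ∧ β k ≤ 1) :
    Tendsto (fun n => meanAt ℙ attr par n fun h =>
      |degSum B a₀ (fun a' d => if a' = a then β d else 0) h / (baseDegree B + 2 * n) -
        π a / 2 * ∑' k, degreePMF π κ a k * β k|) atTop (𝓝 0) := by
  have hφ := phiLimit_pos hκ hπ hπ1 a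
  have hφ2 := phiLimit_lt_two hκ hπ hπ1 a
  have hπa : π a / 2 ≤ 1 := by
    have := Finset.single_le_sum (fun b _ => (hπ b).le) (Finset.mem_univ a)
    rw [hπ1] at this
    linarith
  have hfreq := fun k => tendsto_meanAt_abs hm (tendsto_meanAt_degFreq hm hB hκ hπ hπ1 a k)
  rw [Metric.tendsto_atTop]
  intro ε hε
  -- The cutoff is paid twice, for the network and for the limit law; below it only finitely many
  -- frequencies remain.
  obtain ⟨m, hm'⟩ := exists_nat_one_div_lt (show 0 < ε / 4 by positivity)
  have hsum : Tendsto (fun n => ∑ k ∈ Finset.range (m + 1), meanAt ℙ attr par n fun h =>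
      |degFreq B a₀ a k h - π a / 2 * degreePMF π κ a k|) atTop (𝓝 0) := by
    simpa using tendsto_finsetSum (Finset.range (m + 1)) fun k _ => hfreq k
  obtain ⟨N, hN⟩ := (Metric.tendsto_atTop.1 hsum) (ε / 2) (by positivity)
  refine ⟨N, fun n hn => ?_⟩
  have h0 := (le_abs_self _).trans_lt (by simpa only [Real.dist_eq, sub_zero] using hN n hn)
  rw [Real.dist_eq, sub_zero, abs_of_nonneg (meanAt_nonneg _ _ _ _ fun h => abs_nonneg _)]
  refine lt_of_le_of_lt (b := meanAt ℙ attr par n fun h =>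
    (∑ k ∈ Finset.range (m + 1), |degFreq B a₀ a k h - π a / 2 * degreePMF π κ a k|) + ε / 2)
    (meanAt_mono _ _ _ _ fun h => ?_) ?_
  · have h1 := abs_degSum_sub_sum_degFreq hB a₀ a hβ m h
    have h2 := abs_tsum_sub_sum_degreePMF hφ hφ2 hβ m
    have h3 : |∑ k ∈ Finset.range (m + 1), β k * degFreq B a₀ a k h -
        π a / 2 * ∑ k ∈ Finset.range (m + 1), degreePMF π κ a k * β k| ≤
        ∑ k ∈ Finset.range (m + 1), |degFreq B a₀ a k h - π a / 2 * degreePMF π κ a k| := by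
      rw [Finset.mul_sum, ← Finset.sum_sub_distrib]
      refine (Finset.abs_sum_le_sum_abs _ _).trans (Finset.sum_le_sum fun k _ => ?_)
      rw [show β k * degFreq B a₀ a k h - π a / 2 * (degreePMF π κ a k * β k) =
        β k * (degFreq B a₀ a k h - π a / 2 * degreePMF π κ a k) by ring, abs_mul,
        abs_of_nonneg (hβ k).1]
      exact mul_le_of_le_one_left (abs_nonneg _) (hβ k).2
    have h4 : |π a / 2 * ∑ k ∈ Finset.range (m + 1), degreePMF π κ a k * β k -
        π a / 2 * ∑' k, degreePMF π κ a k * β k| ≤ ε / 4 := by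
      rw [← mul_sub, abs_mul, abs_of_pos (by have := hπ a; positivity), abs_sub_comm]
      calc _ ≤ 1 * (1 / ((m : ℝ) + 1)) := by gcongr
        _ ≤ _ := by rw [one_mul]; exact hm'.le
    have h5 := abs_sub_le (degSum B a₀ (fun a' d => if a' = a then β d else 0) h /
      (baseDegree B + 2 * n)) (∑ k ∈ Finset.range (m + 1), β k * degFreq B a₀ a k h)
      (π a / 2 * ∑' k, degreePMF π κ a k * β k)
    have h6 := abs_sub_le (∑ k ∈ Finset.range (m + 1), β k * degFreq B a₀ a k h)
      (π a / 2 * ∑ k ∈ Finset.range (m + 1), degreePMF π κ a k * β k)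
      (π a / 2 * ∑' k, degreePMF π κ a k * β k)
    linarith
  · rw [meanAt_add, meanAt_finsetSum, meanAt_const hm]
    linarith

end Limits

/-! ### Traces of uniform subsets on small sets -/

section PatternCounts

/-- The number of subsets of size `m` of a set of size `N` with a given trace of size `a` on a
given subset of size `w`. -/
def patternCount (N m w a : ℕ) : ℕ := if a ≤ m then (N - w).choose (m - a) else 0

open Finset in
-- A set with prescribed trace is determined by its part outside W, of size m - a. The case
-- distinction in `patternCount` guards against truncated subtraction when a > m.
lemma card_filter_inter_eq {U : Type*} [DecidableEq U] {E W A : Finset U} (hW : W ⊆ E) (hA : A ⊆ W)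
    (m : ℕ) : #{T ∈ powersetCard m E | T ∩ W = A} = patternCount #E m #W #A := by
  rw [patternCount]
  split_ifs with ham
  · rw [← card_sdiff_of_subset hW, ← card_powersetCard]
    refine card_nbij' (fun T => T \ W) (fun S => S ∪ A) ?_ ?_ ?_ ?_
    · intro T hT
      simp only [coe_filter, mem_powersetCard, Set.mem_ofPred_eq] at hT
      obtain ⟨⟨hTE, hTm⟩, hTA⟩ := hT
      simp only [mem_coe, mem_powersetCard]
      refine ⟨sdiff_subset_sdiff hTE le_rfl, ?_⟩
      have := card_sdiff_add_card_inter T W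
      rw [hTA] at this
      omega
    · intro S hS
      simp only [mem_coe, mem_powersetCard] at hS
      obtain ⟨hSE, hSm⟩ := hS
      have hd : Disjoint S W := disjoint_of_subset_left hSE sdiff_disjoint
      simp only [coe_filter, mem_powersetCard, Set.mem_ofPred_eq]
      refine ⟨⟨union_subset (hSE.trans sdiff_subset) (hA.trans hW), ?_⟩, ?_⟩
      · rw [card_union_of_disjoint (disjoint_of_subset_right hA hd)]
        omega
      · rw [union_inter_distrib_right, disjoint_iff_inter_eq_empty.1 hd, empty_union,
          inter_eq_left.2 hA]
    · intro T hT
      simp only [coe_filter, mem_powersetCard, Set.mem_ofPred_eq] at hT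
      change T \ W ∪ A = T
      rw [← hT.2, sdiff_union_inter]
    · intro S hS
      simp only [mem_coe, mem_powersetCard] at hS
      change (S ∪ A) \ W = S
      rw [union_sdiff_distrib, sdiff_eq_empty_iff_subset.2 hA, union_empty]
      exact sdiff_eq_self_of_disjoint (disjoint_of_subset_left hS.1 sdiff_disjoint)
  · rw [card_eq_zero, filter_eq_empty_iff]
    intro T hT hTA
    have := card_le_card (inter_subset_left (s₁ := T) (s₂ := W))
    rw [hTA, (mem_powersetCard.1 hT).2] at this
    exact ham this

/-- Division-free form of the trace probability (m)_a (N - m)_{w-a} / (N)_w, with falling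
factorials. In the degenerate cases both sides vanish. -/
lemma patternCount_mul {N m w a : ℕ} (hm : m ≤ N) (hw : w ≤ N) (ha : a ≤ w) :
    patternCount N m w a * N.descFactorial w =
      N.choose m * (m.descFactorial a * (N - m).descFactorial (w - a)) := by
  rw [patternCount]
  split_ifs with ham
  · by_cases hwa : w - a ≤ N - m
    · have h1 := Nat.choose_mul_factorial_mul_factorial hm
      have h2 := Nat.choose_mul_factorial_mul_factorial (show m - a ≤ N - w by omega)
      have h3 := Nat.factorial_mul_descFactorial hw
      have h4 := Nat.factorial_mul_descFactorial ham
      have h5 := Nat.factorial_mul_descFactorial hwa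
      rw [show N - w - (m - a) = N - m - (w - a) by omega] at h2
      have hpos : 0 < (m - a).factorial * (N - m - (w - a)).factorial :=
        Nat.mul_pos (Nat.factorial_pos _) (Nat.factorial_pos _)
      refine Nat.eq_of_mul_eq_mul_right hpos ?_
      calc _ = (N - w).choose (m - a) * (m - a).factorial * (N - m - (w - a)).factorial *
            N.descFactorial w := by ring
        _ = N.choose m * m.factorial * (N - m).factorial := by rw [h2, h3, h1]
        _ = _ := by rw [← h4, ← h5]; ring
    · rw [Nat.choose_eq_zero_of_lt (show N - w < m - a by omega),
        Nat.descFactorial_eq_zero_iff_lt.2 (show N - m < w - a by omega)]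
      simp
  · rw [Nat.descFactorial_eq_zero_iff_lt.2 (show m < a by omega)]
    simp

lemma tendsto_descFactorial_div_pow {N m : ℕ → ℕ} {r : ℝ} (hN : Tendsto N atTop atTop)
    (hr : Tendsto (fun n => (m n : ℝ) / N n) atTop (𝓝 r)) (a : ℕ) :
    Tendsto (fun n => ((m n).descFactorial a : ℝ) / (N n : ℝ) ^ a) atTop (𝓝 (r ^ a)) := by
  have hshift : ∀ a : ℕ, Tendsto (fun n => ((m n - a : ℕ) : ℝ) / N n) atTop (𝓝 r) := by
    intro a
    have hinv : Tendsto (fun n => (a : ℝ) / N n) atTop (𝓝 0) :=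
      tendsto_const_nhds.div_atTop (tendsto_natCast_atTop_atTop.comp hN)
    have hlow : Tendsto (fun n => (m n : ℝ) / N n - a / N n) atTop (𝓝 r) := by
      simpa using hr.sub hinv
    refine tendsto_of_tendsto_of_tendsto_of_le_of_le hlow hr (fun n => ?_) fun n => ?_
    · have h1 : (m n : ℝ) - a ≤ ((m n - a : ℕ) : ℝ) := by
        rw [sub_le_iff_le_add, ← Nat.cast_add, Nat.cast_le]
        omega
      rw [← sub_div]
      exact div_le_div_of_nonneg_right h1 (Nat.cast_nonneg _)
    · exact div_le_div_of_nonneg_right (Nat.cast_le.2 (Nat.sub_le _ _)) (Nat.cast_nonneg _)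
  induction a with
  | zero => simp
  | succ a ih =>
    refine ((hshift a).mul ih).congr' ?_ |>.trans (by rw [pow_succ, mul_comm])
    refine Eventually.of_forall fun n => ?_
    dsimp only
    rw [Nat.descFactorial_succ, Nat.cast_mul, div_mul_div_comm, pow_succ, mul_comm ((N n : ℝ) ^ a)]

/-- Dividing the falling factorials by powers of N, sampling without replacement becomes sampling
with replacement, as w and a are fixed. -/
lemma tendsto_patternCount {N m : ℕ → ℕ} {p : ℝ} (hN : Tendsto N atTop atTop)
    (hmN : ∀ n, m n ≤ N n) (hp : Tendsto (fun n => (m n : ℝ) / N n) atTop (𝓝 p)) {w a : ℕ}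
    (ha : a ≤ w) :
    Tendsto (fun n => (patternCount (N n) (m n) w a : ℝ) / (N n).choose (m n)) atTop
      (𝓝 (p ^ a * (1 - p) ^ (w - a))) := by
  have hN0 : ∀ᶠ n in atTop, 0 < N n := hN.eventually_gt_atTop 0
  have h1 := tendsto_descFactorial_div_pow hN hp a
  have hq : Tendsto (fun n => ((N n - m n : ℕ) : ℝ) / N n) atTop (𝓝 (1 - p)) := by
    refine (tendsto_const_nhds.sub hp).congr' ?_
    filter_upwards [hN0] with n hn
    rw [Nat.cast_sub (hmN n), sub_div, div_self (by positivity)]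
  have h2 := tendsto_descFactorial_div_pow hN hq (w - a)
  have hone : Tendsto (fun n => (N n : ℝ) / N n) atTop (𝓝 1) := by
    refine tendsto_const_nhds.congr' ?_
    filter_upwards [hN0] with n hn
    rw [div_self (by positivity)]
  have h3 := tendsto_descFactorial_div_pow hN hone w
  rw [one_pow] at h3
  have h4 := (h1.mul h2).div h3 one_ne_zero
  rw [div_one] at h4
  refine h4.congr' ?_
  filter_upwards [hN0, hN.eventually_ge_atTop w] with n hn hw
  have hc : (0 : ℝ) < (N n).choose (m n) := by exact_mod_cast Nat.choose_pos (hmN n)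
  have hd : (0 : ℝ) < (N n).descFactorial w := by
    exact_mod_cast Nat.pos_of_ne_zero (mt Nat.descFactorial_eq_zero_iff_lt.1 (by omega))
  have hNn : (0 : ℝ) < N n := by exact_mod_cast hn
  have h5 : (patternCount (N n) (m n) w a : ℝ) * (N n).descFactorial w =
      (N n).choose (m n) * ((m n).descFactorial a * (N n - m n).descFactorial (w - a)) := by
    exact_mod_cast patternCount_mul (hmN n) hw ha
  have h6 : (N n : ℝ) ^ w = (N n : ℝ) ^ a * (N n : ℝ) ^ (w - a) := by
    rw [← pow_add, Nat.add_sub_cancel' ha]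
  change ((m n).descFactorial a : ℝ) / (N n : ℝ) ^ a *
    (((N n - m n).descFactorial (w - a) : ℝ) / (N n : ℝ) ^ (w - a)) /
    (((N n).descFactorial w : ℝ) / (N n : ℝ) ^ w) = _
  rw [div_mul_div_comm, ← h6, div_div_div_cancel_right₀ (by positivity), eq_div_iff hc.ne',
    div_mul_eq_mul_div, div_eq_iff hd.ne', h5]
  ring

/-- Uniform subsets of size `m` of a set of size `N` have, on subsets of size at most `K`, up to
`δ` the pattern probabilities of independent sampling at density `p`. -/
def PatternClose (N m : ℕ) (p : ℝ) (K : ℕ) (δ : ℝ) : Prop :=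
  ∀ w ≤ K, ∀ a ≤ w,
    |(patternCount N m w a : ℝ) / N.choose m - p ^ a * (1 - p) ^ (w - a)| ≤ δ

lemma eventually_patternClose {N m : ℕ → ℕ} {p : ℝ} (hN : Tendsto N atTop atTop)
    (hmN : ∀ n, m n ≤ N n) (hp : Tendsto (fun n => (m n : ℝ) / N n) atTop (𝓝 p)) (K : ℕ)
    {δ : ℝ} (hδ : 0 < δ) : ∀ᶠ n in atTop, PatternClose (N n) (m n) p K δ := by
  simp only [PatternClose]
  have : ∀ w ∈ Finset.range (K + 1), ∀ a ∈ Finset.range (w + 1), ∀ᶠ n in atTop,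
      |(patternCount (N n) (m n) w a : ℝ) / (N n).choose (m n) - p ^ a * (1 - p) ^ (w - a)| ≤
        δ := by
    intro w _ a ha
    have h1 := tendsto_patternCount hN hmN hp (Nat.lt_succ_iff.1 (Finset.mem_range.1 ha))
    filter_upwards [Metric.tendsto_nhds.1 h1 δ hδ] with n hn
    rw [Real.dist_eq] at hn
    exact hn.le
  have h2 := (Finset.eventually_all _).2 fun w hw => (Finset.eventually_all _).2 (this w hw)
  filter_upwards [h2] with n hn w hw a ha
  exact hn w (Finset.mem_range.2 (by omega)) a (Finset.mem_range.2 (by omega))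

end PatternCounts

/-! ### Comparison of uniform with independent sampling -/

section IndependentSampling

variable {U : Type*} [DecidableEq U]

/-- The mean of `f` over the random subset of `W` that contains every element independently with
probability `p`. -/
def bernoulliMean (p : ℝ) (W : Finset U) (f : Finset U → ℝ) : ℝ :=
  ∑ A ∈ W.powerset, p ^ A.card * (1 - p) ^ (W.card - A.card) * f A

lemma bernoulliMean_congr {p : ℝ} {W : Finset U} {f g : Finset U → ℝ}
    (h : ∀ A ⊆ W, f A = g A) : bernoulliMean p W f = bernoulliMean p W g :=
  Finset.sum_congr rfl fun A hA => by rw [h A (Finset.mem_powerset.1 hA)]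

lemma bernoulliMean_const_mul (p : ℝ) (W : Finset U) (c : ℝ) (f : Finset U → ℝ) :
    bernoulliMean p W (fun A => c * f A) = c * bernoulliMean p W f := by
  rw [bernoulliMean, bernoulliMean, Finset.mul_sum]
  exact Finset.sum_congr rfl fun _ _ => by ring

lemma bernoulliMean_insert (p : ℝ) {W : Finset U} {x : U} (hx : x ∉ W) (f : Finset U → ℝ) :
    bernoulliMean p (insert x W) f =
      (1 - p) * bernoulliMean p W f + p * bernoulliMean p W fun A => f (insert x A) := by
  rw [bernoulliMean, Finset.sum_powerset_insert hx, bernoulliMean, bernoulliMean, Finset.mul_sum,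
    Finset.mul_sum]
  congr 1
  · refine Finset.sum_congr rfl fun A hA => ?_
    have := Finset.card_le_card (Finset.mem_powerset.1 hA)
    rw [Finset.card_insert_of_notMem hx, Nat.succ_sub this, pow_succ]
    ring
  · refine Finset.sum_congr rfl fun A hA => ?_
    have hxA : x ∉ A := fun h => hx (Finset.mem_powerset.1 hA h)
    rw [Finset.card_insert_of_notMem hx, Finset.card_insert_of_notMem hxA, Nat.succ_sub_succ,
      pow_succ]
    ring

/-- Independence over disjoint sets, by revealing the elements of W one at a time. -/
lemma bernoulliMean_union (p : ℝ) {W W' : Finset U} (hd : Disjoint W W')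
    (f g : Finset U → ℝ) :
    bernoulliMean p (W ∪ W') (fun A => f (A ∩ W) * g (A ∩ W')) =
      bernoulliMean p W f * bernoulliMean p W' g := by
  induction W using Finset.induction_on generalizing f with
  | empty =>
    rw [Finset.empty_union, show bernoulliMean p ∅ f = f ∅ by simp [bernoulliMean],
      ← bernoulliMean_const_mul]
    refine bernoulliMean_congr fun A hA => ?_
    rw [Finset.inter_empty, Finset.inter_eq_left.2 hA]
  | insert x W hx ih =>
    rw [Finset.disjoint_insert_left] at hd
    have hx' : x ∉ W ∪ W' := by simp [hx, hd.1]
    rw [Finset.insert_union, bernoulliMean_insert p hx', bernoulliMean_insert p hx, add_mul,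
      mul_assoc, mul_assoc, ← ih hd.2, ← ih hd.2]
    congr 2
    · refine bernoulliMean_congr fun A hA => ?_
      rw [Finset.inter_insert_of_notMem fun h => hx' (hA h)]
    · refine bernoulliMean_congr fun A hA => ?_
      rw [Finset.insert_inter_of_notMem hd.1, ← Finset.insert_inter_distrib]

lemma bernoulliMean_const (p c : ℝ) (W : Finset U) : bernoulliMean p W (fun _ => c) = c := by
  induction W using Finset.induction_on with
  | empty => simp [bernoulliMean]
  | insert x W hx ih => rw [bernoulliMean_insert p hx, ih]; ring

lemma bernoulliMean_sub (p : ℝ) (W : Finset U) (f g : Finset U → ℝ) :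
    bernoulliMean p W (fun A => f A - g A) = bernoulliMean p W f - bernoulliMean p W g := by
  simp [bernoulliMean, mul_sub, Finset.sum_sub_distrib]

lemma bernoulliMean_mono {p : ℝ} (hp0 : 0 ≤ p) (hp1 : p ≤ 1) (W : Finset U) {f g : Finset U → ℝ}
    (h : ∀ A, f A ≤ g A) : bernoulliMean p W f ≤ bernoulliMean p W g := by
  have : 0 ≤ 1 - p := by linarith
  exact Finset.sum_le_sum fun A _ => mul_le_mul_of_nonneg_left (h A) (by positivity)

lemma bernoulliMean_card (p : ℝ) (W : Finset U) (f : ℕ → ℝ) :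
    bernoulliMean p W (fun A => f A.card) =
      ∑ i ∈ Finset.range (W.card + 1),
        (W.card.choose i : ℝ) * (p ^ i * (1 - p) ^ (W.card - i) * f i) := by
  rw [bernoulliMean, Finset.sum_powerset_apply_card
    (fun i => p ^ i * (1 - p) ^ (W.card - i) * f i)]
  simp

/-- The mean of a function of the trace of a uniform subset on a small set. -/
lemma abs_uniformMean_sub_bernoulliMean {E W : Finset U} {m K : ℕ} {p δ : ℝ} (hW : W ⊆ E)
    (hK : W.card ≤ K) (hδ : 0 ≤ δ) (hclose : PatternClose E.card m p K δ) {f : Finset U → ℝ}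
    (hf : ∀ A, |f A| ≤ 1) :
    |(∑ T ∈ E.powersetCard m, f (T ∩ W)) / E.card.choose m - bernoulliMean p W f| ≤
      2 ^ K * δ := by
  have h1 : ∑ T ∈ E.powersetCard m, f (T ∩ W) =
      ∑ A ∈ W.powerset, (patternCount E.card m W.card A.card : ℝ) * f A := by
    rw [← Finset.sum_fiberwise_of_maps_to (g := fun T => T ∩ W) (t := W.powerset)
      fun T _ => Finset.mem_powerset.2 Finset.inter_subset_right]
    refine Finset.sum_congr rfl fun A hA => ?_
    rw [← card_filter_inter_eq hW (Finset.mem_powerset.1 hA), Finset.sum_congr rfl (g := fun _ => f A)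
      fun T hT => by rw [(Finset.mem_filter.1 hT).2]]
    rw [Finset.sum_const, nsmul_eq_mul]
  -- There are at most 2^K traces, each with probability off by at most δ.
  rw [h1, Finset.sum_div, bernoulliMean, ← Finset.sum_sub_distrib]
  refine (Finset.abs_sum_le_sum_abs _ _).trans ?_
  have h2 : ∀ A ∈ W.powerset, |(patternCount E.card m W.card A.card : ℝ) * f A / E.card.choose m -
      p ^ A.card * (1 - p) ^ (W.card - A.card) * f A| ≤ δ := by
    intro A hA
    rw [mul_div_right_comm, ← sub_mul, abs_mul]
    exact (mul_le_of_le_one_right (abs_nonneg _) (hf A)).trans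
      (hclose _ hK _ (Finset.card_le_card (Finset.mem_powerset.1 hA)))
  refine (Finset.sum_le_sum h2).trans ?_
  rw [Finset.sum_const, nsmul_eq_mul, Finset.card_powerset]
  push_cast
  gcongr
  norm_num

open Classical in
/-- Second moment bound for the number of events, each determined by the trace of a uniform subset
on a small set, centred at the number expected under independent sampling. -/
lemma uniformMean_sq_sum_le {V : Type*} {E : Finset U} {m K : ℕ} {p δ : ℝ} (hm : m ≤ E.card)
    (hp0 : 0 ≤ p) (hp1 : p ≤ 1) (hδ : 0 ≤ δ) (hclose : PatternClose E.card m p (2 * K) δ)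
    (I : Finset V) (W : V → Finset U) (g : V → Finset U → ℝ)
    (hW : ∀ v ∈ I, W v ⊆ E ∧ (W v).card ≤ K) (hg : ∀ v A, 0 ≤ g v A ∧ g v A ≤ 1)
    (hgW : ∀ v T, g v T = g v (T ∩ W v)) :
    (∑ T ∈ E.powersetCard m, (∑ v ∈ I, (g v T - bernoulliMean p (W v) (g v))) ^ 2) /
        E.card.choose m ≤
      (I.card : ℝ) ^ 2 * (4 ^ K * δ) +
        ((I ×ˢ I).filter fun x => ¬ Disjoint (W x.1) (W x.2)).card := by
  set b : V → ℝ := fun v => bernoulliMean p (W v) (g v) with hb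
  have hb01 : ∀ v, 0 ≤ b v ∧ b v ≤ 1 := fun v => by
    constructor
    · rw [← bernoulliMean_const p 0 (W v)]
      exact bernoulliMean_mono hp0 hp1 _ fun A => (hg v A).1
    · rw [← bernoulliMean_const p 1 (W v)]
      exact bernoulliMean_mono hp0 hp1 _ fun A => (hg v A).2
  have habs : ∀ v A, |g v A - b v| ≤ 1 := fun v A => by
    have h1 := hg v A
    have h2 := hb01 v
    rw [abs_le]
    constructor <;> linarith
  have hC : (0 : ℝ) < E.card.choose m := by exact_mod_cast Nat.choose_pos hm
  have hexp : (∑ T ∈ E.powersetCard m, (∑ v ∈ I, (g v T - b v)) ^ 2) / E.card.choose m =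
      ∑ x ∈ I ×ˢ I, (∑ T ∈ E.powersetCard m, (g x.1 T - b x.1) * (g x.2 T - b x.2)) /
        E.card.choose m := by
    rw [← Finset.sum_div, Finset.sum_comm]
    congr 1
    refine Finset.sum_congr rfl fun T _ => ?_
    rw [sq, Finset.sum_mul_sum, Finset.sum_product]
  -- For disjoint W the covariance under independent sampling is zero, and the comparison on the
  -- union, of size at most 2K, costs 2^(2K) δ = 4^K δ. Overlapping pairs, including the diagonal,
  -- are bounded by 1.
  have hpair : ∀ x ∈ I ×ˢ I, (∑ T ∈ E.powersetCard m, (g x.1 T - b x.1) * (g x.2 T - b x.2)) /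
      E.card.choose m ≤ 4 ^ K * δ + if ¬ Disjoint (W x.1) (W x.2) then 1 else 0 := by
    rintro ⟨u, v⟩ hx
    obtain ⟨hu, hv⟩ := Finset.mem_product.1 hx
    dsimp only at hu hv ⊢
    by_cases hd : Disjoint (W u) (W v)
    swap
    · rw [if_pos hd]
      have h1 : ∑ T ∈ E.powersetCard m, (g u T - b u) * (g v T - b v) ≤
          ∑ T ∈ E.powersetCard m, (1 : ℝ) := by
        refine Finset.sum_le_sum fun T _ => (le_abs_self _).trans ?_
        rw [abs_mul]
        exact mul_le_one₀ (habs u T) (abs_nonneg _) (habs v T)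
      rw [Finset.sum_const, Finset.card_powersetCard, nsmul_eq_mul, mul_one] at h1
      have h2 := (div_le_one hC).2 h1
      have h3 : 0 ≤ 4 ^ K * δ := by positivity
      linarith
    · rw [if_neg (not_not.2 hd), add_zero]
      have hu1 := hW u hu
      have hv1 := hW v hv
      have h1 := abs_uniformMean_sub_bernoulliMean (Finset.union_subset hu1.1 hv1.1)
        (K := 2 * K) ((Finset.card_union_le _ _).trans (by omega)) hδ hclose
        (f := fun A => (g u (A ∩ W u) - b u) * (g v (A ∩ W v) - b v)) fun A => by
          rw [abs_mul]
          exact mul_le_one₀ (habs u _) (abs_nonneg _) (habs v _)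
      have h2 : bernoulliMean p (W u ∪ W v)
          (fun A => (g u (A ∩ W u) - b u) * (g v (A ∩ W v) - b v)) = 0 := by
        rw [bernoulliMean_union p hd (fun A => g u A - b u) (fun A => g v A - b v),
          bernoulliMean_sub, bernoulliMean_const, sub_self, zero_mul]
      rw [h2, sub_zero] at h1
      have h3 : ∀ T, (g u (T ∩ (W u ∪ W v) ∩ W u) - b u) * (g v (T ∩ (W u ∪ W v) ∩ W v) - b v) =
          (g u T - b u) * (g v T - b v) := by
        intro T
        rw [hgW u T, hgW v T, Finset.inter_assoc, Finset.inter_assoc,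
          Finset.inter_eq_right.2 Finset.subset_union_left,
          Finset.inter_eq_right.2 Finset.subset_union_right]
      simp only [h3] at h1
      have h4 := (le_abs_self _).trans h1
      rw [pow_mul] at h4
      norm_num at h4
      linarith
  rw [hexp]
  refine (Finset.sum_le_sum hpair).trans (le_of_eq ?_)
  rw [Finset.sum_add_distrib, Finset.sum_const, Finset.card_product, nsmul_eq_mul, Finset.sum_boole]
  push_cast
  ring

end IndependentSampling

open History

/-! ### Uniform samples of the random network and concentration of local counts -/

section RandomSampling

variable {V₀ K Ω : Type*} [Fintype V₀] [Fintype K] [MeasurableSpace Ω]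
  {ℙ : Measure Ω} [IsProbabilityMeasure ℙ] {π : K → ℝ} {κ : K → K → ℝ}
  {B : SimpleGraph V₀} {a₀ : V₀ → K} {attr : ℕ → Ω → K} {par : (n : ℕ) → Ω → V₀ ⊕ Fin n}
  {U : ℕ → Type*} [∀ n, Fintype (U n)]

/-- Given the history at time `n`, the set `S n` is uniformly distributed over the subsets of size
`m n` of the set `E n h`. -/
structure IsUniformSample (ℙ : Measure Ω) (attr : ℕ → Ω → K) (par : (n : ℕ) → Ω → V₀ ⊕ Fin n)
    (m : ℕ → ℕ) (E : ∀ n, History V₀ K n → Finset (U n)) (S : (n : ℕ) → Ω → Finset (U n)) :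
    Prop where
  measurableSet : ∀ n T, MeasurableSet {ω | S n ω = T}
  le_card : ∀ n h, m n ≤ (E n h).card
  law : ∀ (n : ℕ) (h : History V₀ K n), ∀ T ∈ (E n h).powersetCard (m n),
    ℙ.real {ω | historyAt attr par n ω = h ∧ S n ω = T} =
      ℙ.real {ω | historyAt attr par n ω = h} / ((E n h).card).choose (m n)

variable {m : ℕ → ℕ} {E : ∀ n, History V₀ K n → Finset (U n)} {S : (n : ℕ) → Ω → Finset (U n)}

lemma IsUniformSample.integral_eq (hm : IsAttachmentModel ℙ π κ B a₀ attr par)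
    (hS : IsUniformSample ℙ attr par m E S) (n : ℕ) (F : History V₀ K n → Finset (U n) → ℝ) :
    ∫ ω, F (historyAt attr par n ω) (S n ω) ∂ℙ =
      meanAt ℙ attr par n fun h =>
        (∑ T ∈ (E n h).powersetCard (m n), F h T) / ((E n h).card).choose (m n) := by
  classical
  have hmeas : ∀ x : History V₀ K n × Finset (U n),
      MeasurableSet {ω | (historyAt attr par n ω, S n ω) = x} := by
    rintro ⟨h, T⟩
    simp only [Prod.mk.injEq]
    exact (measurableSet_historyAt hm n h).inter (hS.measurableSet n T)
  have hfib : ∀ h : History V₀ K n, ∑ T, ℙ.real {ω | historyAt attr par n ω = h ∧ S n ω = T} =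
      ℙ.real {ω | historyAt attr par n ω = h} := by
    intro h
    have h1 := integral_comp_of_fintype ℙ (fun ω => (historyAt attr par n ω, S n ω)) hmeas
      (fun x => if x.1 = h then 1 else 0)
    have h2 := integral_comp_of_fintype ℙ (historyAt attr par n) (measurableSet_historyAt hm n)
      (fun x => if x = h then 1 else 0)
    dsimp only at h1 h2
    rw [h1, Fintype.sum_prod_type] at h2
    simpa using h2
  -- The law is prescribed only on admissible sets, but these already exhaust the mass of the
  -- history, so all others are null.
  have hzero : ∀ h : History V₀ K n, ∀ T ∉ (E n h).powersetCard (m n),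
      ℙ.real {ω | historyAt attr par n ω = h ∧ S n ω = T} = 0 := by
    intro h T hT
    have h1 := hfib h
    have h2 : ∑ T ∈ (E n h).powersetCard (m n),
        ℙ.real {ω | historyAt attr par n ω = h ∧ S n ω = T} =
        ℙ.real {ω | historyAt attr par n ω = h} := by
      have hc : (0 : ℝ) < ((E n h).card).choose (m n) := by
        exact_mod_cast Nat.choose_pos (hS.le_card n h)
      rw [Finset.sum_congr rfl (hS.law n h), Finset.sum_const, Finset.card_powersetCard,
        nsmul_eq_mul, mul_div_cancel₀ _ hc.ne']
    rw [← Finset.sum_add_sum_compl ((E n h).powersetCard (m n)), h2, add_eq_left] at h1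
    exact (Finset.sum_eq_zero_iff_of_nonneg fun _ _ => measureReal_nonneg).1 h1 T
      (Finset.mem_compl.2 hT)
  rw [integral_comp_of_fintype ℙ (fun ω => (historyAt attr par n ω, S n ω)) hmeas
    (fun x => F x.1 x.2), Fintype.sum_prod_type]
  refine Finset.sum_congr rfl fun h _ => ?_
  dsimp only
  rw [Finset.sum_div, Finset.mul_sum, ← Finset.sum_subset (Finset.subset_univ _)
    fun T _ hT => by
      have := hzero h T hT
      simp only [Prod.mk.injEq]
      rw [this, zero_mul]]
  refine Finset.sum_congr rfl fun T hT => ?_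
  simp only [Prod.mk.injEq]
  rw [hS.law n h T hT]
  ring

lemma IsUniformSample.integrable (hm : IsAttachmentModel ℙ π κ B a₀ attr par)
    (hS : IsUniformSample ℙ attr par m E S) (n : ℕ) (F : History V₀ K n → Finset (U n) → ℝ) :
    Integrable (fun ω => F (historyAt attr par n ω) (S n ω)) ℙ := by
  refine integrable_comp_of_fintype ℙ (fun ω => (historyAt attr par n ω, S n ω)) ?_
    (fun x => F x.1 x.2)
  rintro ⟨h, T⟩
  simp only [Prod.mk.injEq]
  exact (measurableSet_historyAt hm n h).inter (hS.measurableSet n T)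

lemma IsUniformSample.ae_mem (hm : IsAttachmentModel ℙ π κ B a₀ attr par)
    (hS : IsUniformSample ℙ attr par m E S) (n : ℕ) :
    ∀ᵐ ω ∂ℙ, S n ω ∈ (E n (historyAt attr par n ω)).powersetCard (m n) := by
  classical
  have h1 := hS.integral_eq hm n
    (fun h T => if T ∈ (E n h).powersetCard (m n) then 0 else 1)
  have h2 : meanAt ℙ attr par n (fun h => (∑ T ∈ (E n h).powersetCard (m n),
      if T ∈ (E n h).powersetCard (m n) then (0 : ℝ) else 1) /
        ((E n h).card).choose (m n)) = 0 := by
    refine Finset.sum_eq_zero fun h _ => ?_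
    dsimp only
    rw [Finset.sum_eq_zero fun T hT => if_pos hT]
    simp
  have h3 := (integral_eq_zero_iff_of_nonneg
    (fun ω => by dsimp only [Pi.zero_apply]; split_ifs <;> simp) (hS.integrable hm n
      fun h T => if T ∈ (E n h).powersetCard (m n) then 0 else 1)).1 (h1.trans h2)
  filter_upwards [h3] with ω hω
  by_contra hc
  simp [hc] at hω

open Classical in
-- A union bound over a common element. The right side is at most a multiple of |E| for edge
-- samples, and comparable to the sum of squared degrees for node samples.
lemma card_not_disjoint_le {V U : Type*} (I : Finset V) (E : Finset U) (W : V → Finset U)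
    (hW : ∀ v ∈ I, W v ⊆ E) :
    ((I ×ˢ I).filter fun x => ¬ Disjoint (W x.1) (W x.2)).card ≤
      ∑ x ∈ E, (I.filter fun v => x ∈ W v).card ^ 2 := by
  have : ((I ×ˢ I).filter fun x => ¬ Disjoint (W x.1) (W x.2)) ⊆
      E.biUnion fun x => (I.filter fun v => x ∈ W v) ×ˢ (I.filter fun v => x ∈ W v) := by
    rintro ⟨u, v⟩ huv
    simp only [Finset.mem_filter, Finset.mem_product] at huv
    obtain ⟨x, hxu, hxv⟩ := Finset.not_disjoint_iff.1 huv.2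
    simp only [Finset.mem_biUnion, Finset.mem_product, Finset.mem_filter]
    exact ⟨x, hW u huv.1.1 hxu, ⟨huv.1.1, hxu⟩, ⟨huv.1.2, hxv⟩⟩
  refine (Finset.card_le_card this).trans (Finset.card_biUnion_le.trans (le_of_eq ?_))
  exact Finset.sum_congr rfl fun x _ => by rw [Finset.card_product, sq]

/-- Markov's inequality for the degree of a vertex; it allows truncation to bounded degrees. -/
lemma card_filter_lt_adeg (B : SimpleGraph V₀) {n : ℕ} (h : History V₀ K n) (k : ℕ) :
    ((Finset.univ.filter fun v => k < h.adeg B v).card : ℝ) * (k + 1) ≤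
      baseDegree B + 2 * n := by
  rw [← sum_adeg B h, ← nsmul_eq_mul, ← Finset.sum_const]
  refine (Finset.sum_le_sum (g := fun v => (h.adeg B v : ℝ)) fun v hv => ?_).trans
    (Finset.sum_le_sum_of_subset_of_nonneg (Finset.subset_univ _) fun _ _ _ => by positivity)
  exact_mod_cast (Finset.mem_filter.1 hv).2

lemma abs_le_add_sq_div (x : ℝ) {ε : ℝ} (hε : 0 < ε) : |x| ≤ ε + x ^ 2 / ε := by
  have h1 : 0 ≤ (|x| - ε) ^ 2 := sq_nonneg _
  have h2 : |x| * ε ≤ (ε + x ^ 2 / ε) * ε := by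
    rw [add_mul, div_mul_cancel₀ _ hε.ne', ← sq_abs x]
    nlinarith [abs_nonneg x]
  exact le_of_mul_le_mul_right h2 hε

open Classical in
/-- Under uniform sampling, the number of vertices with a property that is determined by the
sample near the vertex is close to its mean under independent sampling. -/
lemma IsUniformSample.tendsto_integral_sub (hm : IsAttachmentModel ℙ π κ B a₀ attr par)
    (hB : B.Connected) (hS : IsUniformSample ℙ attr par m E S) {N : ℕ → ℕ}
    (hN : Tendsto N atTop atTop) (hEN : ∀ n h, (E n h).card = N n) {p : ℝ} (hp0 : 0 ≤ p)
    (hp1 : p ≤ 1) (hmp : Tendsto (fun n => (m n : ℝ) / N n) atTop (𝓝 p))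
    {W : ∀ n, History V₀ K n → V₀ ⊕ Fin n → Finset (U n)} (hWE : ∀ n h v, W n h v ⊆ E n h)
    (hWd : ∀ n h v, (W n h v).card ≤ h.adeg B v + 1)
    {bad : ∀ n, History V₀ K n → ℝ}
    (hbad : ∀ n h, (∑ x ∈ E n h, ((Finset.univ.filter fun v => x ∈ W n h v).card : ℝ) ^ 2) ≤
      bad n h)
    (hbadlim : Tendsto (fun n : ℕ => meanAt ℙ attr par n (bad n) / (baseDegree B + 2 * n) ^ 2)
      atTop (𝓝 0))
    {g : ∀ n, History V₀ K n → V₀ ⊕ Fin n → Finset (U n) → ℝ}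
    (hg : ∀ n h v A, 0 ≤ g n h v A ∧ g n h v A ≤ 1)
    (hgW : ∀ n h v T, g n h v T = g n h v (T ∩ W n h v))
    (J : ∀ n, History V₀ K n → Finset (V₀ ⊕ Fin n)) :
    Tendsto (fun n => ∫ ω, |(∑ v ∈ J n (historyAt attr par n ω),
      (g n (historyAt attr par n ω) v (S n ω) -
        bernoulliMean p (W n (historyAt attr par n ω) v) (g n (historyAt attr par n ω) v))) /
          (baseDegree B + 2 * n)| ∂ℙ) atTop (𝓝 0) := by
  have ht := one_le_baseDegree hB
  set b : ∀ n, History V₀ K n → V₀ ⊕ Fin n → ℝ := fun n h v =>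
    bernoulliMean p (W n h v) (g n h v) with hb
  have hb01 : ∀ n h v, 0 ≤ b n h v ∧ b n h v ≤ 1 := fun n h v => by
    constructor
    · rw [← bernoulliMean_const p 0 (W n h v)]
      exact bernoulliMean_mono hp0 hp1 _ fun A => (hg n h v A).1
    · rw [← bernoulliMean_const p 1 (W n h v)]
      exact bernoulliMean_mono hp0 hp1 _ fun A => (hg n h v A).2
  have habs : ∀ n h v A, |g n h v A - b n h v| ≤ 1 := fun n h v A => by
    have h1 := hg n h v A
    have h2 := hb01 n h v
    rw [abs_le]
    constructor <;> linarith
  rw [Metric.tendsto_atTop]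
  intro ε' hε'
  set ε := ε' / 5 with hεdef
  have hε : 0 < ε := by positivity
  obtain ⟨k, hk⟩ := exists_nat_one_div_lt hε
  set CV : ℝ := Fintype.card V₀ + 1 with hCV
  have hCVpos : 0 < CV := by positivity
  -- With |I| ≤ CV · T this makes the contribution of disjoint pairs at most ε² T². The sets have at
  -- most k + 1 elements after truncation at degree k.
  set δ := ε ^ 2 / (CV ^ 2 * 4 ^ (k + 1)) with hδdef
  have hδ : 0 < δ := by positivity
  -- The bound m n ≤ N n is needed without reference to a history; any history will do, and one
  -- exists because Ω is nonempty, carrying a probability measure.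
  have hclose := eventually_patternClose hN (fun n => (hS.le_card n
    (historyAt attr par n (Classical.choice (by
      by_contra hne
      have := not_nonempty_iff.1 hne
      have h1 := measure_univ (μ := ℙ)
      rw [Set.eq_empty_of_isEmpty (Set.univ : Set Ω), measure_empty] at h1
      exact zero_ne_one h1)))).trans_eq (hEN n _)) hmp (2 * (k + 1)) hδ
  have hbadev := (Metric.tendsto_nhds.1 hbadlim) (ε ^ 2) (by positivity)
  obtain ⟨n₀, hn₀⟩ := eventually_atTop.1 (hclose.and hbadev)
  refine ⟨n₀, fun n hn => ?_⟩
  obtain ⟨hcl, hbd⟩ := hn₀ n hn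
  have hT : 1 ≤ baseDegree B + 2 * (n : ℝ) := by
    have := Nat.cast_nonneg (α := ℝ) n
    linarith
  have hT0 : 0 < baseDegree B + 2 * (n : ℝ) := by linarith
  rw [Real.dist_eq, sub_zero] at hbd ⊢
  rw [abs_of_nonneg (integral_nonneg fun ω => abs_nonneg _)]
  set I : History V₀ K n → Finset (V₀ ⊕ Fin n) := fun h =>
    (J n h).filter fun v => h.adeg B v ≤ k with hI
  -- One ε pays for the vertices of degree above k, the other for |x| ≤ ε + x²/ε, which brings in
  -- the second moment.
  have hpt : ∀ h T, |(∑ v ∈ J n h, (g n h v T - b n h v)) / (baseDegree B + 2 * n)| ≤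
      (ε + ε) + ((∑ v ∈ I h, (g n h v T - b n h v)) / (baseDegree B + 2 * n)) ^ 2 / ε := by
    intro h T
    rw [← Finset.sum_filter_add_sum_filter_not (J n h) (fun v => h.adeg B v ≤ k), add_div]
    refine (abs_add_le _ _).trans ?_
    have h1 := abs_le_add_sq_div ((∑ v ∈ I h, (g n h v T - b n h v)) / (baseDegree B + 2 * n)) hε
    have h2 : |(∑ v ∈ (J n h).filter fun v => ¬ h.adeg B v ≤ k, (g n h v T - b n h v)) /
        (baseDegree B + 2 * n)| ≤ ε := by
      rw [abs_div, abs_of_pos hT0, div_le_iff₀ hT0]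
      have h3 : |∑ v ∈ (J n h).filter fun v => ¬ h.adeg B v ≤ k, (g n h v T - b n h v)| ≤
          ((Finset.univ.filter fun v => k < h.adeg B v).card : ℝ) := by
        refine (Finset.abs_sum_le_sum_abs _ _).trans
          ((Finset.sum_le_sum fun v _ => habs n h v T).trans ?_)
        rw [Finset.sum_const, nsmul_eq_mul, mul_one]
        refine Nat.cast_le.2 (Finset.card_le_card fun v hv => ?_)
        simpa using (Finset.mem_filter.1 hv).2
      have h4 := card_filter_lt_adeg B h k
      have h5 : ((Finset.univ.filter fun v => k < h.adeg B v).card : ℝ) ≤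
          1 / ((k : ℝ) + 1) * (baseDegree B + 2 * n) := by
        rw [div_mul_eq_mul_div, one_mul, le_div_iff₀ (by positivity)]
        exact h4
      refine h3.trans (h5.trans ?_)
      gcongr
    linarith
  have hint1 : ∫ ω, |(∑ v ∈ J n (historyAt attr par n ω),
      (g n (historyAt attr par n ω) v (S n ω) - b n (historyAt attr par n ω) v)) /
          (baseDegree B + 2 * n)| ∂ℙ ≤
      meanAt ℙ attr par n fun h => (∑ T ∈ (E n h).powersetCard (m n), ((ε + ε) +
        ((∑ v ∈ I h, (g n h v T - b n h v)) / (baseDegree B + 2 * n)) ^ 2 / ε)) /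
          ((E n h).card).choose (m n) := by
    rw [← hS.integral_eq hm n fun h T => (ε + ε) +
        ((∑ v ∈ I h, (g n h v T - b n h v)) / (baseDegree B + 2 * n)) ^ 2 / ε]
    exact integral_mono (hS.integrable hm n fun h T =>
      |(∑ v ∈ J n h, (g n h v T - b n h v)) / (baseDegree B + 2 * n)|)
      (hS.integrable hm n fun h T => (ε + ε) +
        ((∑ v ∈ I h, (g n h v T - b n h v)) / (baseDegree B + 2 * n)) ^ 2 / ε) fun ω => hpt _ _
  have hmean : ∀ h, (∑ T ∈ (E n h).powersetCard (m n), ((ε + ε) +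
        ((∑ v ∈ I h, (g n h v T - b n h v)) / (baseDegree B + 2 * n)) ^ 2 / ε)) /
          ((E n h).card).choose (m n) ≤
      (ε + ε + ε) + bad n h / ((baseDegree B + 2 * n) ^ 2 * ε) := by
    intro h
    have hc : (0 : ℝ) < ((E n h).card).choose (m n) := by
      exact_mod_cast Nat.choose_pos (hS.le_card n h)
    have h1 := uniformMean_sq_sum_le (hS.le_card n h) hp0 hp1 hδ.le (by rw [hEN]; exact hcl)
      (I h) (W n h) (g n h) (fun v hv => ⟨hWE n h v, (hWd n h v).trans
        (Nat.succ_le_succ (Finset.mem_filter.1 hv).2)⟩) (hg n h) (hgW n h)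
    have h2 : (((I h ×ˢ I h).filter fun x => ¬ Disjoint (W n h x.1) (W n h x.2)).card : ℝ) ≤
        bad n h := by
      refine le_trans ?_ (hbad n h)
      refine (Nat.cast_le.2 (card_not_disjoint_le (I h) (E n h) (W n h)
        fun v _ => hWE n h v)).trans ?_
      push_cast
      exact Finset.sum_le_sum fun x _ => pow_le_pow_left₀ (Nat.cast_nonneg _) (Nat.cast_le.2
        (Finset.card_le_card (Finset.filter_subset_filter _ (Finset.subset_univ _)))) 2
    have h3 : ((I h).card : ℝ) ≤ CV * (baseDegree B + 2 * n) := by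
      have e1 : ((I h).card : ℝ) ≤ Fintype.card V₀ + n := by
        have := Finset.card_le_univ (I h)
        rw [Fintype.card_sum, Fintype.card_fin] at this
        exact_mod_cast this
      have e2 : (Fintype.card V₀ : ℝ) ≤ Fintype.card V₀ * (baseDegree B + 2 * n) :=
        le_mul_of_one_le_right (Nat.cast_nonneg _) hT
      have e3 := Nat.cast_nonneg (α := ℝ) n
      rw [hCV, add_mul]
      linarith
    rw [Finset.sum_add_distrib, Finset.sum_const, Finset.card_powersetCard, nsmul_eq_mul, add_div,
      mul_div_cancel_left₀ _ hc.ne']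
    have h4 : (∑ T ∈ (E n h).powersetCard (m n),
        ((∑ v ∈ I h, (g n h v T - b n h v)) / (baseDegree B + 2 * n)) ^ 2 / ε) /
          ((E n h).card).choose (m n) =
        (∑ T ∈ (E n h).powersetCard (m n), (∑ v ∈ I h, (g n h v T - b n h v)) ^ 2) /
          ((E n h).card).choose (m n) / ((baseDegree B + 2 * n) ^ 2 * ε) := by
      simp only [div_pow, div_div]
      rw [← Finset.sum_div, div_div]
      congr 1
      ring
    rw [h4]
    have h5 : ((I h).card : ℝ) ^ 2 * (4 ^ (k + 1) * δ) ≤ ε ^ 2 * (baseDegree B + 2 * n) ^ 2 := by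
      calc _ ≤ (CV * (baseDegree B + 2 * n)) ^ 2 * (4 ^ (k + 1) * δ) :=
            mul_le_mul_of_nonneg_right (pow_le_pow_left₀ (Nat.cast_nonneg _) h3 2) (by positivity)
        _ = _ := by
          rw [hδdef]
          field_simp
    have h6 := (h1.trans (add_le_add h5 h2))
    have h7 : (∑ T ∈ (E n h).powersetCard (m n), (∑ v ∈ I h, (g n h v T - b n h v)) ^ 2) /
          ((E n h).card).choose (m n) / ((baseDegree B + 2 * n) ^ 2 * ε) ≤
        (ε ^ 2 * (baseDegree B + 2 * n) ^ 2 + bad n h) / ((baseDegree B + 2 * n) ^ 2 * ε) := by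
      gcongr
    have h8 : (ε ^ 2 * (baseDegree B + 2 * n) ^ 2 + bad n h) / ((baseDegree B + 2 * n) ^ 2 * ε) =
        ε + bad n h / ((baseDegree B + 2 * n) ^ 2 * ε) := by
      rw [add_div]
      congr 1
      field_simp
    linarith
  refine lt_of_le_of_lt (hint1.trans (meanAt_mono _ _ _ _ hmean)) ?_
  rw [meanAt_add, meanAt_const hm, meanAt_div]
  have h9 : meanAt ℙ attr par n (bad n) / ((baseDegree B + 2 * n) ^ 2 * ε) < ε := by
    rw [← div_div, div_lt_iff₀ hε]
    have := (le_abs_self _).trans_lt hbd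
    linarith
  have h10 : meanAt ℙ attr par n (fun h => bad n h) = meanAt ℙ attr par n (bad n) := rfl
  rw [h10]
  linarith

end RandomSampling

open History

/-! ### Selection of the top set by a degree threshold, and limits in probability -/

section TopProportion

open Classical in
/-- The number of vertices of attribute `a` and degree at least `k`. -/
def upperCount {V K : Type*} [Fintype V] (G : SimpleGraph V) (attr : V → K) (a : K) (k : ℕ) : ℝ :=
  ∑ v, if attr v = a ∧ k ≤ G.degree v then 1 else 0

/-- Under these two inequalities the top set is exactly the set of vertices of degree at least k: a
vertex of smaller degree has too many vertices above it, and one of degree at least k has few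
enough. -/
lemma topProportion_eq_div {V : Type*} [Fintype V] (G : SimpleGraph V) (attr : V → Fin 2) {α : ℝ}
    {k : ℕ}
    (h1 : upperCount G attr 0 (k + 1) + upperCount G attr 1 (k + 1) < α * Fintype.card V)
    (h2 : α * Fintype.card V ≤ upperCount G attr 0 k + upperCount G attr 1 k) :
    topProportion G attr 0 α =
      upperCount G attr 0 k / (upperCount G attr 0 k + upperCount G attr 1 k) := by
  classical
  have hsum : ∀ j, upperCount G attr 0 j + upperCount G attr 1 j =
      ((Finset.univ.filter fun v => j ≤ G.degree v).card : ℝ) := by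
    intro j
    rw [upperCount, upperCount, ← Finset.sum_add_distrib, Finset.card_filter]
    push_cast
    refine Finset.sum_congr rfl fun v _ => ?_
    rcases (by omega : attr v = 0 ∨ attr v = 1) with hv | hv <;> simp [hv]
  have htop : topDegreeSet G α = Finset.univ.filter fun v => k ≤ G.degree v := by
    rw [hsum] at h1 h2
    ext v
    simp only [topDegreeSet, Finset.mem_filter, Finset.mem_univ, true_and]
    constructor
    · intro hv
      by_contra hk
      refine absurd (h2.trans ?_) (not_le.2 hv)
      refine Nat.cast_le.2 (Finset.card_le_card fun w hw => ?_)
      simp only [Finset.mem_filter, Finset.mem_univ, true_and] at hw ⊢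
      omega
    · intro hv
      refine lt_of_le_of_lt (Nat.cast_le.2 (Finset.card_le_card fun w hw => ?_)) h1
      simp only [Finset.mem_filter, Finset.mem_univ, true_and] at hw ⊢
      omega
  rw [topProportion, hsum, htop]
  congr 1
  rw [Finset.filter_filter, upperCount, Finset.card_filter]
  push_cast
  refine Finset.sum_congr rfl fun v _ => ?_
  by_cases h3 : attr v = 0 <;> by_cases h4 : k ≤ G.degree v <;> simp [h3, h4]

end TopProportion

section InMeasure

variable {Ω : Type*} [MeasurableSpace Ω] {ℙ : Measure Ω} [IsProbabilityMeasure ℙ]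

lemma tendstoInMeasure_of_integral_abs {X : ℕ → Ω → ℝ} {c : ℝ}
    (hint : ∀ n, Integrable (fun ω => |X n ω - c|) ℙ)
    (h : Tendsto (fun n => ∫ ω, |X n ω - c| ∂ℙ) atTop (𝓝 0)) :
    TendstoInMeasure ℙ X atTop (fun _ => c) := by
  rw [tendstoInMeasure_iff_measureReal_norm]
  intro ε hε
  have h1 : Tendsto (fun n => (∫ ω, |X n ω - c| ∂ℙ) / ε) atTop (𝓝 0) := by
    simpa using h.div_const ε
  refine squeeze_zero (fun n => measureReal_nonneg) (fun n => ?_) h1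
  rw [le_div_iff₀ hε, mul_comm]
  exact mul_meas_ge_le_integral_of_nonneg (Eventually.of_forall fun ω => abs_nonneg _) (hint n) ε

lemma tendstoInMeasure_sub_const {X Y : ℕ → Ω → ℝ} {c d : ℝ}
    (hX : TendstoInMeasure ℙ X atTop (fun _ => c)) (hY : TendstoInMeasure ℙ Y atTop (fun _ => d)) :
    TendstoInMeasure ℙ (fun n ω => X n ω - Y n ω) atTop (fun _ => c - d) := by
  rw [tendstoInMeasure_iff_measureReal_norm] at hX hY ⊢
  intro ε hε
  have h1 := (hX (ε / 2) (by positivity)).add (hY (ε / 2) (by positivity))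
  rw [add_zero] at h1
  refine squeeze_zero (fun n => measureReal_nonneg) (fun n => ?_) h1
  refine (measureReal_mono ?_).trans (measureReal_union_le _ _)
  intro ω hω
  simp only [Set.mem_ofPred_eq, Set.mem_union, Real.norm_eq_abs] at hω ⊢
  by_contra hcon
  rw [not_or, not_le, not_le] at hcon
  have := abs_sub (X n ω - c) (Y n ω - d)
  rw [show X n ω - c - (Y n ω - d) = X n ω - Y n ω - (c - d) by ring] at this
  linarith [hcon.1, hcon.2]

/-- Convergence in probability of the proportion above a threshold that is eventually the one
selected by the level `α`. -/
lemma tendstoInMeasure_ratio {x y x' y' N Y : ℕ → Ω → ℝ} {cx cy cx' cy' ν α : ℝ}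
    (hx : TendstoInMeasure ℙ x atTop (fun _ => cx)) (hy : TendstoInMeasure ℙ y atTop (fun _ => cy))
    (hx' : TendstoInMeasure ℙ x' atTop (fun _ => cx'))
    (hy' : TendstoInMeasure ℙ y' atTop (fun _ => cy'))
    (hN : TendstoInMeasure ℙ N atTop (fun _ => ν)) (hlow : cx' + cy' < α * ν)
    (hhigh : α * ν < cx + cy) (hpos : 0 < cx + cy)
    (hY : ∀ n, ∀ᵐ ω ∂ℙ, x' n ω + y' n ω < α * N n ω → α * N n ω ≤ x n ω + y n ω →
      Y n ω = x n ω / (x n ω + y n ω)) :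
    TendstoInMeasure ℙ Y atTop (fun _ => cx / (cx + cy)) := by
  rw [tendstoInMeasure_iff_measureReal_norm] at hx hy hx' hy' hN ⊢
  intro ε hε
  have hcont : Tendsto (fun z : ℝ × ℝ => z.1 / (z.1 + z.2)) (𝓝 (cx, cy)) (𝓝 (cx / (cx + cy))) :=
    (continuous_fst.continuousAt.div (continuous_fst.add continuous_snd).continuousAt hpos.ne')
  obtain ⟨δ₀, hδ₀, hball⟩ := Metric.tendsto_nhds_nhds.1 hcont ε hε
  -- If all five variables are within δ of their limits, each threshold inequality moves by at most
  -- (2 + |α|)δ, half of its gap, and so persists; δ₀ is the modulus of continuity of the ratio.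
  set δ := min (min (δ₀ / 2) ((α * ν - (cx' + cy')) / (2 * (2 + |α|))))
    ((cx + cy - α * ν) / (2 * (2 + |α|))) with hδdef
  have hα2 : 0 < 2 * (2 + |α|) := by positivity
  have hδ : 0 < δ := lt_min (lt_min (by positivity) (div_pos (by linarith) hα2))
    (div_pos (by linarith) hα2)
  have hδ1 : δ ≤ δ₀ / 2 := (min_le_left _ _).trans (min_le_left _ _)
  have hδ2 : δ * (2 * (2 + |α|)) ≤ α * ν - (cx' + cy') := by
    rw [← le_div_iff₀ hα2]
    exact (min_le_left _ _).trans (min_le_right _ _)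
  have hδ3 : δ * (2 * (2 + |α|)) ≤ cx + cy - α * ν := by
    rw [← le_div_iff₀ hα2]
    exact min_le_right _ _
  have hlim := ((((hx δ hδ).add (hy δ hδ)).add (hx' δ hδ)).add (hy' δ hδ)).add (hN δ hδ)
  simp only [add_zero] at hlim
  refine squeeze_zero (fun n => measureReal_nonneg) (fun n => ?_) hlim
  refine le_trans ?_ ((measureReal_union_le _ _).trans (add_le_add_left
    ((measureReal_union_le _ _).trans (add_le_add_left ((measureReal_union_le _ _).trans
      (add_le_add_left (measureReal_union_le _ _) _)) _)) _))
  refine ENNReal.toReal_mono (measure_ne_top _ _) (measure_mono_ae ?_)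
  filter_upwards [hY n] with ω hω hmem
  change ε ≤ ‖Y n ω - cx / (cx + cy)‖ at hmem
  by_contra hcon
  change ¬ ((((_ ∨ _) ∨ _) ∨ _) ∨ _) at hcon
  simp only [not_or] at hcon
  obtain ⟨⟨⟨⟨h1, h2⟩, h3⟩, h4⟩, h5⟩ := hcon
  change ¬ δ ≤ ‖x n ω - cx‖ at h1
  change ¬ δ ≤ ‖y n ω - cy‖ at h2
  change ¬ δ ≤ ‖x' n ω - cx'‖ at h3
  change ¬ δ ≤ ‖y' n ω - cy'‖ at h4
  change ¬ δ ≤ ‖N n ω - ν‖ at h5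
  rw [not_le, Real.norm_eq_abs] at h1 h2 h3 h4 h5
  have hNα : |α * N n ω - α * ν| ≤ |α| * δ := by
    rw [← mul_sub, abs_mul]
    exact mul_le_mul_of_nonneg_left h5.le (abs_nonneg _)
  have hαδ : 0 ≤ |α| * δ := by positivity
  rw [abs_lt] at h1 h2 h3 h4
  rw [abs_le] at hNα
  have hYω := hω (by linarith [h3.2, h4.2, hNα.1]) (by linarith [h1.1, h2.1, hNα.2])
  have hd : dist (x n ω, y n ω) (cx, cy) < δ₀ := by
    rw [Prod.dist_eq, Real.dist_eq, Real.dist_eq]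
    exact max_lt ((abs_lt.2 h1).trans_le (by linarith)) ((abs_lt.2 h2).trans_le (by linarith))
  have := hball hd
  rw [← hYω, Real.dist_eq, ← Real.norm_eq_abs] at this
  linarith

end InMeasure

/-! ### Strictness from uniqueness of the percentile -/

section Percentile

/-- If the mass above k were exactly α, then k + 1 would be a percentile too, contradicting
uniqueness. -/
lemma IsPercentile.real_Ici_succ_lt {μ : Measure ℕ} [IsProbabilityMeasure μ] {α : ℝ} {k : ℕ}
    (hk : IsPercentile μ α k) : μ.real (Set.Ici (k + 1)) < α := by
  have h1 := (hk k).2 rfl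
  have hcompl : μ.real (Set.Iic k) + μ.real (Set.Ici (k + 1)) = 1 := by
    have : Set.Ici (k + 1) = (Set.Iic k)ᶜ := by
      ext i
      simp
    rw [this, measureReal_add_measureReal_compl MeasurableSet.of_discrete, probReal_univ]
  refine lt_of_le_of_ne (by linarith [h1.2]) fun heq => ?_
  have h2 : μ.real (Set.Iio (k + 1)) ≤ 1 - α := by
    have : Set.Iio (k + 1) = Set.Iic k := by
      ext i
      simp
    rw [this]
    linarith
  have h3 : μ.real (Set.Iic k) ≤ μ.real (Set.Iic (k + 1)) :=
    measureReal_mono (Set.Iic_subset_Iic.2 (Nat.le_succ k))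
  have := (hk (k + 1)).1 ⟨h2, by linarith⟩
  omega

end Percentile

/-! ### Degree counts in the full network -/

section Counts

variable {V₀ Ω : Type*} [Fintype V₀] [MeasurableSpace Ω]
  {ℙ : Measure Ω} [IsProbabilityMeasure ℙ] {π : Fin 2 → ℝ} {κ : Fin 2 → Fin 2 → ℝ}
  {B : SimpleGraph V₀} {a₀ : V₀ → Fin 2} {attr : ℕ → Ω → Fin 2}
  {par : (n : ℕ) → Ω → V₀ ⊕ Fin n}

lemma tendsto_const_div_total (B : SimpleGraph V₀) (c : ℝ) :
    Tendsto (fun n : ℕ => c / (baseDegree B + 2 * (n : ℝ))) atTop (𝓝 0) := by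
  refine tendsto_const_nhds.div_atTop (tendsto_atTop_add_const_left _ _ ?_)
  exact tendsto_natCast_atTop_atTop.const_mul_atTop (by norm_num)

lemma tendsto_linear_div_total (hB : B.Connected) (c : ℝ) :
    Tendsto (fun n : ℕ => (c + n) / (baseDegree B + 2 * (n : ℝ))) atTop (𝓝 (1 / 2)) := by
  have ht := one_le_baseDegree hB
  have h1 := (tendsto_const_div_total B (c - baseDegree B / 2)).add_const (1 / 2)
  rw [zero_add] at h1
  refine h1.congr fun n => ?_
  have hT : 0 < baseDegree B + 2 * (n : ℝ) := by positivity
  field_simp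
  ring

open Classical in
/-- Averages of bounded functions of the degree in the network converge. -/
lemma tendsto_meanAt_degree (hm : IsAttachmentModel ℙ π κ B a₀ attr par) (hB : B.Connected)
    (hκ : ∀ a b, 0 < κ a b) (hπ : ∀ b, 0 < π b) (hπ1 : ∑ b, π b = 1) (a : Fin 2) {β : ℕ → ℝ}
    (hβ : ∀ k, 0 ≤ β k ∧ β k ≤ 1) :
    Tendsto (fun n => meanAt ℙ attr par n fun h =>
      |(∑ v, if h.attr a₀ v = a then β ((h.graph B).degree v) else 0) / (baseDegree B + 2 * n) -
        π a / 2 * ∑' k, degreePMF π κ a k * β k|) atTop (𝓝 0) := by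
  have ht := one_le_baseDegree hB
  have h1 := (tendsto_const_div_total B (Fintype.card V₀)).add
    (tendsto_meanAt_degSum hm hB hκ hπ hπ1 a hβ)
  rw [add_zero] at h1
  refine squeeze_zero (fun n => meanAt_nonneg _ _ _ _ fun h => abs_nonneg _) (fun n => ?_) h1
  rw [← meanAt_const hm n (Fintype.card V₀ / (baseDegree B + 2 * n)), ← meanAt_add]
  refine meanAt_mono _ _ _ _ fun h => ?_
  have hT : 0 < baseDegree B + 2 * (n : ℝ) := by positivity
  refine (abs_sub_le _ (degSum B a₀ (fun a' d => if a' = a then β d else 0) h /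
    (baseDegree B + 2 * n)) _).trans (add_le_add_left ?_ _)
  rw [← sub_div, abs_div, abs_of_pos hT]
  refine div_le_div_of_nonneg_right ?_ hT.le
  rw [degSum, ← Finset.sum_sub_distrib]
  refine (Finset.abs_sum_le_sum_abs _ _).trans ?_
  -- The degree in the network and the attachment degree can differ only at base vertices, a bounded
  -- number that is negligible after division by T.
  have h2 : ∀ v : V₀ ⊕ Fin n, |(if h.attr a₀ v = a then β ((h.graph B).degree v) else 0) -
      (if h.attr a₀ v = a then β (h.adeg B v) else 0)| ≤ if v.isLeft then 1 else 0 := by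
    intro v
    have hb1 := hβ ((h.graph B).degree v)
    have hb2 := hβ (h.adeg B v)
    by_cases hv : v.isLeft
    · rw [if_pos hv, abs_le]
      split_ifs <;> constructor <;> linarith
    · have : h.adeg B v = (h.graph B).degree v := by simp [adeg, hv]
      rw [this]
      simp [hv]
  refine (Finset.sum_le_sum fun v _ => h2 v).trans (le_of_eq ?_)
  rw [Fintype.sum_sum_type]
  simp

/-- Vertex counts above a degree threshold in the full network. -/
lemma tendstoInMeasure_upperCount (hm : IsAttachmentModel ℙ π κ B a₀ attr par) (hB : B.Connected)
    (hκ : ∀ a b, 0 < κ a b) (hπ : ∀ b, 0 < π b) (hπ1 : ∑ b, π b = 1) (a : Fin 2) (k : ℕ) :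
    TendstoInMeasure ℙ (fun n ω => upperCount ((historyAt attr par n ω).graph B)
      ((historyAt attr par n ω).attr a₀) a k / (baseDegree B + 2 * n)) atTop
      (fun _ => π a / 2 * (degreeLaw π κ a).real (Set.Ici k)) := by
  classical
  have hφ := phiLimit_pos hκ hπ hπ1 a
  have hφ2 := phiLimit_lt_two hκ hπ hπ1 a
  have h1 := tendsto_meanAt_degree hm hB hκ hπ hπ1 a (β := fun j => (Set.Ici k).indicator 1 j)
    fun j => by
      by_cases hj : j ∈ Set.Ici k <;> simp [hj]
  rw [degreeLaw_real hφ hφ2]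
  refine tendstoInMeasure_of_integral_abs (fun n => ?_) ?_
  · exact integrable_historyAt hm n fun h => |upperCount (h.graph B) (h.attr a₀) a k /
      (baseDegree B + 2 * n) - π a / 2 * ∑' j, degreePMF π κ a j * (Set.Ici k).indicator 1 j|
  · refine h1.congr fun n => ?_
    rw [← integral_historyAt hm]
    refine integral_congr_ae (Eventually.of_forall fun ω => ?_)
    dsimp only
    congr 3
    refine Finset.sum_congr rfl fun v _ => ?_
    simp only [Set.indicator_apply, Set.mem_Ici, Pi.one_apply, ite_and]
    congr

end Counts

open History

/-! ### Counts of locally determined properties in a sample -/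

section SampleLimits

variable {V₀ Ω : Type*} [Fintype V₀] [MeasurableSpace Ω]
  {ℙ : Measure Ω} [IsProbabilityMeasure ℙ] {π : Fin 2 → ℝ} {κ : Fin 2 → Fin 2 → ℝ}
  {B : SimpleGraph V₀} {a₀ : V₀ → Fin 2} {attr : ℕ → Ω → Fin 2}
  {par : (n : ℕ) → Ω → V₀ ⊕ Fin n} {U : ℕ → Type*} [∀ n, Fintype (U n)]
  {m : ℕ → ℕ} {E : ∀ n, History V₀ (Fin 2) n → Finset (U n)} {S : (n : ℕ) → Ω → Finset (U n)}

open Classical in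
/-- Under uniform sampling, the normalized number of vertices of attribute `a` with a property
determined by the sample near the vertex converges, if the probability of the property under
independent sampling is a function of the degree. -/
lemma IsUniformSample.tendstoInMeasure_sum (hm : IsAttachmentModel ℙ π κ B a₀ attr par)
    (hB : B.Connected) (hκ : ∀ a b, 0 < κ a b) (hπ : ∀ b, 0 < π b) (hπ1 : ∑ b, π b = 1)
    (hS : IsUniformSample ℙ attr par m E S) {N : ℕ → ℕ}
    (hN : Tendsto N atTop atTop) (hEN : ∀ n h, (E n h).card = N n) {p : ℝ} (hp0 : 0 ≤ p)
    (hp1 : p ≤ 1) (hmp : Tendsto (fun n => (m n : ℝ) / N n) atTop (𝓝 p))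
    {W : ∀ n, History V₀ (Fin 2) n → V₀ ⊕ Fin n → Finset (U n)} (hWE : ∀ n h v, W n h v ⊆ E n h)
    (hWd : ∀ n h v, (W n h v).card ≤ h.adeg B v + 1)
    {bad : ∀ n, History V₀ (Fin 2) n → ℝ}
    (hbad : ∀ n h, (∑ x ∈ E n h, ((Finset.univ.filter fun v => x ∈ W n h v).card : ℝ) ^ 2) ≤
      bad n h)
    (hbadlim : Tendsto (fun n : ℕ => meanAt ℙ attr par n (bad n) / (baseDegree B + 2 * n) ^ 2)
      atTop (𝓝 0))
    {g : ∀ n, History V₀ (Fin 2) n → V₀ ⊕ Fin n → Finset (U n) → ℝ}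
    (hg : ∀ n h v A, 0 ≤ g n h v A ∧ g n h v A ≤ 1)
    (hgW : ∀ n h v T, g n h v T = g n h v (T ∩ W n h v)) {r : ℝ} {β : ℕ → ℝ}
    (hβ : ∀ k, 0 ≤ β k ∧ β k ≤ 1)
    (hgβ : ∀ n h v, bernoulliMean p (W n h v) (g n h v) = r * β ((h.graph B).degree v))
    (a : Fin 2) :
    TendstoInMeasure ℙ (fun n ω => (∑ v, if (historyAt attr par n ω).attr a₀ v = a then
        g n (historyAt attr par n ω) v (S n ω) else 0) / (baseDegree B + 2 * n)) atTop
      (fun _ => r * (π a / 2 * ∑' k, degreePMF π κ a k * β k)) := by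
  set c := π a / 2 * ∑' k, degreePMF π κ a k * β k with hc
  set J : ∀ n, History V₀ (Fin 2) n → Finset (V₀ ⊕ Fin n) := fun n h =>
    Finset.univ.filter fun v => h.attr a₀ v = a with hJ
  have h1 := hS.tendsto_integral_sub hm hB hN hEN hp0 hp1 hmp hWE hWd hbad hbadlim hg hgW J
  have h2 := (tendsto_meanAt_degree hm hB hκ hπ hπ1 a hβ).const_mul |r|
  have h3 := h1.add h2
  rw [mul_zero, add_zero] at h3
  have hpt : ∀ n (h : History V₀ (Fin 2) n) T,
      |(∑ v, if h.attr a₀ v = a then g n h v T else 0) / (baseDegree B + 2 * n) - r * c| ≤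
      |(∑ v ∈ J n h, (g n h v T - bernoulliMean p (W n h v) (g n h v))) /
        (baseDegree B + 2 * n)| +
      |r| * |(∑ v, if h.attr a₀ v = a then β ((h.graph B).degree v) else 0) /
        (baseDegree B + 2 * n) - c| := by
    intro n h T
    rw [← abs_mul, Finset.sum_sub_distrib, hJ, Finset.sum_filter, Finset.sum_filter]
    refine le_trans (le_of_eq ?_) (abs_add_le _ _)
    congr 1
    rw [mul_sub, sub_div, mul_div_assoc', Finset.mul_sum]
    have : ∑ v, (if h.attr a₀ v = a then bernoulliMean p (W n h v) (g n h v) else 0) =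
        ∑ v, r * (if h.attr a₀ v = a then β ((h.graph B).degree v) else 0) :=
      Finset.sum_congr rfl fun v _ => by
        rw [hgβ]
        split_ifs <;> simp
    rw [this]
    ring
  have hint := fun n => hS.integrable hm n fun h T =>
    |(∑ v, if h.attr a₀ v = a then g n h v T else 0) / (baseDegree B + 2 * n) - r * c|
  refine tendstoInMeasure_of_integral_abs hint
    (squeeze_zero (fun n => integral_nonneg fun ω => abs_nonneg _) (fun n => ?_) h3)
  rw [← meanAt_const_mul, ← integral_historyAt hm, ← integral_add]
  · refine integral_mono (hint n) ?_ fun ω => hpt n _ _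
    exact hS.integrable hm n fun h T =>
      |(∑ v ∈ J n h, (g n h v T - bernoulliMean p (W n h v) (g n h v))) /
        (baseDegree B + 2 * n)| +
      |r| * |(∑ v, if h.attr a₀ v = a then β ((h.graph B).degree v) else 0) /
        (baseDegree B + 2 * n) - c|
  · exact hS.integrable hm n fun h T =>
      |(∑ v ∈ J n h, (g n h v T - bernoulliMean p (W n h v) (g n h v))) /
        (baseDegree B + 2 * n)|
  · exact integrable_historyAt hm n fun h => |r| * |(∑ v, if h.attr a₀ v = a then
      β ((h.graph B).degree v) else 0) / (baseDegree B + 2 * n) - c|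

end SampleLimits

lemma tendsto_floor_mul_div {N : ℕ → ℕ} (hN : Tendsto N atTop atTop) {p : ℝ} (hp0 : 0 ≤ p) :
    Tendsto (fun n => (⌊p * (N n : ℝ)⌋₊ : ℝ) / N n) atTop (𝓝 p) :=
  (tendsto_nat_floor_mul_div_atTop hp0).comp (tendsto_natCast_atTop_atTop.comp hN)

lemma floor_mul_le {p : ℝ} (hp1 : p ≤ 1) (N : ℕ) : ⌊p * (N : ℝ)⌋₊ ≤ N :=
  Nat.floor_le_of_le (mul_le_of_le_one_left (Nat.cast_nonneg _) hp1)

lemma binomial_real_mem_unit (p : unitInterval) (k j : ℕ) :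
    0 ≤ (ProbabilityTheory.binomial j p).real (Set.Ici k) ∧
      (ProbabilityTheory.binomial j p).real (Set.Ici k) ≤ 1 :=
  ⟨measureReal_nonneg, measureReal_le_one⟩

/-! ### Degrees after node and edge sampling as local functions of the sample -/

section SampledDegrees

variable {V : Type*} [Fintype V]

open Classical in
lemma degree_le_adeg {V₀ K : Type*} [Fintype V₀] {n : ℕ} (B : SimpleGraph V₀)
    (h : History V₀ K n) (v : V₀ ⊕ Fin n) : (h.graph B).degree v ≤ h.adeg B v :=
  Nat.le_add_right _ _

open Classical in
/-- The indicator that `v` is sampled and has at least `k` sampled neighbours. -/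
def nodeIndicator (G : SimpleGraph V) (k : ℕ) (v : V) (T : Finset V) : ℝ :=
  if v ∈ T ∧ k ≤ (T.filter fun w => G.Adj v w).card then 1 else 0

open Classical in
/-- The indicator that at least `k` edges at `v` are sampled. -/
def edgeIndicator (G : SimpleGraph V) (k : ℕ) (v : V) (T : Finset (Sym2 V)) : ℝ :=
  if k ≤ (T.filter fun e => e ∈ G.incidenceFinset v).card then 1 else 0

open Classical in
lemma nodeIndicator_inter (G : SimpleGraph V) (k : ℕ) (v : V) (T : Finset V) :
    nodeIndicator G k v T = nodeIndicator G k v (T ∩ insert v (G.neighborFinset v)) := by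
  have : (T ∩ insert v (G.neighborFinset v)).filter (fun w => G.Adj v w) =
      T.filter fun w => G.Adj v w := by
    ext w
    simp only [Finset.mem_filter, Finset.mem_inter, Finset.mem_insert,
      SimpleGraph.mem_neighborFinset]
    tauto
  rw [nodeIndicator, nodeIndicator, this]
  simp

open Classical in
lemma edgeIndicator_inter (G : SimpleGraph V) (k : ℕ) (v : V) (T : Finset (Sym2 V)) :
    edgeIndicator G k v T = edgeIndicator G k v (T ∩ G.incidenceFinset v) := by
  have : (T ∩ G.incidenceFinset v).filter (fun e => e ∈ G.incidenceFinset v) =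
      T.filter fun e => e ∈ G.incidenceFinset v := by
    ext w
    simp only [Finset.mem_filter, Finset.mem_inter]
    tauto
  rw [edgeIndicator, edgeIndicator, this]

open Classical in
-- The inclusion of v itself is independent of that of its neighbours: it gives the factor p, and
-- the sampled neighbours are binomially distributed.
lemma bernoulliMean_nodeIndicator (G : SimpleGraph V) (k : ℕ) (v : V) (p : unitInterval) :
    bernoulliMean (p : ℝ) (insert v (G.neighborFinset v)) (nodeIndicator G k v) =
      p * (ProbabilityTheory.binomial (G.degree v) p).real (Set.Ici k) := by
  have hv : v ∉ G.neighborFinset v := by simp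
  rw [bernoulliMean_insert _ hv, bernoulliMean_congr (g := fun _ => 0),
    bernoulliMean_congr (f := fun A => nodeIndicator G k v (insert v A))
      (g := fun A => (fun i => if k ≤ i then 1 else 0) A.card), bernoulliMean_const,
    bernoulliMean_card p _ (fun i => if k ≤ i then 1 else 0), mul_zero, zero_add, SimpleGraph.card_neighborFinset_eq_degree,
    binomial_real_Ici]
  · intro A hA
    have : (insert v A).filter (fun w => G.Adj v w) = A := by
      ext w
      simp only [Finset.mem_filter, Finset.mem_insert]
      constructor
      · rintro ⟨rfl | h1, h2⟩
        · exact absurd h2 (G.irrefl)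
        · exact h1
      · exact fun hw => ⟨Or.inr hw, (G.mem_neighborFinset v w).1 (hA hw)⟩
    rw [nodeIndicator, this]
    simp
  · intro A hA
    rw [nodeIndicator, if_neg fun h => hv (hA h.1)]

open Classical in
lemma bernoulliMean_edgeIndicator (G : SimpleGraph V) (k : ℕ) (v : V) (p : unitInterval) :
    bernoulliMean (p : ℝ) (G.incidenceFinset v) (edgeIndicator G k v) =
      1 * (ProbabilityTheory.binomial (G.degree v) p).real (Set.Ici k) := by
  rw [bernoulliMean_congr (g := fun A => (fun i => if k ≤ i then 1 else 0) A.card),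
    bernoulliMean_card p _ (fun i => if k ≤ i then 1 else 0), SimpleGraph.card_incidenceFinset_eq_degree, binomial_real_Ici, one_mul]
  intro A hA
  rw [edgeIndicator, Finset.filter_true_of_mem fun e he => hA he]

open Classical in
lemma upperCount_induce {K : Type*} (G : SimpleGraph V) (attr : V → K) (S : Finset V)
    [Fintype {v | v ∈ S}] (a : K) (k : ℕ) :
    upperCount (G.induce {v | v ∈ S}) (fun v => attr v.1) a k =
      ∑ v, if attr v = a then nodeIndicator G k v S else 0 := by
  have hdeg : ∀ (x : {v | v ∈ S}) [Fintype ((G.induce {v | v ∈ S}).neighborSet x)],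
      (G.induce {v | v ∈ S}).degree x = (S.filter fun w => G.Adj x w).card := by
    intro x _
    rw [degree_eq_sum, Finset.card_filter,
      Finset.sum_subtype S (p := fun v => v ∈ {v | v ∈ S}) (fun _ => Iff.rfl)]
    exact Fintype.sum_congr _ _ fun w => rfl
  rw [upperCount]
  simp only [hdeg]
  have h1 := Finset.sum_subtype (F := (inferInstance : Fintype {v | v ∈ S})) S (fun _ => Iff.rfl)
    (fun v => if attr v = a ∧ k ≤ (S.filter fun w => G.Adj v w).card then (1 : ℝ) else 0)
  refine h1.symm.trans ?_
  rw [← Finset.sum_subset (Finset.subset_univ S)]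
  · refine Finset.sum_congr rfl fun v hv => ?_
    by_cases h2 : attr v = a <;> simp [nodeIndicator, hv, h2]
  · intro v _ hv
    simp [nodeIndicator, hv]

open Classical in
-- The inclusion `hF` rules out loops and edges foreign to G, so the sampled degree counts the
-- sampled edges among those incident in G.
lemma upperCount_fromEdgeSet {K : Type*} (G : SimpleGraph V) (attr : V → K) (F : Finset (Sym2 V))
    (hF : F ⊆ G.edgeFinset) (a : K) (k : ℕ) :
    upperCount (SimpleGraph.fromEdgeSet {e | e ∈ F}) attr a k =
      ∑ v, if attr v = a then edgeIndicator G k v F else 0 := by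
  have hdeg : ∀ v [Fintype ((SimpleGraph.fromEdgeSet {e | e ∈ F}).neighborSet v)],
      (SimpleGraph.fromEdgeSet {e | e ∈ F}).degree v =
      (F.filter fun e => e ∈ G.incidenceFinset v).card := by
    intro v _
    rw [← SimpleGraph.card_incidenceFinset_eq_degree]
    congr 1
    ext e
    have h1 : e ∈ F → e ∈ G.edgeSet := fun h => SimpleGraph.mem_edgeFinset.1 (hF h)
    have h2 : e ∈ G.edgeSet → ¬ e.IsDiag := G.not_isDiag_of_mem_edgeSet
    simp only [SimpleGraph.mem_incidenceFinset, SimpleGraph.incidenceSet,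
      SimpleGraph.edgeSet_fromEdgeSet, Finset.mem_filter]
    constructor
    · rintro ⟨⟨h3, -⟩, h4⟩
      exact ⟨h3, h1 h3, h4⟩
    · rintro ⟨h3, -, h4⟩
      exact ⟨⟨h3, h2 (h1 h3)⟩, h4⟩
  rw [upperCount]
  refine Finset.sum_congr rfl fun v _ => ?_
  rw [hdeg, edgeIndicator]
  by_cases hv : attr v = a <;> simp [hv]

end SampledDegrees

open History

/-! ### The two sampling schemes -/

section Schemes

variable {V₀ Ω : Type*} [Fintype V₀] [MeasurableSpace Ω]
  {ℙ : Measure Ω} [IsProbabilityMeasure ℙ] {π : Fin 2 → ℝ} {κ : Fin 2 → Fin 2 → ℝ}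
  {B : SimpleGraph V₀} {a₀ : V₀ → Fin 2} {attr : ℕ → Ω → Fin 2}
  {par : (n : ℕ) → Ω → V₀ ⊕ Fin n}

lemma isUniformSample_of_isNodeSample {p : unitInterval}
    {S : (n : ℕ) → Ω → Finset (V₀ ⊕ Fin n)} (hS : IsNodeSample ℙ attr par p S) :
    IsUniformSample ℙ attr par
      (fun n => ⌊(p : ℝ) * ((Fintype.card V₀ + n : ℕ) : ℝ)⌋₊) (fun _ _ => Finset.univ) S where
  measurableSet := hS.measurableSet
  le_card n h := by
    rw [Finset.card_univ, Fintype.card_sum, Fintype.card_fin]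
    exact floor_mul_le p.2.2 _
  law n h T hT := by
    have h1 := hS.law n h T
    rw [Fintype.card_sum, Fintype.card_fin] at h1
    rw [Finset.card_univ, Fintype.card_sum, Fintype.card_fin]
    exact h1 (Finset.mem_powersetCard.1 hT).2

lemma tendsto_card_add (V₀ : Type*) [Fintype V₀] :
    Tendsto (fun n => Fintype.card V₀ + n) atTop atTop :=
  tendsto_atTop_mono (fun n => Nat.le_add_left n _) tendsto_id

/-- Vertex counts above a degree threshold in the subgraph induced by a node sample. -/
lemma tendstoInMeasure_upperCount_node (hm : IsAttachmentModel ℙ π κ B a₀ attr par)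
    (hB : B.Connected) (hκ : ∀ a b, 0 < κ a b) (hπ : ∀ b, 0 < π b) (hπ1 : ∑ b, π b = 1)
    {p : unitInterval} {S : (n : ℕ) → Ω → Finset (V₀ ⊕ Fin n)}
    (hS : IsNodeSample ℙ attr par p S) (a : Fin 2) (k : ℕ) :
    TendstoInMeasure ℙ (fun n ω => upperCount
      (((historyAt attr par n ω).graph B).induce {v | v ∈ S n ω})
      (fun v => (historyAt attr par n ω).attr a₀ v.1) a k / (baseDegree B + 2 * n)) atTop
      (fun _ => p * (π a / 2 * (thinning p (degreeLaw π κ a)).real (Set.Ici k))) := by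
  classical
  have hφ := phiLimit_pos hκ hπ hπ1 a
  have hφ2 := phiLimit_lt_two hκ hπ hπ1 a
  have ht := one_le_baseDegree hB
  rw [thinning_real hφ hφ2]
  -- A vertex x lies in deg x + 1 of the closed neighbourhoods, and (d + 1)² ≤ 2d² + 2; the sum of
  -- squared degrees is o(T²) in mean.
  have hbadlim : Tendsto (fun n : ℕ => meanAt ℙ attr par n
      (fun h => 2 * (∑ v, (h.adeg B v : ℝ) ^ 2) + 2 * ((Fintype.card V₀ : ℝ) + n)) /
        (baseDegree B + 2 * n) ^ 2) atTop (𝓝 0) := by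
    have h1 := (tendsto_meanAt_sum_sq hm hB hκ hπ hπ1).const_mul 2
    have h2 := ((tendsto_linear_div_total hB (Fintype.card V₀)).mul
      (tendsto_const_div_total B 1)).const_mul 2
    have h3 := h1.add h2
    simp only [mul_zero, add_zero] at h3
    refine h3.congr fun n => ?_
    rw [meanAt_add, meanAt_const_mul, meanAt_const hm]
    have hT : 0 < baseDegree B + 2 * (n : ℝ) := by positivity
    field_simp
  have := (isUniformSample_of_isNodeSample hS).tendstoInMeasure_sum hm hB hκ hπ hπ1
    (tendsto_card_add V₀)
    (fun n h => by rw [Finset.card_univ, Fintype.card_sum, Fintype.card_fin]) p.2.1 p.2.2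
    (tendsto_floor_mul_div (tendsto_card_add V₀) p.2.1)
    (W := fun n h v => insert v ((h.graph B).neighborFinset v))
    (fun _ _ _ => Finset.subset_univ _)
    (fun n h v => (Finset.card_insert_le _ _).trans (Nat.succ_le_succ (degree_le_adeg B h v)))
    (fun n h => ?_) hbadlim (g := fun n h v => nodeIndicator (h.graph B) k v)
    (fun n h v A => by rw [nodeIndicator]; split_ifs <;> simp)
    (fun n h v T => by
      rw [nodeIndicator_inter]
      congr
      exact Subsingleton.elim _ _)
    (fun j => binomial_real_mem_unit p k j)
    (fun n h v => by
      rw [← bernoulliMean_nodeIndicator]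
      congr
      exact Subsingleton.elim _ _) a
  · refine this.congr_left fun n => Eventually.of_forall fun ω => ?_
    dsimp only
    rw [upperCount_induce]
    congr 1
    refine Finset.sum_congr rfl fun v _ => ?_
    congr
  · have h1 : ∀ x, ((Finset.univ.filter fun v =>
        x ∈ insert v ((h.graph B).neighborFinset v)).card : ℝ) ≤ h.adeg B x + 1 := by
      intro x
      have h2 : (Finset.univ.filter fun v => x ∈ insert v ((h.graph B).neighborFinset v)) =
          insert x ((h.graph B).neighborFinset x) := by
        ext v
        simp [SimpleGraph.adj_comm, eq_comm]
      rw [h2]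
      exact_mod_cast (Finset.card_insert_le _ _).trans (Nat.succ_le_succ (degree_le_adeg B h x))
    have h3 : ∀ x ∈ Finset.univ, ((Finset.univ.filter fun v =>
        x ∈ insert v ((h.graph B).neighborFinset v)).card : ℝ) ^ 2 ≤
        2 * (h.adeg B x : ℝ) ^ 2 + 2 := by
      intro x _
      refine (pow_le_pow_left₀ (Nat.cast_nonneg _) (h1 x) 2).trans ?_
      nlinarith [sq_nonneg ((h.adeg B x : ℝ) - 1)]
    have h4 := Finset.sum_le_sum h3
    rw [Finset.sum_add_distrib, ← Finset.mul_sum, Finset.sum_const, Finset.card_univ,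
      Fintype.card_sum, Fintype.card_fin, nsmul_eq_mul] at h4
    refine le_trans (le_of_eq ?_) (h4.trans (le_of_eq ?_))
    · refine Finset.sum_congr rfl fun x _ => ?_
      congr
    · push_cast
      ring

open Classical in
/-- The number of edges, in terms of the total attachment degree of the base graph. -/
lemma two_mul_card_edges (B : SimpleGraph V₀) {n : ℕ} (h : History V₀ (Fin 2) n) :
    2 * ((h.edges B).card : ℝ) =
      baseDegree B - (if Fintype.card V₀ = 1 then 1 else 0) + 2 * n := by
  have h1 := sum_adeg B h
  have h2 := (h.graph B).sum_degrees_eq_twice_card_edges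
  have h3 : ∑ v, (h.adeg B v : ℝ) = ∑ v, ((h.graph B).degree v : ℝ) +
      if Fintype.card V₀ = 1 then 1 else 0 := by
    simp only [adeg, Nat.cast_add, Finset.sum_add_distrib]
    congr 1
    rw [Fintype.sum_sum_type]
    by_cases hc : Fintype.card V₀ = 1 <;> simp [hc]
  have h4 : ∑ v, ((h.graph B).degree v : ℝ) = 2 * ((h.edges B).card : ℝ) := by
    rw [History.edges]
    exact_mod_cast h2
  linarith

open Classical in
/-- The number of edges at time `n`. -/
def edgeNumber (B : SimpleGraph V₀) (n : ℕ) : ℕ :=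
  ⌊(baseDegree B - (if Fintype.card V₀ = 1 then 1 else 0) + 2 * n) / 2⌋₊

/-- The number of edges is a function of n alone, so the sample size is deterministic; the floor in
`edgeNumber` rounds nothing. -/
lemma card_edges_eq (B : SimpleGraph V₀) {n : ℕ} (h : History V₀ (Fin 2) n) :
    (h.edges B).card = edgeNumber B n := by
  rw [edgeNumber, ← two_mul_card_edges B h, mul_div_cancel_left₀ _ two_ne_zero, Nat.floor_natCast]

lemma tendsto_edgeNumber (hB : B.Connected) : Tendsto (edgeNumber B) atTop atTop := by
  have ht := one_le_baseDegree hB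
  refine tendsto_atTop_mono (fun n => Nat.le_floor ?_) tendsto_id
  simp only [id]
  split_ifs <;> linarith

lemma isUniformSample_of_isEdgeSample {p : unitInterval}
    {F : (n : ℕ) → Ω → Finset (Sym2 (V₀ ⊕ Fin n))} (hF : IsEdgeSample ℙ B attr par p F) :
    IsUniformSample ℙ attr par
      (fun n => ⌊(p : ℝ) * (edgeNumber B n : ℝ)⌋₊) (fun _ h => h.edges B) F where
  measurableSet := hF.measurableSet
  le_card n h := by
    rw [card_edges_eq]
    exact floor_mul_le p.2.2 _
  law n h T hT := by
    rw [Finset.mem_powersetCard] at hT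
    have h1 := hF.law n h T hT.1
    rw [card_edges_eq] at h1 ⊢
    exact h1 hT.2

/-- Vertex counts above a degree threshold in the graph formed by an edge sample. -/
lemma tendstoInMeasure_upperCount_edge (hm : IsAttachmentModel ℙ π κ B a₀ attr par)
    (hB : B.Connected) (hκ : ∀ a b, 0 < κ a b) (hπ : ∀ b, 0 < π b) (hπ1 : ∑ b, π b = 1)
    {p : unitInterval} {F : (n : ℕ) → Ω → Finset (Sym2 (V₀ ⊕ Fin n))}
    (hF : IsEdgeSample ℙ B attr par p F) (a : Fin 2) (k : ℕ) :
    TendstoInMeasure ℙ (fun n ω => upperCount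
      (SimpleGraph.fromEdgeSet {e | e ∈ F n ω})
      ((historyAt attr par n ω).attr a₀) a k / (baseDegree B + 2 * n)) atTop
      (fun _ => π a / 2 * (thinning p (degreeLaw π κ a)).real (Set.Ici k)) := by
  classical
  have hφ := phiLimit_pos hκ hπ hπ1 a
  have hφ2 := phiLimit_lt_two hκ hπ hπ1 a
  have ht := one_le_baseDegree hB
  rw [thinning_real hφ hφ2]
  -- Every edge is incident to at most two vertices, so the overlaps are at most 4|E| ≤ 2T; no
  -- degree moment is needed.
  have hbadlim : Tendsto (fun n : ℕ => meanAt ℙ attr par n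
      (fun _ => 2 * (baseDegree B + 2 * (n : ℝ))) / (baseDegree B + 2 * n) ^ 2) atTop (𝓝 0) := by
    refine (tendsto_const_div_total B 2).congr fun n => ?_
    rw [meanAt_const hm]
    have hT : 0 < baseDegree B + 2 * (n : ℝ) := by positivity
    field_simp
  have hU := isUniformSample_of_isEdgeSample hF
  have := hU.tendstoInMeasure_sum hm hB hκ hπ hπ1 (tendsto_edgeNumber hB)
    (fun n h => card_edges_eq B h) p.2.1 p.2.2
    (tendsto_floor_mul_div (tendsto_edgeNumber hB) p.2.1)
    (W := fun n h v => (h.graph B).incidenceFinset v)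
    (fun n h v => ?_)
    (fun n h v => by
      rw [SimpleGraph.card_incidenceFinset_eq_degree]
      exact (degree_le_adeg B h v).trans (Nat.le_succ _))
    (fun n h => ?_) hbadlim (g := fun n h v => edgeIndicator (h.graph B) k v)
    (fun n h v A => by rw [edgeIndicator]; split_ifs <;> simp)
    (fun n h v T => by
      rw [edgeIndicator_inter]
      congr
      exact Subsingleton.elim _ _)
    (fun j => binomial_real_mem_unit p k j)
    (fun n h v => by
      rw [← bernoulliMean_edgeIndicator]
      congr) a
  · rw [one_mul] at this
    refine this.congr_left fun n => ?_
    -- Only almost surely is the sample contained in the edge set of the network.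
    filter_upwards [hU.ae_mem hm n] with ω hω
    have hsub : F n ω ⊆ ((historyAt attr par n ω).graph B).edgeFinset := by
      have := (Finset.mem_powersetCard.1 hω).1
      rw [History.edges] at this
      convert this
    rw [upperCount_fromEdgeSet _ _ _ hsub]
    congr 1
    refine Finset.sum_congr rfl fun v _ => ?_
    congr
  · rw [History.edges]
    intro e he
    rw [SimpleGraph.mem_edgeFinset]
    exact ((SimpleGraph.mem_incidenceFinset _ _ _).1 he).1
  · have h1 : ∀ e ∈ h.edges B, ((Finset.univ.filter fun v =>
        e ∈ (h.graph B).incidenceFinset v).card : ℝ) ^ 2 ≤ 4 := by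
      intro e _
      have h2 : (Finset.univ.filter fun v => e ∈ (h.graph B).incidenceFinset v).card ≤ 2 := by
        induction e using Sym2.ind with
        | _ x y =>
          refine (Finset.card_le_card (t := {x, y}) fun v hv => ?_).trans Finset.card_le_two
          have := ((SimpleGraph.mem_incidenceFinset _ _ _).1 (Finset.mem_filter.1 hv).2).2
          simpa using this
      have h3 : ((Finset.univ.filter fun v =>
        e ∈ (h.graph B).incidenceFinset v).card : ℝ) ≤ 2 := by exact_mod_cast h2
      exact (pow_le_pow_left₀ (Nat.cast_nonneg _) h3 2).trans (by norm_num)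
    have h4 := Finset.sum_le_sum h1
    rw [Finset.sum_const, nsmul_eq_mul] at h4
    have h5 := two_mul_card_edges B h
    have h6 : (0 : ℝ) ≤ if Fintype.card V₀ = 1 then 1 else 0 := by split_ifs <;> simp
    refine le_trans (le_of_eq ?_) (h4.trans (by linarith))
    refine Finset.sum_congr rfl fun x _ => ?_
    congr

lemma tendstoInMeasure_of_tendsto {x : ℕ → ℝ} {c : ℝ} (h : Tendsto x atTop (𝓝 c)) :
    TendstoInMeasure ℙ (fun n _ => x n) atTop (fun _ => c) := by
  refine tendstoInMeasure_of_integral_abs (fun n => integrable_const _) ?_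
  simpa using (tendsto_iff_norm_sub_tendsto_zero.1 h)

/-- The proportion of attribute `0` among the top vertices converges, if the vertex counts above
degree thresholds do. -/
lemma tendstoInMeasure_topProportion (hB : B.Connected) {V : ℕ → Ω → Type*}
    [∀ n ω, Fintype (V n ω)] (G : ∀ n ω, SimpleGraph (V n ω)) (A : ∀ n ω, V n ω → Fin 2)
    {μ ν : Measure ℕ} {q r α α' : ℝ} {k : ℕ} (hr : 0 < r)
    (h0 : ∀ j, TendstoInMeasure ℙ (fun n ω => upperCount (G n ω) (A n ω) 0 j /
      (baseDegree B + 2 * n)) atTop (fun _ => r * (q / 2 * μ.real (Set.Ici j))))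
    (h1 : ∀ j, TendstoInMeasure ℙ (fun n ω => upperCount (G n ω) (A n ω) 1 j /
      (baseDegree B + 2 * n)) atTop (fun _ => r * ((1 - q) / 2 * ν.real (Set.Ici j))))
    (hcard : TendstoInMeasure ℙ (fun n ω => (Fintype.card (V n ω) : ℝ) /
      (baseDegree B + 2 * n)) atTop (fun _ => r / 2))
    (hα₀ : 0 < α)
    (hlow : q * μ.real (Set.Ici (k + 1)) + (1 - q) * ν.real (Set.Ici (k + 1)) < α)
    (hα' : q * μ.real (Set.Ici k) + (1 - q) * ν.real (Set.Ici k) = α') (hαα' : α < α') :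
    TendstoInMeasure ℙ (fun n ω => topProportion (G n ω) (A n ω) 0 α) atTop
      (fun _ => q * μ.real (Set.Ici k) / α') := by
  have ht := one_le_baseDegree hB
  have hsum : r * (q / 2 * μ.real (Set.Ici k)) + r * ((1 - q) / 2 * ν.real (Set.Ici k)) =
      r / 2 * α' := by
    rw [← hα']
    ring
  have hlim := tendstoInMeasure_ratio (h0 k) (h1 k) (h0 (k + 1)) (h1 (k + 1)) hcard
    (Y := fun n ω => topProportion (G n ω) (A n ω) 0 α) (α := α) ?_ ?_ ?_ fun n => ?_
  · have heq : r * (q / 2 * μ.real (Set.Ici k)) / (r * (q / 2 * μ.real (Set.Ici k)) +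
        r * ((1 - q) / 2 * ν.real (Set.Ici k))) = q * μ.real (Set.Ici k) / α' := by
      rw [hsum, show r * (q / 2 * μ.real (Set.Ici k)) = r / 2 * (q * μ.real (Set.Ici k)) by ring,
        mul_div_mul_left _ _ (by positivity)]
    rwa [heq] at hlim
  · have := mul_lt_mul_of_pos_left hlow (half_pos hr)
    linarith
  · rw [hsum]
    have := mul_lt_mul_of_pos_left hαα' (half_pos hr)
    linarith
  · rw [hsum]
    have : 0 < α' := hα₀.trans hαα'
    positivity
  · have hT : 0 < baseDegree B + 2 * (n : ℝ) := by positivity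
    refine Eventually.of_forall fun ω hl hh => ?_
    rw [← add_div, mul_div_assoc', div_lt_div_iff_of_pos_right hT] at hl
    rw [← add_div, mul_div_assoc', div_le_div_iff_of_pos_right hT] at hh
    rw [← add_div, div_div_div_cancel_right₀ hT.ne']
    exact topProportion_eq_div (G n ω) (A n ω) hl hh

end Schemes

end

/-! ### Assembly of the limits of the two proportions -/

theorem theorem6p3 {V₀ Ω : Type*} [Fintype V₀] [MeasurableSpace Ω]
    (ℙ : Measure Ω) [IsProbabilityMeasure ℙ]
    -- the parameters of the model: two attributes, type one is `0 : Fin 2`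
    (q : ℝ) (hq₀ : 0 < q) (hq : q < 1 / 2)
    (κ : Fin 2 → Fin 2 → ℝ) (hκ : ∀ a b, 0 < κ a b)
    -- the base graph and its attributes
    (B : SimpleGraph V₀) (hB : B.Connected) (a₀ : V₀ → Fin 2)
    -- the sequence of networks
    (attr : ℕ → Ω → Fin 2) (par : (n : ℕ) → Ω → V₀ ⊕ Fin n)
    (hmodel : IsAttachmentModel ℙ ![q, 1 - q] κ B a₀ attr par)
    (p : unitInterval) (α : ℝ) (hα₀ : 0 < α) (hα₁ : α < 1)
    -- the limiting degree laws
    (D₁ D₂ : Measure ℕ) (hD₁ : D₁ = degreeLaw ![q, 1 - q] κ 0)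
    (hD₂ : D₂ = degreeLaw ![q, 1 - q] κ 1)
    -- the percentiles, and the actual masses above them
    (k : ℕ) (hk : IsPercentile (mixture q D₁ D₂) α k)
    (kp : ℕ) (hkp : IsPercentile (mixture q (thinning p D₁) (thinning p D₂)) α kp)
    (α' αp' : ℝ) (hα' : α' = (mixture q D₁ D₂).real (Set.Ici k))
    (hαp' : αp' = (mixture q (thinning p D₁) (thinning p D₂)).real (Set.Ici kp))
    (hαα' : α < α') (hααp' : α < αp') :
    (0 < p → ∀ S : (n : ℕ) → Ω → Finset (V₀ ⊕ Fin n),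
      IsNodeSample ℙ attr par p S →
        TendstoInMeasure ℙ
          (fun n ω => nodeBias B a₀ 0 α (historyAt attr par n ω) (S n ω)) atTop
          (fun _ => q * ((thinning p D₁).real (Set.Ici kp) / αp' - D₁.real (Set.Ici k) / α'))) ∧
    (∀ F : (n : ℕ) → Ω → Finset (Sym2 (V₀ ⊕ Fin n)),
      IsEdgeSample ℙ B attr par p F →
        TendstoInMeasure ℙ
          (fun n ω => edgeBias B a₀ 0 α (historyAt attr par n ω) (F n ω)) atTop
          (fun _ => q * ((thinning p D₁).real (Set.Ici kp) / αp' - D₁.real (Set.Ici k) / α'))) := by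
  have hq1 : q ≤ 1 := by linarith
  have hπ : ∀ b, 0 < (![q, 1 - q] : Fin 2 → ℝ) b := by
    intro b
    fin_cases b
    · exact hq₀
    · change 0 < 1 - q
      linarith
  have hπ1 : ∑ b, (![q, 1 - q] : Fin 2 → ℝ) b = 1 := by simp
  have hD1 : IsProbabilityMeasure D₁ := hD₁ ▸
    isProbabilityMeasure_degreeLaw (phiLimit_pos hκ hπ hπ1 0) (phiLimit_lt_two hκ hπ hπ1 0)
  have hD2 : IsProbabilityMeasure D₂ := hD₂ ▸
    isProbabilityMeasure_degreeLaw (phiLimit_pos hκ hπ hπ1 1) (phiLimit_lt_two hκ hπ hπ1 1)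
  have := isProbabilityMeasure_thinning p D₁
  have := isProbabilityMeasure_thinning p D₂
  have := isProbabilityMeasure_mixture hq₀.le hq1 D₁ D₂
  have := isProbabilityMeasure_mixture hq₀.le hq1 (thinning p D₁) (thinning p D₂)
  have hlow := hk.real_Ici_succ_lt
  have hlowp := hkp.real_Ici_succ_lt
  rw [mixture_real hq₀.le hq1] at hα' hαp' hlow hlowp
  have hcard : Tendsto (fun n : ℕ => (Fintype.card (V₀ ⊕ Fin n) : ℝ) / (History.baseDegree B + 2 * n))
      atTop (𝓝 (1 / 2)) := by
    refine (tendsto_linear_div_total hB (Fintype.card V₀)).congr fun n => ?_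
    rw [Fintype.card_sum, Fintype.card_fin, Nat.cast_add]
  have hfull : TendstoInMeasure ℙ (fun n ω => topProportion ((historyAt attr par n ω).graph B)
      ((historyAt attr par n ω).attr a₀) 0 α) atTop (fun _ => q * D₁.real (Set.Ici k) / α') := by
    refine tendstoInMeasure_topProportion hB _ _ (μ := D₁) (ν := D₂) one_pos (fun j => ?_)
      (fun j => ?_) (tendstoInMeasure_of_tendsto hcard) hα₀ hlow hα'.symm hαα'
    · rw [one_mul, hD₁]
      exact tendstoInMeasure_upperCount hmodel hB hκ hπ hπ1 0 j
    · rw [one_mul, hD₂]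
      exact tendstoInMeasure_upperCount hmodel hB hκ hπ hπ1 1 j
  have hlim : q * ((thinning p D₁).real (Set.Ici kp) / αp' - D₁.real (Set.Ici k) / α') =
      q * (thinning p D₁).real (Set.Ici kp) / αp' - q * D₁.real (Set.Ici k) / α' := by
    rw [mul_sub, mul_div_assoc, mul_div_assoc]
  rw [hlim]
  refine ⟨fun hp S hS => ?_, fun F hF => ?_⟩
  · refine tendstoInMeasure_sub_const ?_ hfull
    -- Counts and number of vertices all carry the factor r = p, which cancels in the proportion;
    -- this is where p > 0 enters.
    refine tendstoInMeasure_topProportion hB _ _ (μ := thinning p D₁) (ν := thinning p D₂)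
      (r := p) hp (fun j => ?_) (fun j => ?_) ?_ hα₀ hlowp hαp'.symm hααp'
    · rw [hD₁]
      exact tendstoInMeasure_upperCount_node hmodel hB hκ hπ hπ1 hS 0 j
    · rw [hD₂]
      exact tendstoInMeasure_upperCount_node hmodel hB hκ hπ hπ1 hS 1 j
    · have h1 := (tendsto_floor_mul_div (tendsto_card_add V₀) p.2.1).mul
        (tendsto_linear_div_total hB (Fintype.card V₀))
      rw [mul_one_div] at h1
      refine (tendstoInMeasure_of_tendsto h1).congr_left fun n => ?_
      filter_upwards [(isUniformSample_of_isNodeSample hS).ae_mem hmodel n] with ω hω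
      have hc : Fintype.card ({v | v ∈ S n ω} : Set (V₀ ⊕ Fin n)) =
          ⌊(p : ℝ) * ((Fintype.card V₀ + n : ℕ) : ℝ)⌋₊ := by
        rw [← (Finset.mem_powersetCard.1 hω).2]
        exact Fintype.card_coe _
      have hpos : 0 < ((Fintype.card V₀ + n : ℕ) : ℝ) := by
        have := hB.nonempty
        have := Fintype.card_pos (α := V₀)
        exact_mod_cast Nat.add_pos_left this n
      rw [hc, ← Nat.cast_add, div_mul_div_cancel₀ hpos.ne']
  · refine tendstoInMeasure_sub_const ?_ hfull
    -- All vertices are kept, so the factor is r = 1 and p = 0 is allowed.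
    refine tendstoInMeasure_topProportion hB _ _ (μ := thinning p D₁) (ν := thinning p D₂)
      one_pos (fun j => ?_) (fun j => ?_) (tendstoInMeasure_of_tendsto hcard) hα₀ hlowp
      hαp'.symm hααp'
    · rw [one_mul, hD₁]
      exact tendstoInMeasure_upperCount_edge hmodel hB hκ hπ hπ1 hF 0 j
    · rw [one_mul, hD₂]
      exact tendstoInMeasure_upperCount_edge hmodel hB hκ hπ hπ1 hF 1 j
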